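/- Let $G$ be a simple group of order $168$, $504$ or $360$. Let $\chi$ be an irreducible character of $G$ over $\overline{\mathbb{Q}}$, and suppose that $\#G\neq 360$ or $\deg\chi\neq 8$. If $7\nmid\#G$, put $k=2^2\cdot3\cdot5$. If $7\mid\#G$, put $k=3\cdot 7$, except that $k=3^2\cdot 7$ when $\#G=504$ and $\chi$ has a value outside $\mathbb{Q}(\zeta_{21})$. For a finite group $\Gamma$ and a character $\varphi$ of $\Gamma$ put $e_\varphi^{\Gamma}=\frac{\varphi(1)}{\#\Gamma}\sum_{\gamma\in\Gamma}\varphi(\gamma^{-1})\gamma$, and write $e_\chi=e_\chi^G$. Then there are subgroups $H_1,\dots,H_m$ of $G$, characters $\psi_i$ of degree $1$ of $H_i$, integers $a_i$ with $$\chi=\sum_{i=1}^m a_i\,\mathrm{Ind}_{H_i}^G(\psi_i),$$ and a finite set $S$ of primes such that the following holds for every prime $p\nmid\#G$ with $p\notin S$ and every embedding $\overline{\mathbb{Q}}\hookrightarrow\overline{\mathbb{Q}_p}$ (through which all characters are regarded as $p$-adic ones). The elements $e_\chi$ and $e_{\psi_i}^{H_i}$ lie in $\mathbb{Z}_p[\zeta_k][G]$,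 and for every $\mathbb{Z}_p[\zeta_k][G]$-module $M$ there is a $\mathbb{Z}_p[\zeta_k]$-submodule $N$ of $M$ such that 1. $e_\chi M\simeq N^{(\deg\chi)}$ as $\mathbb{Z}_p$-modules, where $N^{(n)}$ is the direct sum of $n$ copies of $N$; 2. if $M$ is finite, then $\#N=\prod_{i=1}^m\bigl(\#e_{\psi_i}^{H_i}M\bigr)^{a_i}$. -/

import Mathlib

open scoped MonoidAlgebra

noncomputable section

/-- The field `ℚ̄` in which all characters take their values. -/
abbrev QBar : Type := AlgebraicClosure ℚ

/-- The cyclotomic field `ℚ(ζ_n)` inside `ℚ̄` (for `n > 0`). -/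
def cyclotomicSubfield (n : ℕ) : IntermediateField ℚ QBar :=
  IntermediateField.adjoin ℚ {z : QBar | z ^ n = 1}

/-- The ring `ℤ_p[ζ_k]` inside the algebraic closure of `ℚ_p` (for `k > 0`), generated over `ℤ_p`
by all `k`-th roots of unity, that is, by one primitive `k`-th root of unity. -/
abbrev ZpZeta (p : ℕ) [Fact p.Prime] (k : ℕ) : Subalgebra ℤ_[p] (PadicAlgCl p) :=
  Algebra.adjoin ℤ_[p] {z : PadicAlgCl p | z ^ k = 1}

open scoped Classical in
/-- The number `k` attached to a character `χ` of `G`: it is `3 · 7` if `7` divides `#G` and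
`2² · 3 · 5` otherwise, except that it is `3² · 7` for the characters of the group of order `504`
that are not `ℚ(ζ_21)`-valued. -/
def rootOrder (G : Type*) (χ : G → QBar) : ℕ :=
  if 7 ∣ Nat.card G then
    (if Nat.card G = 504 ∧ ∃ g, χ g ∉ cyclotomicSubfield 21 then 3 ^ 2 * 7 else 3 * 7)
  else 2 ^ 2 * 3 * 5

open scoped Classical in
/-- The character of `G` induced from the degree one character `ψ` of the subgroup `H`:
`(Ind_H^G ψ)(g) = (1 / #H) ∑_{x ∈ G} ψ°(x⁻¹ g x)`, where `ψ°` is `ψ` extended by `0`. -/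
def indChar {G : Type*} [Group G] [Fintype G] (H : Subgroup G) (ψ : H →* QBar) (g : G) : QBar :=
  (Nat.card H : QBar)⁻¹ *
    ∑ x : G, if h : x⁻¹ * g * x ∈ H then ψ ⟨x⁻¹ * g * x, h⟩ else 0

/-- The element `e_φ = (φ(1) / #Γ) ∑_{γ ∈ Γ} φ(γ⁻¹) γ` of the group ring `F[Γ]`. -/
def charIdem {Γ F : Type*} [Group Γ] [Fintype Γ] [Field F] (φ : Γ → F) : F[Γ] :=
  ∑ γ : Γ, MonoidAlgebra.single γ (φ 1 / (Nat.card Γ : F) * φ γ⁻¹)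

open scoped Classical in
/-- The element `e_ψ^H` of a subgroup `H` of `G`, as an element of the group ring `F[G]`. -/
def subgroupIdem {G F : Type*} [Group G] [Fintype G] [Field F] (H : Subgroup G) (ψ : H → F) :
    F[G] :=
  MonoidAlgebra.mapDomain (fun h : H => (h : G)) (charIdem ψ)

/-- The inclusion of `ℤ_p[ζ_k][G]` into the group ring of `G` over the algebraic closure
of `ℚ_p`. -/
def groupRingIncl (p : ℕ) [Fact p.Prime] (k : ℕ) (G : Type*) [Group G] :
    (ZpZeta p k)[G] →+* (PadicAlgCl p)[G] :=
  MonoidAlgebra.mapRingHom G (algebraMap (ZpZeta p k) (PadicAlgCl p))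

/-- The subset `e M = {e x | x ∈ M}` of an `O[G]`-module `M`, an `O`-submodule of `M`. -/
def idemPart {O G : Type*} [CommRing O] [Group G] (e : O[G]) (M : Type*) [AddCommGroup M]
    [Module O M] [Module O[G] M] [IsScalarTower O O[G] M] : Submodule O M :=
  LinearMap.range (Algebra.lsmul O O M e)

end

/-!
The characters of degree one in a Brauer induction `χ = ∑ a_i Ind ψ_i` give left ideals
`ℚ(ζ_k)[G] e_{ψ_i}` with characters `Ind ψ_i`. Moving the terms with negative `a_i` to the other
side, the formula for `χ` compares two direct sums of such ideals: the first one has the character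
of the second one plus `χ`. As `ℚ(ζ_k)[G]` is semisimple, the first sum is the direct sum of the
second one and a module with character `χ` (`exists_equiv_prod_of_char`). So `χ` is realized over
`ℚ(ζ_k)`; Schur's relations give matrix units `E i j` in `ℚ(ζ_k)[G]` with `∑ E i i = e_χ`, and the
isomorphism of left ideals becomes a pair of matrices `u`, `v` making the family of the `e_{ψ_i}`
with `a_i > 0` equivalent to the family of the `e_{ψ_i}` with `a_i < 0` together with `E i i`
(`exists_matUnits_idemEquivVia`). All of this involves finitely many elements of `ℚ(ζ_k)[G]`, whose
coefficients lie in `ℤ_p[ζ_k]` for almost all `p`. For such `p` the identities hold in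
`ℤ_p[ζ_k][G]`, and they give `e_χ M ≃ N ^ deg χ` and the formula for `#N`, with `N = E i i M`
(`exists_idempotents_of_brauer`).

It remains to find a Brauer induction with `ψ_i` valued in `ℚ(ζ_k)`. Brauer's theorem with all
`ψ_i` valued in the `n`-th roots of unity holds if `n` is a multiple of the exponent of `G`
(`virtualCharacters_le_monomialSpan`); it is proved for groups whose `q`-subgroups have commutative
subgroups of index at most two, where monomiality is elementary. For `n`-th roots of unity with `n`
smaller than the exponent, there is a version for `ℚ(ζ_n)`-valued characters, when the exponent
divides `nr` with a prime `r ∣ n` (`cyclotomicCharacters_le_monomialSpan`). At the primes other than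
`r` it follows from the full theorem by projecting `ℚ(ζ_nr)` onto `ℚ(ζ_n)`, which costs
a denominator `r`; at `r` it follows from Brauer's argument, if the elementary subgroups can be
handled directly: for commutative ones, the multiplicities are constant on Galois orbits, and the
orbit sums are induced characters.

Up to the sign `-1`, the roots of unity of order `k` are those of order `n = 60` for `#G = 360`,
`n = 42` or `n = 126` for the other orders. Sylow's theorems, transfer and counting show that `G` has
exponent dividing `60` when `#G = 360` and `126` when `#G = 504`. When `#G = 504` and `χ` has values
in `ℚ(ζ_21)`, the second version applies with `n = 42` and `r = 3`, as the `3`-subgroups are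
commutative. When `#G = 168`, the exponent divides `42 * 2`; an element of order four is conjugate to
its inverse, so all characters have values in `ℚ(ζ_42)`, and the second version applies with `r = 2`,
the noncommutative Sylow `2`-subgroups having Klein four-subgroups
(`exists_involution_ne_of_168`).
-/

open Module

/-! ### Comparing modules by their characters -/

section GroupAlgebraModules

/-- The character of a module over the group algebra `F[G]`. -/
noncomputable def modChar (F : Type*) {G : Type*} [Field F] [Group G] (V : Type*) [AddCommGroup V]
    [Module F V] [Module F[G] V] [IsScalarTower F F[G] V] (g : G) : F :=
  (Representation.ofModule' (k := F) (G := G) V).character g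

theorem ofModule'_apply {F G V : Type*} [Field F] [Group G] [AddCommGroup V]
    [Module F V] [Module F[G] V] [IsScalarTower F F[G] V] (g : G) (v : V) :
    Representation.ofModule' (k := F) (G := G) V g v = MonoidAlgebra.of F G g • v := rfl

theorem finite_submodule {F G V : Type*} [Field F] [Group G] [AddCommGroup V]
    [Module F V] [Module F[G] V] [IsScalarTower F F[G] V] [FiniteDimensional F V]
    (p : Submodule F[G] V) : FiniteDimensional F p :=
  Module.Finite.of_injective (p.subtype.restrictScalars F) p.injective_subtype

theorem modChar_congr {F G V W : Type*} [Field F] [Group G] [AddCommGroup V]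
    [Module F V] [Module F[G] V] [IsScalarTower F F[G] V] [AddCommGroup W]
    [Module F W] [Module F[G] W] [IsScalarTower F F[G] W] (φ : V ≃ₗ[F[G]] W) (g : G) :
    modChar F V g = modChar F W g := by
  rw [modChar, modChar, Representation.character, Representation.character,
    ← LinearMap.trace_conj' _ (φ.restrictScalars F)]
  congr 1
  ext w
  simp [ofModule'_apply, LinearEquiv.conj_apply]

theorem modChar_prod {F G V W : Type*} [Field F] [Group G] [AddCommGroup V]
    [Module F V] [Module F[G] V] [IsScalarTower F F[G] V] [AddCommGroup W]
    [Module F W] [Module F[G] W] [IsScalarTower F F[G] W] [FiniteDimensional F V]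
    [FiniteDimensional F W] (g : G) :
    modChar F (V × W) g = modChar F V g + modChar F W g := by
  rw [modChar, modChar, modChar, Representation.character, Representation.character,
    Representation.character, ← LinearMap.trace_prodMap']
  rfl

theorem linear_of_intertwining {F G V W : Type*} [Field F] [Group G] [AddCommGroup V]
    [Module F V] [Module F[G] V] [IsScalarTower F F[G] V] [AddCommGroup W]
    [Module F W] [Module F[G] W] [IsScalarTower F F[G] W]
    (T : Representation.IntertwiningMap (Representation.ofModule' (k := F) (G := G) V)
      (Representation.ofModule' (k := F) (G := G) W)) :
    ∃ T' : V →ₗ[F[G]] W, ∀ v, T' v = T v := by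
  refine ⟨MonoidAlgebra.equivariantOfLinearOfComm T.toLinearMap fun g v => ?_, fun v => rfl⟩
  exact Representation.IntertwiningMap.isIntertwining _ _ T g v

/-- The `F[G]`-modules whose character is, after extension of scalars, larger than that of `W` by
the character of a representation over a larger field `L`, contain `W` as a direct summand. The
extension field is needed since the difference is not known to be a character over `F`. -/
theorem exists_equiv_prod_of_char {F L G : Type*} [Field F] [CharZero F] [Field L] [CharZero L]
    [Algebra F L] [Group G] [Fintype G] {U : Type*} [AddCommGroup U] [Module L U]
    [FiniteDimensional L U] (ρ : Representation L G U) (n : ℕ) :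
    ∀ (V W : Type _) [AddCommGroup V] [Module F V] [Module F[G] V] [IsScalarTower F F[G] V]
      [AddCommGroup W] [Module F W] [Module F[G] W] [IsScalarTower F F[G] W]
      [FiniteDimensional F V] [FiniteDimensional F W],
      finrank F W = n →
      (∀ g : G, algebraMap F L (modChar F V g) = algebraMap F L (modChar F W g) + ρ.character g) →
      ∃ X : Submodule F[G] V, Nonempty (V ≃ₗ[F[G]] W × X) := by
  induction n using Nat.strong_induction_on with
  | _ n ih =>
  intro V W _ _ _ _ _ _ _ _ _ _ hn hχ
  rcases Nat.eq_zero_or_pos n with h0 | hpos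
  · subst h0
    have : Subsingleton W := Module.finrank_zero_iff.mp hn
    refine ⟨⊤, ⟨?_⟩⟩
    exact Submodule.topEquiv.symm.trans
      { toFun := fun x => (0, x)
        map_add' := by simp
        map_smul' := by simp
        invFun := fun x => x.2
        left_inv := fun x => rfl
        right_inv := fun x => Prod.ext (Subsingleton.elim _ _) rfl }
  have hcG : (Nat.card G : F) ≠ 0 := by exact_mod_cast Nat.card_pos.ne'
  have hcL : (Nat.card G : L) ≠ 0 := by exact_mod_cast Nat.card_pos.ne'
  let _ : Invertible (Nat.card G : F) := invertibleOfNonzero hcG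
  let _ : Invertible (Nat.card G : L) := invertibleOfNonzero hcL
  have hntW : Nontrivial W := Module.nontrivial_of_finrank_pos (R := F) (by omega)
  -- a nonzero homomorphism from `W` to `V`, found by computing the dimension of `Hom(W, V)`
  obtain ⟨T, hT⟩ : ∃ T : W →ₗ[F[G]] V, T ≠ 0 := by
    by_contra! hall
    let rV := Representation.ofModule' (k := F) (G := G) V
    let rW := Representation.ofModule' (k := F) (G := G) W
    let rL : Representation L G (TensorProduct F L W) :=
      { toFun := fun g => (rW g).baseChange L
        map_one' := by simp [Module.End.one_eq_id]
        map_mul' := fun a b => by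
          rw [map_mul, Module.End.mul_eq_comp, LinearMap.baseChange_comp]; rfl }
    have e1 := Representation.card_inv_mul_sum_char_mul_char_eq_finrank rW rV
    have e2 := Representation.card_inv_mul_sum_char_mul_char_eq_finrank rW rW
    have e3 := Representation.card_inv_mul_sum_char_mul_char_eq_finrank rL ρ
    have hL : ∀ g, rL.character g = algebraMap F L (rW.character g) := fun g => by
      rw [Representation.character, Representation.character]
      exact LinearMap.trace_baseChange (rW g) L
    have hsub : Subsingleton (Representation.IntertwiningMap rW rV) := by
      refine ⟨fun a b => ?_⟩
      have key : ∀ a : Representation.IntertwiningMap rW rV, a = 0 := fun a => by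
        obtain ⟨a', ha'⟩ := linear_of_intertwining a
        ext v
        have := ha' v
        rw [hall a'] at this
        simpa using this.symm
      rw [key a, key b]
    rw [Module.finrank_zero_of_subsingleton] at e1
    have e4 : ((finrank F (Representation.IntertwiningMap rW rW) : ℕ) : L)
        + (finrank L (Representation.IntertwiningMap rL ρ) : ℕ) = 0 := by
      have e1' := congrArg (algebraMap F L) e1
      have e2' := congrArg (algebraMap F L) e2
      simp only [map_mul, map_sum, map_inv₀, map_natCast, Nat.cast_zero, map_zero] at e1' e2'
      rw [← e2', ← e3, ← mul_add, ← Finset.sum_add_distrib, ← e1']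
      congr 1
      refine Finset.sum_congr rfl fun g _ => ?_
      have := hχ g
      simp only [modChar] at this
      rw [hL, this]
      ring
    have e5 : finrank F (Representation.IntertwiningMap rW rW) = 0 := by
      have : ((finrank F (Representation.IntertwiningMap rW rW)
        + finrank L (Representation.IntertwiningMap rL ρ) : ℕ) : L) = 0 := by exact_mod_cast e4
      have := Nat.cast_eq_zero.mp this
      omega
    have : Subsingleton (Representation.IntertwiningMap rW rW) := by
      have : FiniteDimensional F (Representation.IntertwiningMap rW rW) :=
        Module.Finite.equiv (Representation.invariantsEquivIntertwiningMap rW rW)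
      exact Module.finrank_zero_iff.mp e5
    obtain ⟨w, hw⟩ := exists_ne (0 : W)
    apply hw
    have := congrArg (fun t : Representation.IntertwiningMap rW rW => t w)
      (Subsingleton.elim (Representation.IntertwiningMap.id rW) 0)
    simpa using this
  obtain ⟨W₁, hW₁⟩ := exists_isCompl (LinearMap.ker T)
  obtain ⟨V₁, hV₁⟩ := exists_isCompl (LinearMap.range T)
  have := finite_submodule (F := F) (LinearMap.ker T)
  have := finite_submodule (F := F) (LinearMap.range T)
  have := finite_submodule (F := F) W₁
  have := finite_submodule (F := F) V₁
  let eW := Submodule.prodEquivOfIsCompl _ _ hW₁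
  let eV := Submodule.prodEquivOfIsCompl _ _ hV₁
  let eT : W₁ ≃ₗ[F[G]] LinearMap.range T :=
    (Submodule.quotientEquivOfIsCompl _ _ hW₁).symm.trans T.quotKerEquivRange
  have hlt : finrank F (LinearMap.ker T) < n := by
    have h1 : finrank F (LinearMap.ker T) + finrank F W₁ = n := by
      rw [← hn, ← (eW.restrictScalars F).finrank_eq, Module.finrank_prod]
    have h2 : finrank F W₁ ≠ 0 := by
      rw [(eT.restrictScalars F).finrank_eq]
      intro h
      have hs : Subsingleton (LinearMap.range T) := Module.finrank_zero_iff.mp h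
      apply hT
      ext w
      exact congrArg Subtype.val (Subsingleton.elim (⟨T w, w, rfl⟩ : LinearMap.range T) 0)
    omega
  obtain ⟨X, ⟨eX⟩⟩ := ih _ hlt V₁ (LinearMap.ker T) rfl fun g => by
    have h := hχ g
    rw [← modChar_congr eW, ← modChar_congr eV, modChar_prod, modChar_prod, modChar_congr eT,
      map_add, map_add] at h
    linear_combination h
  refine ⟨X.map V₁.subtype, ⟨?_⟩⟩
  let eX' : X ≃ₗ[F[G]] X.map V₁.subtype :=
    Submodule.equivMapOfInjective _ V₁.injective_subtype X
  exact eV.symm.trans <| ((eT.symm.prodCongr eX)).trans <|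
    (LinearEquiv.prodAssoc F[G] _ _ _).symm.trans <|
    ((LinearEquiv.prodComm _ _ _).trans eW).prodCongr eX'

end GroupAlgebraModules

/-! ### Left ideals generated by idempotents -/

section LeftIdeals

theorem modChar_pi {F G J : Type*} [Field F] [Group G] [Fintype J] (V : J → Type*)
    [∀ j, AddCommGroup (V j)] [∀ j, Module F (V j)] [∀ j, Module F[G] (V j)]
    [∀ j, IsScalarTower F F[G] (V j)] [∀ j, FiniteDimensional F (V j)] (g : G) :
    modChar F (∀ j, V j) g = ∑ j, modChar F (V j) g := by
  classical
  let r := fun j => Representation.ofModule' (k := F) (G := G) (V j) g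
  have h : Representation.ofModule' (k := F) (G := G) (∀ j, V j) g =
      ∑ j, (LinearMap.single F V j ∘ₗ r j) ∘ₗ LinearMap.proj j := by
    ext1 j
    ext v k
    simp only [LinearMap.comp_apply, LinearMap.sum_apply, Finset.sum_apply, ofModule'_apply, r,
      LinearMap.single_apply, LinearMap.proj_apply, Pi.smul_apply]
    rw [Finset.sum_eq_single k (fun i _ hi => by simp [Pi.single_eq_of_ne hi.symm]) (by simp)]
    simp
  rw [modChar, Representation.character, h, map_sum]
  refine Finset.sum_congr rfl fun j _ => ?_
  rw [LinearMap.comp_assoc, LinearMap.trace_comp_comm', LinearMap.comp_assoc]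
  have : (LinearMap.proj j : (∀ j, V j) →ₗ[F] V j) ∘ₗ LinearMap.single F V j = LinearMap.id := by
    ext; simp
  rw [this, LinearMap.comp_id]
  rfl

/-- The character of the left ideal `F[G] f` generated by an idempotent `f`. -/
theorem modChar_span_idempotent {F G : Type*} [Field F] [Group G] [Fintype G] (f : F[G])
    (hf : f * f = f) (g : G) :
    modChar F (Submodule.span F[G] {f}) g = ∑ h : G, f.coeff (h⁻¹ * g⁻¹ * h) := by
  classical
  have hmem : ∀ x : F[G], x * f ∈ Submodule.span F[G] {f} := fun x =>
    Submodule.mem_span_singleton.mpr ⟨x, rfl⟩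
  let b : Basis G F F[G] := Basis.ofRepr (MonoidAlgebra.coeffLinearEquiv F)
  have : FiniteDimensional F F[G] := Module.Finite.of_basis b
  have := finite_submodule (F := F) (Submodule.span F[G] {f})
  let π : F[G] →ₗ[F] Submodule.span F[G] {f} :=
    { toFun := fun x => ⟨x * f, hmem x⟩
      map_add' := fun x y => Subtype.ext (add_mul x y f)
      map_smul' := fun c x => Subtype.ext (smul_mul_assoc c x f) }
  let ι : Submodule.span F[G] {f} →ₗ[F] F[G] := (Submodule.span F[G] {f}).subtype.restrictScalars F
  have hfix : ∀ x ∈ Submodule.span F[G] {f}, x * f = x := fun x hx => by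
    obtain ⟨y, rfl⟩ := Submodule.mem_span_singleton.mp hx
    rw [smul_eq_mul, mul_assoc, hf]
  have hπι : Representation.ofModule' (k := F) (G := G) (Submodule.span F[G] {f}) g =
      π ∘ₗ (LinearMap.mulLeft F (MonoidAlgebra.of F G g) ∘ₗ ι) := by
    ext1 x
    refine Subtype.ext ?_
    change MonoidAlgebra.of F G g * (x : F[G]) = MonoidAlgebra.of F G g * (x : F[G]) * f
    rw [mul_assoc, hfix x x.2]
  rw [modChar, Representation.character, hπι, LinearMap.trace_comp_comm',
    LinearMap.trace_eq_matrix_trace F b, Matrix.trace]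
  refine Finset.sum_congr rfl fun h _ => ?_
  rw [Matrix.diag_apply, LinearMap.toMatrix_apply]
  change (MonoidAlgebra.of F G g * (b h * f)).coeff h = _
  have hb : b h = MonoidAlgebra.single h 1 := by
    apply b.repr.injective
    rw [Basis.repr_self]
    rfl
  rw [hb, MonoidAlgebra.of_apply, MonoidAlgebra.coeff_single_mul_apply,
    MonoidAlgebra.coeff_single_mul_apply]
  simp [mul_assoc]

end LeftIdeals

/-! ### Matrix units from Schur's orthogonality relations -/

section MatrixUnits

/-- The elements `(n / #G) ∑ r(g⁻¹)_{ji} g` of the group algebra attached to a matrix representation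
`r`; for absolutely irreducible `r` they are matrix units. -/
noncomputable def matUnit {F G : Type*} [Field F] [Group G] [Fintype G] {n : ℕ}
    (r : G →* Matrix (Fin n) (Fin n) F) (i j : Fin n) : F[G] :=
  ∑ g : G, MonoidAlgebra.single g ((n : F) / Nat.card G * r g⁻¹ j i)

/-- Schur's orthogonality relations for the coefficients of a matrix representation. -/
def SchurRelations {F G : Type*} [Field F] [Group G] [Fintype G] {n : ℕ}
    (r : G →* Matrix (Fin n) (Fin n) F) : Prop :=
  ∀ s j k t, ∑ g : G, r g s j * r g⁻¹ k t = if j = k ∧ s = t then (Nat.card G : F) / n else 0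

theorem coeff_matUnit {F G : Type*} [Field F] [Group G] [Fintype G] {n : ℕ}
    (r : G →* Matrix (Fin n) (Fin n) F) (i j : Fin n) (g : G) :
    (matUnit r i j).coeff g = (n : F) / Nat.card G * r g⁻¹ j i := by
  classical
  simp [matUnit, Finsupp.single_apply]

theorem coeff_mul_eq_sum {F G : Type*} [Semiring F] [Group G] [Fintype G] (a b : F[G]) (m : G) :
    (a * b).coeff m = ∑ g : G, a.coeff g * b.coeff (g⁻¹ * m) := by
  classical
  have ha : a = ∑ g : G, MonoidAlgebra.single g (a.coeff g) := by
    ext g; simp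
  conv_lhs => rw [ha]
  rw [Finset.sum_mul, MonoidAlgebra.coeff_sum, Finsupp.finsetSum_apply]
  exact Finset.sum_congr rfl fun g _ => MonoidAlgebra.coeff_single_mul_apply ..

theorem matUnit_mul_matUnit {F G : Type*} [Field F] [CharZero F] [Group G] [Fintype G] {n : ℕ}
    (r : G →* Matrix (Fin n) (Fin n) F) (hr : SchurRelations r) (i j k l : Fin n) :
    matUnit r i j * matUnit r k l = if j = k then matUnit r i l else 0 := by
  have hn : (n : F) ≠ 0 := by
    have : n ≠ 0 := fun h => by subst h; exact i.elim0
    exact_mod_cast this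
  have hG : (Nat.card G : F) ≠ 0 := by exact_mod_cast Nat.card_pos.ne'
  ext m
  have h1 : ∀ g, (matUnit r i j).coeff g * (matUnit r k l).coeff (g⁻¹ * m) =
      ∑ s, ((n : F) / Nat.card G) ^ 2 * r m⁻¹ l s * (r g s k * r g⁻¹ j i) := fun g => by
    rw [coeff_matUnit, coeff_matUnit, mul_inv_rev, inv_inv, map_mul, Matrix.mul_apply,
      Finset.mul_sum, Finset.mul_sum]
    exact Finset.sum_congr rfl fun s _ => by ring
  rw [coeff_mul_eq_sum, Finset.sum_congr rfl fun g _ => h1 g, Finset.sum_comm]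
  simp_rw [← Finset.mul_sum]
  rw [Finset.sum_congr rfl fun s _ => congrArg _ (hr s k j i)]
  rw [Finset.sum_eq_single i (fun s _ hs => by simp [hs]) (by simp)]
  by_cases hjk : j = k
  · subst hjk
    simp only [and_self, if_true, coeff_matUnit]
    field_simp
  · simp [hjk, Ne.symm hjk]

/-- Schur orthogonality for a module with only scalar endomorphisms: the average of the conjugates
of an endomorphism is the scalar determined by its trace. -/
theorem schurRelations_of_scalar_end {F G : Type*} [Field F] [CharZero F] [Group G] [Fintype G]
    {n : ℕ} (r : G →* Matrix (Fin n) (Fin n) F)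
    (hend : ∀ A : Matrix (Fin n) (Fin n) F, (∀ g, r g * A = A * r g) → ∃ c : F, A = c • 1) :
    SchurRelations r := by
  intro s j k t
  have hn : (n : F) ≠ 0 := by
    have : n ≠ 0 := fun h => by subst h; exact s.elim0
    exact_mod_cast this
  set A : Matrix (Fin n) (Fin n) F := Matrix.single j k 1
  set B := ∑ g : G, r g * A * r g⁻¹ with hB
  obtain ⟨c, hc⟩ := hend B fun g => by
    rw [hB, Finset.mul_sum, Finset.sum_mul]
    rw [← Equiv.sum_comp (Equiv.mulLeft g) fun x => r x * A * r x⁻¹ * r g]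
    refine Finset.sum_congr rfl fun h _ => ?_
    simp only [Equiv.coe_mulLeft, mul_inv_rev, map_mul]
    have : r g⁻¹ * r g = 1 := by rw [← map_mul]; simp
    simp only [mul_assoc, this, mul_one]
  have htr : Matrix.trace B = Nat.card G * (if j = k then 1 else 0) := by
    have : ∀ g, Matrix.trace (r g * A * r g⁻¹) = if j = k then 1 else 0 := fun g => by
      rw [Matrix.trace_mul_cycle, ← map_mul, inv_mul_cancel, map_one, one_mul]
      by_cases h : j = k
      · subst h; simp [A]
      · simp [A, h]
    rw [hB, Matrix.trace_sum, Finset.sum_congr rfl fun g _ => this g]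
    simp
  have hc' : c * n = Nat.card G * (if j = k then 1 else 0) := by
    rw [← htr, hc]; simp [Matrix.trace_smul]
  have hent : B s t = ∑ g : G, r g s j * r g⁻¹ k t := by
    rw [hB, Matrix.sum_apply]
    refine Finset.sum_congr rfl fun g _ => ?_
    simp [A, Matrix.mul_apply, Matrix.single_apply, ite_and, Finset.sum_ite_eq]
  rw [← hent, hc]
  simp only [Matrix.smul_apply, Matrix.one_apply, smul_eq_mul]
  by_cases hst : s = t <;> by_cases hjk : j = k <;> simp [hst, hjk] at hc' ⊢
  · field_simp; exact hc'
  · rcases hc' with h | h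
    · exact h
    · exact absurd (by exact_mod_cast h) hn

/-- A module whose character becomes irreducible over an algebraically closed field is absolutely
irreducible: its matrix coefficients satisfy Schur's relations. -/
theorem exists_schurRelations {F L G : Type*} [Field F] [CharZero F] [Field L] [CharZero L]
    [IsAlgClosed L] [Algebra F L] [Group G] [Fintype G] {U : Type*} [AddCommGroup U] [Module L U]
    [FiniteDimensional L U] (ρ : Representation L G U) [ρ.IsIrreducible]
    (X : Type*) [AddCommGroup X] [Module F X] [Module F[G] X] [IsScalarTower F F[G] X]
    [FiniteDimensional F X] (hX : ∀ g : G, algebraMap F L (modChar F X g) = ρ.character g) :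
    ∃ (b : Basis (Fin (finrank L U)) F X)
      (r : G →* Matrix (Fin (finrank L U)) (Fin (finrank L U)) F),
      SchurRelations r ∧ (∀ g, Matrix.trace (r g) = modChar F X g) ∧
      ∀ g i, MonoidAlgebra.of F G g • b i = ∑ s, r g s i • b s := by
  have hcG : (Nat.card G : F) ≠ 0 := by exact_mod_cast Nat.card_pos.ne'
  have hcL : (Nat.card G : L) ≠ 0 := by exact_mod_cast Nat.card_pos.ne'
  let _ : Invertible (Nat.card G : F) := invertibleOfNonzero hcG
  let _ : Invertible (Nat.card G : L) := invertibleOfNonzero hcL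
  have hdim : finrank F X = finrank L U := by
    have h := hX 1
    rw [modChar, Representation.char_one, Representation.char_one, map_natCast] at h
    exact_mod_cast h
  let rX := Representation.ofModule' (k := F) (G := G) X
  have hend1 : finrank F (Representation.IntertwiningMap rX rX) = 1 := by
    have h1 := Representation.card_inv_mul_sum_char_mul_char_eq_finrank rX rX
    have h2 := Representation.card_inv_mul_sum_char_mul_char_eq_finrank ρ ρ
    rw [Representation.IsIrreducible.finrank_intertwiningMap_self] at h2
    have h1' := congrArg (algebraMap F L) h1
    simp only [map_mul, map_sum, map_inv₀, map_natCast] at h1'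
    have h3 : ∀ g, algebraMap F L (rX.character g) = ρ.character g := hX
    simp only [h3] at h1'
    rw [h2] at h1'
    exact_mod_cast h1'.symm
  let b : Basis (Fin (finrank L U)) F X := finBasisOfFinrankEq F X hdim
  let r : G →* Matrix (Fin (finrank L U)) (Fin (finrank L U)) F :=
    ((LinearMap.toMatrixAlgEquiv b : _ →* _)).comp rX
  have hr : ∀ g, r g = LinearMap.toMatrix b b (rX g) := fun g => rfl
  refine ⟨b, r, schurRelations_of_scalar_end r fun A hA => ?_, fun g => ?_, fun g i => ?_⟩
  · have : Nontrivial (Representation.IntertwiningMap rX rX) :=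
      Module.nontrivial_of_finrank_pos (R := F) (by omega)
    let T : Representation.IntertwiningMap rX rX := ⟨Matrix.toLin b b A, fun g => by
      apply (LinearMap.toMatrix b b).injective
      rw [LinearMap.toMatrix_comp b b b, LinearMap.toMatrix_comp b b b, LinearMap.toMatrix_toLin,
        ← hr, hA]⟩
    have hid : Representation.IntertwiningMap.id rX ≠ 0 := by
      intro h0
      obtain ⟨S, hS⟩ := exists_ne (0 : Representation.IntertwiningMap rX rX)
      apply hS
      ext x
      have := congrArg (fun t : Representation.IntertwiningMap rX rX => S (t x)) h0
      simpa using this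
    obtain ⟨c, hc⟩ := (finrank_eq_one_iff_of_nonzero' _ hid).mp hend1 T
    refine ⟨c, (Matrix.toLin b b).injective ?_⟩
    rw [map_smul, Matrix.toLin_one]
    ext x
    exact (congrArg (fun t : Representation.IntertwiningMap rX rX => t x) hc).symm
  · rw [hr, ← LinearMap.trace_eq_matrix_trace]; rfl
  · have := (b.sum_repr (rX g (b i))).symm
    simp only [hr, LinearMap.toMatrix_apply]
    exact this

/-- The left ideal generated by a diagonal matrix unit is the module it comes from. -/
theorem span_matUnit_equiv {F G : Type*} [Field F] [CharZero F] [Group G] [Fintype G]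
    {n : ℕ} (r : G →* Matrix (Fin n) (Fin n) F) (hr : SchurRelations r)
    (X : Type*) [AddCommGroup X] [Module F X] [Module F[G] X] [IsScalarTower F F[G] X]
    (b : Basis (Fin n) F X) (hb : ∀ g i, MonoidAlgebra.of F G g • b i = ∑ s, r g s i • b s)
    (i : Fin n) : Nonempty (Submodule.span F[G] {matUnit r i i} ≃ₗ[F[G]] X) := by
  have hn : (n : F) ≠ 0 := by
    have : n ≠ 0 := fun h => by subst h; exact i.elim0
    exact_mod_cast this
  have hG : (Nat.card G : F) ≠ 0 := by exact_mod_cast Nat.card_pos.ne'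
  have hact : ∀ j, matUnit r j i • b i = b j := fun j => by
    have h1 : ∀ g : G, MonoidAlgebra.single g ((n : F) / Nat.card G * r g⁻¹ i j) • b i =
        ∑ s, ((n : F) / Nat.card G * (r g s i * r g⁻¹ i j)) • b s := fun g => by
      have h2 : MonoidAlgebra.single g ((n : F) / Nat.card G * r g⁻¹ i j) =
          ((n : F) / Nat.card G * r g⁻¹ i j) • MonoidAlgebra.of F G g := by simp
      rw [h2, smul_assoc, hb, Finset.smul_sum]
      refine Finset.sum_congr rfl fun s _ => ?_
      rw [smul_smul]; congr 1; ring
    rw [matUnit, Finset.sum_smul, Finset.sum_congr rfl fun g _ => h1 g, Finset.sum_comm]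
    simp_rw [← Finset.sum_smul, ← Finset.mul_sum]
    rw [Finset.sum_congr rfl fun s _ =>
      congrArg (fun z => ((n : F) / Nat.card G * z) • b s) (hr s i i j)]
    rw [Finset.sum_eq_single j (fun s _ hs => by simp [hs]) (by simp)]
    simp only [and_self, if_true]
    rw [div_mul_div_comm, mul_comm, div_self (mul_ne_zero hG hn), one_smul]
  have hid := matUnit_mul_matUnit r hr i i i i
  rw [if_pos rfl] at hid
  have : FiniteDimensional F F[G] :=
    Module.Finite.of_basis (Basis.ofRepr (MonoidAlgebra.coeffLinearEquiv F) : Basis G F F[G])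
  have := finite_submodule (F := F) (Submodule.span F[G] {matUnit r i i})
  have : FiniteDimensional F X := Module.Finite.of_basis b
  let φ : Submodule.span F[G] {matUnit r i i} →ₗ[F[G]] X :=
    (LinearMap.toSpanSingleton F[G] X (b i)).comp (Submodule.subtype _)
  have hsurj : Function.Surjective (φ.restrictScalars F) := by
    rw [← LinearMap.range_eq_top, ← top_le_iff, ← b.span_eq, Submodule.span_le]
    rintro _ ⟨j, rfl⟩
    refine ⟨⟨matUnit r j i, Submodule.mem_span_singleton.mpr ⟨matUnit r j i, ?_⟩⟩, hact j⟩
    rw [smul_eq_mul, matUnit_mul_matUnit r hr, if_pos rfl]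
  have hdim : finrank F (Submodule.span F[G] {matUnit r i i}) = finrank F X := by
    have h := modChar_span_idempotent _ hid 1
    rw [modChar, Representation.char_one] at h
    rw [finrank_eq_card_basis b, Fintype.card_fin]
    have : ∀ h : G, (matUnit r i i).coeff (h⁻¹ * 1⁻¹ * h) = (n : F) / Nat.card G := fun h => by
      rw [coeff_matUnit]; simp
    rw [Finset.sum_congr rfl fun g _ => this g, Finset.sum_const, Finset.card_univ,
      Fintype.card_eq_nat_card, nsmul_eq_mul, mul_div_cancel₀ _ hG] at h
    exact_mod_cast h
  have hinj : Function.Injective (φ.restrictScalars F) :=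
    (LinearMap.injective_iff_surjective_of_finrank_eq_finrank hdim).mpr hsurj
  exact ⟨LinearEquiv.ofBijective φ ⟨hinj, hsurj⟩⟩

end MatrixUnits

/-! ### Equivalent families of idempotents -/

section EquivalentIdempotents

/-- Two finite families of idempotents are equivalent if the corresponding diagonal matrices are
Murray–von Neumann equivalent, the equivalence being given by matrices `u` and `v`. -/
def IdemEquivVia {R J K : Type*} [Ring R] [Fintype J] [Fintype K] [DecidableEq J] [DecidableEq K]
    (f : J → R) (f' : K → R) (u : J → K → R) (v : K → J → R) : Prop :=
  (∀ j k, f j * u j k = u j k) ∧ (∀ j k, f' k * v k j = v k j) ∧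
    (∀ j j', ∑ k, u j k * v k j' = if j = j' then f j else 0) ∧
    ∀ k k', ∑ j, v k j * u j k' = if k = k' then f' k else 0

/-- A linear map between products of left ideals generated by idempotents is the right
multiplication by a matrix. -/
theorem exists_matrix_of_linearMap {R J K : Type*} [Ring R] [Fintype J] [Fintype K]
    [DecidableEq J] (f : J → R) (f' : K → R) (hf : ∀ j, f j * f j = f j)
    (φ : (∀ j, Submodule.span R {f j}) →ₗ[R] ∀ k, Submodule.span R {f' k}) :
    ∃ u : J → K → R, (∀ j k, f j * u j k = u j k) ∧
      (∀ j k, (φ (Pi.single j ⟨f j, Submodule.mem_span_singleton_self _⟩) k : R) = u j k) ∧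
      ∀ x k, (φ x k : R) = ∑ j, (x j : R) * u j k := by
  have hfix : ∀ (e : R), e * e = e → ∀ x ∈ Submodule.span R {e}, x * e = x := fun e he x hx => by
    obtain ⟨y, rfl⟩ := Submodule.mem_span_singleton.mp hx
    rw [smul_eq_mul, mul_assoc, he]
  let s : ∀ j, Submodule.span R {f j} := fun j => ⟨f j, Submodule.mem_span_singleton_self _⟩
  have hs : ∀ j (x : Submodule.span R {f j}), x = (x : R) • s j := fun j x =>
    Subtype.ext (hfix _ (hf j) x x.2).symm
  refine ⟨fun j k => φ (Pi.single j (s j)) k, fun j k => ?_, fun j k => rfl, fun x k => ?_⟩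
  · rw [← smul_eq_mul, ← Submodule.coe_smul, ← Pi.smul_apply, ← map_smul, ← Pi.single_smul,
      ← hs j (s j)]
  · have hx : x = ∑ j, (x j : R) • Pi.single j (s j) := by
      conv_lhs => rw [← Finset.univ_sum_single x]
      refine Finset.sum_congr rfl fun j _ => ?_
      rw [← Pi.single_smul, ← hs]
    conv_lhs => rw [hx]
    simp only [map_sum, map_smul, Finset.sum_apply, Pi.smul_apply]
    rw [AddSubmonoidClass.coe_finsetSum]
    rfl

/-- An isomorphism between products of left ideals makes the generating idempotents equivalent. -/
theorem exists_idemEquivVia {R J K : Type*} [Ring R] [Fintype J] [Fintype K]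
    [DecidableEq J] [DecidableEq K] (f : J → R) (f' : K → R) (hf : ∀ j, f j * f j = f j)
    (hf' : ∀ k, f' k * f' k = f' k)
    (φ : (∀ j, Submodule.span R {f j}) ≃ₗ[R] ∀ k, Submodule.span R {f' k}) :
    ∃ u v, IdemEquivVia f f' u v := by
  obtain ⟨u, hu, hu1, hu2⟩ := exists_matrix_of_linearMap f f' hf φ.toLinearMap
  obtain ⟨v, hv, hv1, hv2⟩ := exists_matrix_of_linearMap f' f hf' φ.symm.toLinearMap
  refine ⟨u, v, hu, fun j k => hv k j, fun j j' => ?_, fun k k' => ?_⟩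
  · have h := hv2 (φ (Pi.single j ⟨f j, Submodule.mem_span_singleton_self _⟩)) j'
    rw [LinearEquiv.coe_coe, LinearEquiv.symm_apply_apply] at h
    rw [Finset.sum_congr rfl fun k _ => congrArg (· * v k j') (hu1 j k).symm]
    refine h.symm.trans ?_
    by_cases hj : j = j'
    · subst hj; simp
    · simp [hj]
  · have h := hu2 (φ.symm (Pi.single k ⟨f' k, Submodule.mem_span_singleton_self _⟩)) k'
    rw [LinearEquiv.coe_coe, LinearEquiv.apply_symm_apply] at h
    rw [Finset.sum_congr rfl fun j _ => congrArg (· * u j k') (hv1 k j).symm]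
    refine h.symm.trans ?_
    by_cases hk : k = k'
    · subst hk; simp
    · simp [hk]

/-- Equivalent families of idempotents cut out isomorphic products of pieces of any module. -/
theorem prod_card_idemPart_eq {R M J K : Type*} [Ring R] [AddCommGroup M] [Module R M] [Fintype J]
    [Fintype K] [DecidableEq J] [DecidableEq K] {f : J → R} {f' : K → R}
    (hf : ∀ j, f j * f j = f j) (hf' : ∀ k, f' k * f' k = f' k) {u : J → K → R} {v : K → J → R}
    (h : IdemEquivVia f f' u v) :
    ∏ j, Nat.card (Set.range fun x : M => f j • x) =
      ∏ k, Nat.card (Set.range fun x : M => f' k • x) := by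
  have hfix : ∀ (e : R), e * e = e → ∀ x : Set.range fun x : M => e • x, e • (x : M) = x := by
    rintro e he ⟨_, x, rfl⟩
    simp only [smul_smul, he]
  obtain ⟨h1, h2, h3, h4⟩ := h
  rw [← Nat.card_pi, ← Nat.card_pi]
  refine Nat.card_congr
    { toFun := fun x k => ⟨∑ j, v k j • (x j : M), ∑ j, v k j • (x j : M), ?_⟩
      invFun := fun y j => ⟨∑ k, u j k • (y k : M), ∑ k, u j k • (y k : M), ?_⟩
      left_inv := fun x => ?_
      right_inv := fun y => ?_ }
  · simp only [Finset.smul_sum, smul_smul, h2]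
  · simp only [Finset.smul_sum, smul_smul, h1]
  · funext j
    refine Subtype.ext ?_
    simp only [Finset.smul_sum, smul_smul]
    rw [Finset.sum_comm]
    simp only [← Finset.sum_smul, h3, ite_smul, zero_smul, Finset.sum_ite_eq, Finset.mem_univ,
      if_true]
    exact hfix _ (hf j) (x j)
  · funext k
    refine Subtype.ext ?_
    simp only [Finset.smul_sum, smul_smul]
    rw [Finset.sum_comm]
    simp only [← Finset.sum_smul, h4, ite_smul, zero_smul, Finset.sum_ite_eq, Finset.mem_univ,
      if_true]
    exact hfix _ (hf' k) (y k)

end EquivalentIdempotents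

/-! ### Idempotents of characters of degree one -/

section LinearCharacterIdempotents

theorem mapRingHom_charIdem {F L Γ : Type*} [Field F] [Field L] [Fintype Γ] [Group Γ]
    (σ : F →+* L) (φ : Γ → F) :
    MonoidAlgebra.mapRingHom Γ σ (charIdem φ) = charIdem fun γ => σ (φ γ) := by
  simp [charIdem]

theorem coeff_sum_single {F Γ : Type*} [Semiring F] [Fintype Γ] (c : Γ → F) (g : Γ) :
    (∑ γ : Γ, MonoidAlgebra.single γ (c γ)).coeff g = c g := by
  classical
  rw [MonoidAlgebra.coeff_sum, Finsupp.finsetSum_apply,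
    Finset.sum_eq_single g (fun b _ hb => by simp [hb.symm]) (by simp)]
  simp

theorem coeff_charIdem {F Γ : Type*} [Field F] [Group Γ] [Fintype Γ] (φ : Γ → F) (g : Γ) :
    (charIdem φ).coeff g = φ 1 / Nat.card Γ * φ g⁻¹ :=
  coeff_sum_single (fun γ => φ 1 / (Nat.card Γ : F) * φ γ⁻¹) g

open scoped Classical in
theorem subgroupIdem_eq {F G : Type*} [Field F] [Group G] [Fintype G] (H : Subgroup G)
    (ψ : H → F) : subgroupIdem H ψ = MonoidAlgebra.mapDomainRingHom F H.subtype (charIdem ψ) := by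
  rw [MonoidAlgebra.mapDomainRingHom_apply]
  rfl

open scoped Classical in
theorem coeff_subgroupIdem {F G : Type*} [Field F] [Group G] [Fintype G] (H : Subgroup G)
    (ψ : H →* F) (g : G) : (subgroupIdem H ψ).coeff g =
      (Nat.card H : F)⁻¹ * if h : g⁻¹ ∈ H then ψ ⟨g⁻¹, h⟩ else 0 := by
  rw [subgroupIdem_eq, charIdem, map_sum, MonoidAlgebra.coeff_sum, Finsupp.finsetSum_apply]
  simp only [map_one, one_div, MonoidAlgebra.mapDomainRingHom_apply, MonoidAlgebra.mapDomain_single,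
    MonoidAlgebra.coeff_single]
  by_cases hg : g⁻¹ ∈ H
  · have hg' : g ∈ H := by simpa using H.inv_mem hg
    rw [dif_pos hg, Finset.sum_eq_single ⟨g, hg'⟩]
    · exact Finsupp.single_eq_same
    · intro b _ hb
      rw [Finsupp.single_apply, if_neg]
      intro h; exact hb (Subtype.ext h)
    · simp
  · rw [dif_neg hg, mul_zero]
    refine Finset.sum_eq_zero fun b _ => ?_
    rw [Finsupp.single_apply, if_neg]
    rintro rfl
    exact hg (H.inv_mem b.2)

theorem mapRingHom_subgroupIdem {F L G : Type*} [Field F] [Field L] [Fintype G] [Group G]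
    (σ : F →+* L) (H : Subgroup G) (ψ : H →* F) :
    MonoidAlgebra.mapRingHom G σ (subgroupIdem H ψ) = subgroupIdem H fun h => σ (ψ h) := by
  classical
  have h := coeff_subgroupIdem H ((σ : F →* L).comp ψ)
  ext g
  rw [MonoidAlgebra.coeff_mapRingHom, coeff_subgroupIdem]
  refine Eq.trans ?_ (h g).symm
  split_ifs <;> simp

theorem subgroupIdem_mul_self {F G : Type*} [Field F] [CharZero F] [Group G] [Fintype G]
    (H : Subgroup G) (ψ : H →* F) : subgroupIdem H ψ * subgroupIdem H ψ = subgroupIdem H ψ := by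
  classical
  have hH : (Nat.card H : F) ≠ 0 := by exact_mod_cast Nat.card_pos.ne'
  have h1 : charIdem ψ * charIdem ψ = charIdem ψ := by
    ext m
    have hc : ∀ h : H, (charIdem ψ).coeff h = (Nat.card H : F)⁻¹ * ψ h⁻¹ := fun h => by
      rw [coeff_charIdem, map_one, one_div]
    rw [coeff_mul_eq_sum]
    have : ∀ g : H, (charIdem ψ).coeff g * (charIdem ψ).coeff (g⁻¹ * m) =
        (Nat.card H : F)⁻¹ * ((Nat.card H : F)⁻¹ * ψ m⁻¹) := fun g => by
      rw [hc, hc, mul_inv_rev, inv_inv, map_mul]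
      have : ψ g⁻¹ * ψ g = 1 := by rw [← map_mul]; simp
      linear_combination ((Nat.card H : F)⁻¹) ^ 2 * ψ m⁻¹ * this
    rw [Finset.sum_congr rfl fun g _ => this g, hc, Finset.sum_const, Finset.card_univ,
      Fintype.card_eq_nat_card, nsmul_eq_mul, mul_inv_cancel_left₀ hH]
  rw [subgroupIdem_eq, ← map_mul, h1]

/-- The left ideal generated by the idempotent of `ψ` has the character induced from `ψ`; its
character is computed in `modChar_span_idempotent`. -/
theorem sum_coeff_subgroupIdem {G : Type*} [Group G] [Fintype G] (F : IntermediateField ℚ QBar)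
    (H : Subgroup G) (ψ : H →* F) (g : G) :
    algebraMap F QBar (∑ h : G, (subgroupIdem H ψ).coeff (h⁻¹ * g⁻¹ * h)) =
      indChar H ((algebraMap F QBar : F →* QBar).comp ψ) g := by
  classical
  rw [indChar, map_sum, Finset.mul_sum]
  refine Finset.sum_congr rfl fun h _ => ?_
  have e : (h⁻¹ * g⁻¹ * h)⁻¹ = h⁻¹ * g * h := by group
  rw [coeff_subgroupIdem, map_mul, map_inv₀, map_natCast]
  congr 1
  simp only [e]
  split_ifs <;> simp

end LinearCharacterIdempotents

/-! ### Realizing a virtual character by matrix units -/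

section MatrixUnits

/-- A character that is a difference of characters over `F` of modules cut out by idempotents
is realized over `F`: its block contains matrix units over `F`, and the difference lifts to an
equivalence of idempotents. -/
theorem exists_matUnits_idemEquivVia {F L G : Type*} [Field F] [CharZero F] [Field L] [CharZero L]
    [IsAlgClosed L] [Algebra F L] [Group G] [Fintype G] {U : Type*} [AddCommGroup U] [Module L U]
    [FiniteDimensional L U] (ρ : Representation L G U) [ρ.IsIrreducible] {J K : Type*} [Fintype J]
    [Fintype K] [DecidableEq J] [DecidableEq K] (f : J → F[G]) (f' : K → F[G])
    (hf : ∀ j, f j * f j = f j) (hf' : ∀ k, f' k * f' k = f' k)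
    (h : ∀ g, algebraMap F L (∑ j, ∑ h : G, (f j).coeff (h⁻¹ * g⁻¹ * h)) =
      algebraMap F L (∑ k, ∑ h : G, (f' k).coeff (h⁻¹ * g⁻¹ * h)) + ρ.character g) :
    ∃ E : Fin (finrank L U) → Fin (finrank L U) → F[G],
      (∀ i j k l, E i j * E k l = if j = k then E i l else 0) ∧
      MonoidAlgebra.mapRingHom G (algebraMap F L) (∑ i, E i i) = charIdem ρ.character ∧
      ∀ i, ∃ u v, IdemEquivVia f (fun o : Option K => o.elim (E i i) f') u v := by
  have : FiniteDimensional F F[G] :=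
    Module.Finite.of_basis (Basis.ofRepr (MonoidAlgebra.coeffLinearEquiv F) : Basis G F F[G])
  have := fun j => finite_submodule (F := F) (Submodule.span F[G] {f j})
  have := fun j => finite_submodule (F := F) (Submodule.span F[G] {f' j})
  have hchar : ∀ g, algebraMap F L (modChar F (∀ j, Submodule.span F[G] {f j}) g) =
      algebraMap F L (modChar F (∀ k, Submodule.span F[G] {f' k}) g) + ρ.character g := fun g => by
    rw [modChar_pi, modChar_pi, Finset.sum_congr rfl fun j _ => modChar_span_idempotent _ (hf j) g,
      Finset.sum_congr rfl fun j _ => modChar_span_idempotent _ (hf' j) g]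
    exact h g
  obtain ⟨X, ⟨φ⟩⟩ := exists_equiv_prod_of_char ρ _ _ _ rfl hchar
  have := finite_submodule (F := F) X
  have hX : ∀ g, algebraMap F L (modChar F X g) = ρ.character g := fun g => by
    have := hchar g
    rw [modChar_congr (W := (∀ k, Submodule.span F[G] {f' k}) × X) φ, modChar_prod, map_add] at this
    exact add_left_cancel this
  obtain ⟨b, r, hr, htr, hb⟩ := exists_schurRelations ρ X hX
  refine ⟨matUnit r, matUnit_mul_matUnit r hr, ?_, fun i => ?_⟩
  · classical
    ext g
    rw [MonoidAlgebra.coeff_mapRingHom, MonoidAlgebra.coeff_sum, Finsupp.finsetSum_apply]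
    simp only [coeff_matUnit]
    rw [← Finset.mul_sum, map_mul]
    have h1 : algebraMap F L (∑ i, r g⁻¹ i i) = ρ.character g⁻¹ := by
      rw [← hX, ← htr]; rfl
    rw [h1, coeff_charIdem]
    simp
  · obtain ⟨e⟩ := span_matUnit_equiv r hr X b hb i
    have hid : ∀ o : Option K, o.elim (matUnit r i i) f' * o.elim (matUnit r i i) f' =
        o.elim (matUnit r i i) f' := by
      rintro (_ | k)
      · exact (matUnit_mul_matUnit r hr i i i i).trans (if_pos rfl)
      · exact hf' k
    let ψ : ((∀ k, Submodule.span F[G] {f' k}) × X) ≃ₗ[F[G]]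
        ∀ o : Option K, Submodule.span F[G] {o.elim (matUnit r i i) f'} :=
      (LinearEquiv.prodComm F[G] _ _).trans ((e.symm.prodCongr (LinearEquiv.refl _ _)).trans
        (LinearEquiv.piOptionEquivProd F[G]
          (M := fun o : Option K => Submodule.span F[G] {o.elim (matUnit r i i) f'})).symm)
    exact exists_idemEquivVia f _ hf hid (φ.trans ψ)

end MatrixUnits

/-! ### Integrality at almost all primes -/

section Spreading

/-- An element of `ℚ(ζ_k)` is integral at almost all primes, in the sense of the ring
`ℤ_p[ζ_k]`. -/
theorem exists_denominator {k : ℕ} (hk : 0 < k) {c : QBar} (hc : c ∈ cyclotomicSubfield k) :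
    ∃ D : ℕ, 0 < D ∧ ∀ (p : ℕ) [Fact p.Prime], ¬ p ∣ D → ∀ ι : QBar →+* PadicAlgCl p,
      ι c ∈ ZpZeta p k := by
  have hc' : c ∈ Algebra.adjoin ℚ {z : QBar | z ^ k = 1} := by
    rw [cyclotomicSubfield] at hc
    rw [← IntermediateField.adjoin_toSubalgebra_of_isAlgebraic]
    · exact hc
    · intro z hz
      refine ⟨Polynomial.X ^ k - 1, (Polynomial.monic_X_pow_sub_C (1 : ℚ) hk.ne').ne_zero, ?_⟩
      simp [show z ^ k = 1 from hz]
  induction hc' using Algebra.adjoin_induction with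
  | mem x hx =>
    refine ⟨1, one_pos, fun p _ _ ι => Algebra.subset_adjoin ?_⟩
    rw [Set.mem_ofPred_eq, ← map_pow, hx, map_one]
  | algebraMap q =>
    refine ⟨q.den, q.den_pos, fun p _ hp ι => ?_⟩
    have hu : IsUnit (q.den : ℤ_[p]) := by
      rw [PadicInt.isUnit_iff, PadicInt.norm_natCast_eq_one_iff]
      exact (Nat.Prime.coprime_iff_not_dvd Fact.out).mpr hp
    obtain ⟨u, hu⟩ := hu
    have h1 : ι (algebraMap ℚ QBar q) =
        algebraMap ℤ_[p] (PadicAlgCl p) (q.num * (u⁻¹ : ℤ_[p]ˣ)) := by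
      have h2 : algebraMap ℤ_[p] (PadicAlgCl p) u *
          algebraMap ℤ_[p] (PadicAlgCl p) (u⁻¹ : ℤ_[p]ˣ) = 1 := by
        rw [← map_mul, Units.mul_inv, map_one]
      have h3 : (q.den : PadicAlgCl p) ≠ 0 := by exact_mod_cast q.den_ne_zero
      rw [hu, map_natCast] at h2
      rw [eq_ratCast, map_ratCast, Rat.cast_def, map_mul, map_intCast, div_eq_iff h3]
      linear_combination (-(q.num : PadicAlgCl p)) * h2
    rw [h1]
    exact Subalgebra.algebraMap_mem _ _
  | add x y hx hy ihx ihy =>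
    have : Algebra.adjoin ℚ {z : QBar | z ^ k = 1} ≤ (cyclotomicSubfield k).toSubalgebra :=
      Algebra.adjoin_le (IntermediateField.subset_adjoin ℚ _)
    obtain ⟨D, hD, h⟩ := ihx (this hx)
    obtain ⟨D', hD', h'⟩ := ihy (this hy)
    refine ⟨D * D', mul_pos hD hD', fun p _ hp ι => ?_⟩
    rw [map_add]
    exact add_mem (h p (fun hd => hp (hd.mul_right _)) ι) (h' p (fun hd => hp (hd.mul_left _)) ι)
  | mul x y hx hy ihx ihy =>
    have : Algebra.adjoin ℚ {z : QBar | z ^ k = 1} ≤ (cyclotomicSubfield k).toSubalgebra :=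
      Algebra.adjoin_le (IntermediateField.subset_adjoin ℚ _)
    obtain ⟨D, hD, h⟩ := ihx (this hx)
    obtain ⟨D', hD', h'⟩ := ihy (this hy)
    refine ⟨D * D', mul_pos hD hD', fun p _ hp ι => ?_⟩
    rw [map_mul]
    exact mul_mem (h p (fun hd => hp (hd.mul_right _)) ι) (h' p (fun hd => hp (hd.mul_left _)) ι)

/-- The embedding of `ℚ(ζ_k)[G]` into the group ring over the algebraic closure of `ℚ_p` induced
by an embedding of `ℚ̄`. -/
noncomputable def padicGroupRingHom (p : ℕ) [Fact p.Prime] (k : ℕ) (G : Type*) [Group G]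
    (ι : QBar →+* PadicAlgCl p) : (cyclotomicSubfield k)[G] →+* (PadicAlgCl p)[G] :=
  MonoidAlgebra.mapRingHom G (ι.comp (algebraMap (cyclotomicSubfield k) QBar))

/-- The elements of `ℚ(ζ_k)[G]` with coefficients in `ℤ_p[ζ_k]`. -/
noncomputable def integralSubring (p : ℕ) [Fact p.Prime] (k : ℕ) (G : Type*) [Group G]
    (ι : QBar →+* PadicAlgCl p) : Subring (cyclotomicSubfield k)[G] :=
  (groupRingIncl p k G).range.comap (padicGroupRingHom p k G ι)

theorem groupRingIncl_injective (p : ℕ) [Fact p.Prime] (k : ℕ) (G : Type*) [Group G] :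
    Function.Injective (groupRingIncl p k G) := by
  intro x y h
  ext g
  have := congrArg (fun z => MonoidAlgebra.coeff z g) h
  simpa [groupRingIncl] using this

/-- The elements of `ℚ(ζ_k)[G]` with coefficients in `ℤ_p[ζ_k]` can be regarded as elements of
`ℤ_p[ζ_k][G]`. -/
theorem exists_integral_lift (p : ℕ) [Fact p.Prime] (k : ℕ) (G : Type*) [Group G]
    (ι : QBar →+* PadicAlgCl p) :
    ∃ Λ : integralSubring p k G ι →+* (ZpZeta p k)[G],
      ∀ x, groupRingIncl p k G (Λ x) = padicGroupRingHom p k G ι x := by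
  let e := RingEquiv.ofBijective (groupRingIncl p k G).rangeRestrict
    ⟨fun x y h => groupRingIncl_injective p k G (congrArg Subtype.val h),
      RingHom.rangeRestrict_surjective _⟩
  refine ⟨e.symm.toRingHom.comp
    (((padicGroupRingHom p k G ι).domRestrict _).codRestrict _ fun x => x.2), fun x => ?_⟩
  exact congrArg Subtype.val (e.apply_symm_apply _)

/-- Finitely many elements of `ℚ(ζ_k)[G]` have coefficients in `ℤ_p[ζ_k]` for almost all `p`,
whatever the embedding of `ℚ̄`. -/
theorem exists_spreading {k : ℕ} (hk : 0 < k) {G : Type*} [Group G] [Fintype G]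
    (T : Set (cyclotomicSubfield k)[G]) (hT : T.Finite) :
    ∃ S : Finset ℕ, ∀ (p : ℕ) [Fact p.Prime], p ∉ S → ∀ ι : QBar →+* PadicAlgCl p,
      ∀ x ∈ T, x ∈ integralSubring p k G ι := by
  choose D hD hDι using fun c : cyclotomicSubfield k => exists_denominator hk c.2
  let N := ∏ x ∈ hT.toFinset, ∏ g : G, D (x.coeff g)
  have hN : N ≠ 0 := Finset.prod_ne_zero_iff.mpr fun x _ =>
    Finset.prod_ne_zero_iff.mpr fun g _ => (hD _).ne'
  refine ⟨N.primeFactors, fun p hp hpS ι x hx => ?_⟩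
  have hpN : ¬ p ∣ N := fun h => hpS (Nat.mem_primeFactors.mpr ⟨hp.out, h, hN⟩)
  have hcoeff : ∀ g, ι (x.coeff g : QBar) ∈ ZpZeta p k := fun g =>
    hDι _ p (fun h => hpN (h.trans ((Finset.dvd_prod_of_mem _ (Finset.mem_univ g)).trans
      (Finset.dvd_prod_of_mem (fun x : (cyclotomicSubfield k)[G] => ∏ g : G, D (x.coeff g))
        (hT.mem_toFinset.mpr hx))))) ι
  refine ⟨∑ g : G, MonoidAlgebra.single g ⟨_, hcoeff g⟩, ?_⟩
  ext g
  rw [groupRingIncl, MonoidAlgebra.coeff_mapRingHom, coeff_sum_single, padicGroupRingHom,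
    MonoidAlgebra.coeff_mapRingHom]
  rfl

theorem IdemEquivVia.of_injective {R S J K : Type*} [Ring R] [Ring S] [Fintype J] [Fintype K]
    [DecidableEq J] [DecidableEq K] (φ : R →+* S) (hφ : Function.Injective φ) {f : J → R}
    {f' : K → R} {u : J → K → R} {v : K → J → R}
    (h : IdemEquivVia (fun j => φ (f j)) (fun k => φ (f' k)) (fun j k => φ (u j k))
      fun k j => φ (v k j)) : IdemEquivVia f f' u v := by
  obtain ⟨h1, h2, h3, h4⟩ := h
  refine ⟨fun j k => hφ ?_, fun j k => hφ ?_, fun j j' => hφ ?_, fun k k' => hφ ?_⟩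
  · simpa using h1 j k
  · simpa using h2 j k
  · simpa [apply_ite φ] using h3 j j'
  · simpa [apply_ite φ] using h4 k k'

theorem IdemEquivVia.map {R S J K : Type*} [Ring R] [Ring S] [Fintype J] [Fintype K]
    [DecidableEq J] [DecidableEq K] (φ : R →+* S) {f : J → R}
    {f' : K → R} {u : J → K → R} {v : K → J → R} (h : IdemEquivVia f f' u v) :
    IdemEquivVia (fun j => φ (f j)) (fun k => φ (f' k)) (fun j k => φ (u j k))
      fun k j => φ (v k j) := by
  obtain ⟨h1, h2, h3, h4⟩ := h
  refine ⟨fun j k => ?_, fun j k => ?_, fun j j' => ?_, fun k k' => ?_⟩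
  · rw [← map_mul, h1]
  · rw [← map_mul, h2]
  · simpa [apply_ite φ] using congrArg φ (h3 j j')
  · simpa [apply_ite φ] using congrArg φ (h4 k k')

end Spreading

/-! ### The pieces of a module cut out by the idempotents -/

section MatrixUnitDecomposition

/-- In the presence of matrix units `E`, the piece `(∑ E_ii) M` of a module is the sum of `n` copies
of the piece `E_ii M`. -/
theorem idemPart_equiv_pi {O A G : Type*} [CommRing O] [CommRing A] [Algebra A O] [Group G] {n : ℕ}
    (E : Fin n → Fin n → O[G]) (hE : ∀ i j k l, E i j * E k l = if j = k then E i l else 0)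
    (i₀ : Fin n) (M : Type*) [AddCommGroup M] [Module O M] [Module O[G] M] [IsScalarTower O O[G] M]
    [Module A M] [IsScalarTower A O M] :
    Nonempty (idemPart (∑ i, E i i) M ≃ₗ[A] (Fin n → idemPart (E i₀ i₀) M)) := by
  have hmem : ∀ (e : O[G]) (x : M), x ∈ idemPart e M ↔ ∃ y : M, e • y = x := fun e x => Iff.rfl
  have hfix : ∀ x ∈ idemPart (∑ i, E i i) M, (∑ i, E i i) • x = x := fun x hx => by
    obtain ⟨y, rfl⟩ := (hmem _ _).mp hx
    rw [smul_smul]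
    congr 1
    simp [Finset.sum_mul_sum, hE]
  have hfix' : ∀ x ∈ idemPart (E i₀ i₀) M, E i₀ i₀ • x = x := fun x hx => by
    obtain ⟨y, rfl⟩ := (hmem _ _).mp hx
    rw [smul_smul, hE, if_pos rfl]
  have hsm : ∀ (e : O[G]) (c : O) (x : M), e • c • x = c • e • x := fun e c x =>
    ((Algebra.lsmul O O M e).map_smul c x)
  have e : idemPart (∑ i, E i i) M ≃ₗ[O] (Fin n → idemPart (E i₀ i₀) M) :=
    { toFun := fun x j => ⟨E i₀ j • (x : M), (hmem _ _).mpr ⟨E i₀ j • (x : M), by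
        rw [smul_smul, hE, if_pos rfl]⟩⟩
      map_add' := fun x y => by
        funext j; refine Subtype.ext ?_; exact smul_add _ _ _
      map_smul' := fun c x => by
        funext j; refine Subtype.ext ?_; exact hsm _ _ _
      invFun := fun y => ⟨∑ j, E j i₀ • (y j : M), (hmem _ _).mpr ⟨∑ j, E j i₀ • (y j : M), by
        rw [Finset.smul_sum]
        refine Finset.sum_congr rfl fun j _ => ?_
        rw [smul_smul]
        congr 1
        simp [Finset.sum_mul, hE]⟩⟩
      left_inv := fun x => by
        refine Subtype.ext ?_
        simp only [smul_smul, hE, if_true]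
        rw [← Finset.sum_smul]
        exact hfix x x.2
      right_inv := fun y => by
        funext j
        refine Subtype.ext ?_
        simp only [Finset.smul_sum, smul_smul, hE, ite_smul, zero_smul, Finset.sum_ite_eq,
          Finset.mem_univ, if_true]
        exact hfix' _ (y j).2 }
  exact ⟨e.restrictScalars A⟩

end MatrixUnitDecomposition

section Reduction

/-- Once an irreducible character is an integral combination of characters induced from
`ℚ(ζ_k)`-valued characters of degree one, the structure of `e_χ M` and the order formula hold away
from finitely many primes. -/
theorem exists_idempotents_of_brauer (G : Type*) [Group G] [Fintype G]
    (V : Type*) [AddCommGroup V] [Module QBar V] [FiniteDimensional QBar V]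
    (ρ : Representation QBar G V) [ρ.IsIrreducible] {k : ℕ} (hk : 0 < k) (m : ℕ)
    (H : Fin m → Subgroup G)
    (ψ : ∀ i, H i →* QBar) (a : Fin m → ℤ) (hψ : ∀ i h, ψ i h ∈ cyclotomicSubfield k)
    (hχ : ∀ g : G, ρ.character g = ∑ i, (a i : QBar) * indChar (H i) (ψ i) g) :
      ∃ S : Finset ℕ, ∀ (p : ℕ) [Fact p.Prime], p ∉ S → ∀ ι : QBar →+* PadicAlgCl p,
        ∃ (e : (ZpZeta p k)[G]) (f : Fin m → (ZpZeta p k)[G]),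
          groupRingIncl p k G e = charIdem (fun g => ι (ρ.character g)) ∧
          (∀ i, groupRingIncl p k G (f i) = subgroupIdem (H i) (fun h => ι (ψ i h))) ∧
          ∀ (M : Type*) [AddCommGroup M] [Module (ZpZeta p k) M] [Module (ZpZeta p k)[G] M]
            [IsScalarTower (ZpZeta p k) (ZpZeta p k)[G] M]
            [Module ℤ_[p] M] [IsScalarTower ℤ_[p] (ZpZeta p k) M],
            ∃ N : Submodule (ZpZeta p k) M,
              Nonempty (idemPart e M ≃ₗ[ℤ_[p]] (Fin (Module.finrank QBar V) → N)) ∧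
              (Finite M →
                (Nat.card N : ℚ) = ∏ i, (Nat.card (idemPart (f i) M) : ℚ) ^ (a i)) := by
  classical
  let F := cyclotomicSubfield k
  let ψF : ∀ i, H i →* F := fun i =>
    { toFun := fun h => ⟨ψ i h, hψ i h⟩
      map_one' := Subtype.ext (map_one (ψ i))
      map_mul' := fun x y => Subtype.ext (map_mul (ψ i) x y) }
  have hψF : ∀ i, (algebraMap F QBar : F →* QBar).comp (ψF i) = ψ i := fun i => rfl
  let f₀ : Fin m → F[G] := fun i => subgroupIdem (H i) (ψF i)
  have hf₀ : ∀ i, f₀ i * f₀ i = f₀ i := fun i => subgroupIdem_mul_self _ _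
  -- the parts of the combination with positive and with negative coefficients
  let f₁ : (Σ i, Fin (a i).toNat) → F[G] := fun j => f₀ j.1
  let f₂ : (Σ i, Fin (-a i).toNat) → F[G] := fun j => f₀ j.1
  have hnt : Nontrivial V := by
    have h : IsSimpleModule QBar[G] ρ.asModule := inferInstance
    exact h.nontrivial
  have i₀ : Fin (finrank QBar V) := ⟨0, Module.finrank_pos⟩
  obtain ⟨E, hE, hEχ, hEuv⟩ := exists_matUnits_idemEquivVia (F := F) ρ f₁ f₂ (fun j => hf₀ _)
    (fun j => hf₀ _) fun g => by
      simp only [Fintype.sum_sigma, Finset.sum_const, f₁, f₂, map_sum (algebraMap F QBar),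
        Finset.card_univ, Fintype.card_fin, nsmul_eq_mul, map_mul, map_natCast]
      simp only [f₀, ← map_sum (algebraMap F QBar), sum_coeff_subgroupIdem, hψF, hχ]
      rw [← Finset.sum_add_distrib]
      refine Finset.sum_congr rfl fun i _ => ?_
      rw [← add_mul]
      congr 1
      have : ((a i).toNat : ℤ) = ((-a i).toNat : ℤ) + a i := by omega
      exact_mod_cast congrArg (Int.cast : ℤ → QBar) this
  obtain ⟨u, v, huv⟩ := hEuv i₀
  -- the idempotents, the matrix units and the equivalence involve finitely many elements
  let T : Set F[G] := Set.range f₀ ∪ Set.range (fun t : _ × _ => E t.1 t.2) ∪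
    Set.range (fun t : _ × _ => u t.1 t.2) ∪ Set.range (fun t : _ × _ => v t.1 t.2)
  have hT : T.Finite := (((Set.finite_range _).union (Set.finite_range _)).union
    (Set.finite_range _)).union (Set.finite_range _)
  obtain ⟨S, hS⟩ := exists_spreading hk T hT
  refine ⟨S, fun p _ hp ι => ?_⟩
  have hQ := hS p hp ι
  obtain ⟨Λ, hΛ⟩ := exists_integral_lift p k G ι
  let Q := integralSubring p k G ι
  have hf₀Q : ∀ i, f₀ i ∈ Q := fun i => hQ _ (Or.inl (Or.inl (Or.inl ⟨i, rfl⟩)))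
  have hEQ : ∀ i j, E i j ∈ Q := fun i j => hQ _ (Or.inl (Or.inl (Or.inr ⟨(i, j), rfl⟩)))
  have huQ : ∀ i j, u i j ∈ Q := fun i j => hQ _ (Or.inl (Or.inr ⟨(i, j), rfl⟩))
  have hvQ : ∀ i j, v i j ∈ Q := fun i j => hQ _ (Or.inr ⟨(i, j), rfl⟩)
  let E' : Fin (finrank QBar V) → Fin (finrank QBar V) → (ZpZeta p k)[G] :=
    fun i j => Λ ⟨E i j, hEQ i j⟩
  have hE' : ∀ i j k l, E' i j * E' k l = if j = k then E' i l else 0 := fun i j k l => by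
    have h : (⟨E i j, hEQ i j⟩ * ⟨E k l, hEQ k l⟩ : Q) = if j = k then ⟨E i l, hEQ i l⟩ else 0 := by
      refine Subtype.ext ((hE i j k l).trans ?_)
      split_ifs <;> rfl
    simp only [E', ← map_mul]
    rw [h]
    split_ifs <;> simp
  let f : Fin m → (ZpZeta p k)[G] := fun i => Λ ⟨f₀ i, hf₀Q i⟩
  have hf : ∀ i, f i * f i = f i := fun i => by
    simp only [f, ← map_mul]
    exact congrArg Λ (Subtype.ext (hf₀ i))
  have huv' := IdemEquivVia.map Λ (IdemEquivVia.of_injective Q.subtype Subtype.val_injective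
    (f := fun j : (Σ i, Fin (a i).toNat) => ⟨f₀ j.1, hf₀Q _⟩)
    (f' := fun o : Option (Σ i, Fin (-a i).toNat) =>
      o.elim ⟨E i₀ i₀, hEQ _ _⟩ fun j => ⟨f₀ j.1, hf₀Q _⟩)
    (u := fun j o => ⟨u j o, huQ _ _⟩) (v := fun o j => ⟨v o j, hvQ _ _⟩) (by
      convert huv using 1
      all_goals first | rfl | (funext o; cases o <;> rfl)))
  refine ⟨∑ i, E' i i, f, ?_, fun i => ?_, ?_⟩
  · simp only [E']
    rw [← map_sum, hΛ, padicGroupRingHom]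
    rw [AddSubmonoidClass.coe_finsetSum, ← mapRingHom_charIdem, ← hEχ]
    ext g
    simp
  · simp only [f]
    rw [hΛ, padicGroupRingHom]
    exact mapRingHom_subgroupIdem _ (H i) (ψF i)
  · intro M _ _ _ _ _ _
    refine ⟨idemPart (E' i₀ i₀) M, idemPart_equiv_pi E' hE' i₀ M, fun hM => ?_⟩
    have hcount := prod_card_idemPart_eq (M := M) (fun j => hf _) (by
      rintro (_ | j)
      · exact (hE' _ _ _ _).trans (if_pos rfl)
      · exact hf _) huv'
    rw [Fintype.prod_option] at hcount
    have hc : ∀ i, (Nat.card (idemPart (f i) M) : ℚ) ≠ 0 := fun i => by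
      exact_mod_cast Nat.card_pos.ne'
    have hcount' : ∏ i, Nat.card (idemPart (f i) M) ^ (a i).toNat =
        Nat.card (idemPart (E' i₀ i₀) M) * ∏ i, Nat.card (idemPart (f i) M) ^ (-a i).toNat := by
      rw [Fintype.prod_sigma, Fintype.prod_sigma] at hcount
      refine Eq.trans (Finset.prod_congr rfl fun i _ => ?_) (hcount.trans ?_)
      · refine Eq.symm ((Finset.prod_const (Nat.card (idemPart (f i) M))).trans ?_)
        rw [Finset.card_univ, Fintype.card_fin]
      · refine congrArg _ (Finset.prod_congr rfl fun i _ => ?_)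
        refine (Finset.prod_const (Nat.card (idemPart (f i) M))).trans ?_
        rw [Finset.card_univ, Fintype.card_fin]
    have h1 : ∏ i, (Nat.card (idemPart (f i) M) : ℚ) ^ (-a i).toNat ≠ 0 :=
      Finset.prod_ne_zero_iff.mpr fun i _ => pow_ne_zero _ (hc i)
    apply mul_right_cancel₀ h1
    have h2 : (∏ i, (Nat.card (idemPart (f i) M) : ℚ) ^ (a i).toNat) =
        Nat.card (idemPart (E' i₀ i₀) M) * ∏ i, (Nat.card (idemPart (f i) M) : ℚ) ^ (-a i).toNat := by
      exact_mod_cast hcount'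
    rw [← h2, ← Finset.prod_mul_distrib]
    refine Finset.prod_congr rfl fun i _ => ?_
    rw [← zpow_natCast, ← zpow_natCast, ← zpow_add₀ (hc i)]
    congr 1
    omega

end Reduction

/-! ### Induced functions and monomial combinations -/

section Induction

variable {K G : Type*} [Field K] [Group G]

open scoped Classical in
/-- The extension by zero of a function on a subgroup. -/
noncomputable def zeroExt (H : Subgroup G) (θ : H → K) (g : G) : K :=
  if h : g ∈ H then θ ⟨g, h⟩ else 0

theorem zeroExt_of_mem {H : Subgroup G} (θ : H → K) {g : G} (h : g ∈ H) :
    zeroExt H θ g = θ ⟨g, h⟩ := dif_pos h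

theorem zeroExt_of_notMem {H : Subgroup G} (θ : H → K) {g : G} (h : g ∉ H) :
    zeroExt H θ g = 0 := dif_neg h

theorem zeroExt_add (H : Subgroup G) (θ θ' : H → K) :
    zeroExt H (θ + θ') = zeroExt H θ + zeroExt H θ' := by
  funext g
  by_cases h : g ∈ H
  · simp [zeroExt_of_mem _ h]
  · simp [zeroExt_of_notMem _ h]

variable [Fintype G]

/-- The class function induced by a function `θ` on a subgroup `H`. -/
noncomputable def ind (H : Subgroup G) (θ : H → K) (g : G) : K :=
  (Nat.card H : K)⁻¹ * ∑ x : G, zeroExt H θ (x⁻¹ * g * x)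

theorem indChar_eq_ind {G : Type*} [Group G] [Fintype G] (H : Subgroup G) (ψ : H →* QBar) :
    indChar H ψ = ind H ψ := rfl

/-- Induction as an additive homomorphism. -/
noncomputable def indHom (H : Subgroup G) : (H → K) →+ (G → K) :=
  AddMonoidHom.mk' (ind H) fun θ θ' => by
    funext g
    simp only [ind, zeroExt_add, Pi.add_apply, Finset.sum_add_distrib, mul_add]

@[simp] theorem indHom_apply (H : Subgroup G) (θ : H → K) : indHom H θ = ind H θ := rfl

/-- The projection formula for induction. -/
theorem mul_ind (H : Subgroup G) (θ : H → K) (f : G → K) (hf : ∀ x g, f (x⁻¹ * g * x) = f g) :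
    f * ind H θ = ind H (fun h => f h * θ h) := by
  funext g
  simp only [Pi.mul_apply, ind]
  rw [mul_left_comm, Finset.mul_sum]
  congr 1
  refine Finset.sum_congr rfl fun x _ => ?_
  by_cases h : x⁻¹ * g * x ∈ H
  · simp [zeroExt_of_mem _ h, hf]
  · simp [zeroExt_of_notMem _ h]

theorem ind_top (θ : G → K) [CharZero K] (hθ : ∀ x g, θ (x⁻¹ * g * x) = θ g) :
    ind (⊤ : Subgroup G) (fun h => θ h) = θ := by
  funext g
  have hG : (Nat.card G : K) ≠ 0 := by exact_mod_cast Nat.card_pos.ne'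
  have : ∀ x : G, zeroExt (⊤ : Subgroup G) (fun h => θ h) (x⁻¹ * g * x) = θ g := fun x => by
    rw [zeroExt_of_mem _ (Subgroup.mem_top _), hθ]
  rw [ind, Finset.sum_congr rfl fun x _ => this x, Finset.sum_const, Finset.card_univ,
    Fintype.card_eq_nat_card, Subgroup.card_top, nsmul_eq_mul, inv_mul_cancel_left₀ hG]

/-- Induction is transitive. -/
theorem ind_ind [CharZero K] (H : Subgroup G) [Fintype H] (A : Subgroup H) (ψ : A → K) :
    ind H (ind A ψ) = ind (A.map H.subtype)
      (fun a => ψ ((A.equivMapOfInjective H.subtype H.subtype_injective).symm a)) := by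
  funext g
  have hH : (Nat.card H : K) ≠ 0 := by exact_mod_cast Nat.card_pos.ne'
  set e := A.equivMapOfInjective H.subtype H.subtype_injective
  set ψ' : A.map H.subtype → K := fun a => ψ (e.symm a)
  have key : ∀ (z : G) (hz : z ∈ H), zeroExt A ψ ⟨z, hz⟩ = zeroExt (A.map H.subtype) ψ' z := by
    intro z hz
    by_cases h : (⟨z, hz⟩ : H) ∈ A
    · have h' : z ∈ A.map H.subtype := ⟨⟨z, hz⟩, h, rfl⟩
      rw [zeroExt_of_mem _ h, zeroExt_of_mem _ h']
      congr 1
      rw [MulEquiv.eq_symm_apply]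
      rfl
    · have h' : z ∉ A.map H.subtype := by
        rintro ⟨w, hw, rfl⟩
        exact h hw
      rw [zeroExt_of_notMem _ h, zeroExt_of_notMem _ h']
  have h1 : ∀ x : G, zeroExt H (ind A ψ) (x⁻¹ * g * x) = (Nat.card A : K)⁻¹ *
      ∑ h : H, zeroExt (A.map H.subtype) ψ' ((x * h)⁻¹ * g * (x * h)) := by
    intro x
    by_cases hx : x⁻¹ * g * x ∈ H
    · rw [zeroExt_of_mem _ hx, ind]
      congr 1
      refine Finset.sum_congr rfl fun h _ => ?_
      rw [show (h⁻¹ * ⟨x⁻¹ * g * x, hx⟩ * h : H) = ⟨(x * h)⁻¹ * g * (x * h), by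
        have := H.mul_mem (H.mul_mem (H.inv_mem h.2) hx) h.2
        convert this using 1; group⟩ from Subtype.ext (by simp [mul_assoc]), key]
    · rw [zeroExt_of_notMem _ hx]
      symm
      refine mul_eq_zero_of_right _ (Finset.sum_eq_zero fun h _ => zeroExt_of_notMem _ ?_)
      rintro ⟨w, -, hw⟩
      apply hx
      have := H.mul_mem (H.mul_mem h.2 w.2) (H.inv_mem h.2)
      rw [show (w : G) = _ from hw] at this
      convert this using 1; group
  rw [ind, Finset.sum_congr rfl fun x _ => h1 x, ← Finset.mul_sum, Finset.sum_comm]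
  have h2 : ∀ h : H, ∑ x : G, zeroExt (A.map H.subtype) ψ' ((x * h)⁻¹ * g * (x * h)) =
      ∑ x : G, zeroExt (A.map H.subtype) ψ' (x⁻¹ * g * x) := fun h =>
    Equiv.sum_comp (Equiv.mulRight (h : G)) fun x => zeroExt (A.map H.subtype) ψ' (x⁻¹ * g * x)
  rw [Finset.sum_congr rfl fun h _ => h2 h, Finset.sum_const, Finset.card_univ,
    Fintype.card_eq_nat_card, nsmul_eq_mul, ind, Nat.card_congr e.toEquiv.symm]
  field_simp

/-- The additive group of integral combinations of the characters induced from characters of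
degree one whose values are `n`-th roots of unity. -/
def monomialSpan (K : Type*) [Field K] (n : ℕ) (G : Type*) [Group G] [Fintype G] :
    AddSubgroup (G → K) :=
  AddSubgroup.closure
    {f | ∃ (H : Subgroup G) (ψ : H →* K), (∀ h, ψ h ^ n = 1) ∧ f = ind H ψ}

theorem ind_mem_monomialSpan_of_mem [CharZero K] {n : ℕ} (H : Subgroup G) [Fintype H] {θ : H → K}
    (hθ : θ ∈ monomialSpan K n H) : ind H θ ∈ monomialSpan K n G := by
  have : (monomialSpan K n H).map (indHom H) ≤ monomialSpan K n G := by
    rw [monomialSpan, AddMonoidHom.map_closure, AddSubgroup.closure_le]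
    rintro _ ⟨_, ⟨A, ψ, hψ, rfl⟩, rfl⟩
    rw [indHom_apply, ind_ind]
    exact AddSubgroup.subset_closure ⟨_, ψ.comp
      (A.equivMapOfInjective H.subtype H.subtype_injective).symm.toMonoidHom, fun h => hψ _, rfl⟩
  exact this ⟨θ, hθ, rfl⟩

theorem monoidHom_mem_monomialSpan [CharZero K] {n : ℕ} (ψ : G →* K) (hψ : ∀ g, ψ g ^ n = 1) :
    ⇑ψ ∈ monomialSpan K n G := by
  refine AddSubgroup.subset_closure ⟨⊤, ψ.comp (Subgroup.subtype ⊤), fun h => hψ h, ?_⟩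
  refine (ind_top ψ fun x g => ?_).symm
  rw [map_mul, map_mul, mul_right_comm, ← map_mul]
  simp

end Induction

/-! ### Virtual characters -/

section VirtualCharacters

/-- The characters of the matrix representations of `G` over `K`. -/
def matrixCharacters (K G : Type*) [Field K] [Group G] : Submonoid (G → K) where
  carrier := {f | ∃ (n : ℕ) (r : G →* Matrix (Fin n) (Fin n) K), ∀ g, f g = Matrix.trace (r g)}
  one_mem' := ⟨1, 1, fun g => by simp⟩
  mul_mem' := by
    rintro f f' ⟨n, r, hr⟩ ⟨n', r', hr'⟩
    let e : Matrix (Fin n × Fin n') (Fin n × Fin n') K ≃ₐ[K]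
        Matrix (Fin (n * n')) (Fin (n * n')) K :=
      Matrix.reindexAlgEquiv K K finProdFinEquiv
    refine ⟨n * n', (e : _ →* _).comp
      { toFun := fun g => Matrix.kroneckerMap (· * ·) (r g) (r' g)
        map_one' := by
          rw [map_one, map_one]; exact Matrix.one_kronecker_one
        map_mul' := fun g g' => by
          rw [map_mul, map_mul]; exact Matrix.mul_kronecker_mul _ _ _ _ }, fun g => ?_⟩
    have h := Matrix.trace_kronecker (r g) (r' g)
    rw [Pi.mul_apply, hr, hr', ← h]
    simp only [Matrix.trace, Matrix.diag, e]
    rw [← Equiv.sum_comp finProdFinEquiv]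
    simp

/-- The ring of virtual characters of `G`. -/
def virtualCharacters (K G : Type*) [Field K] [Group G] : Subring (G → K) :=
  Subring.closure (matrixCharacters K G)

theorem virtualCharacters_induction {K G : Type*} [Field K] [Group G] {B : AddSubgroup (G → K)}
    (hB : ∀ f ∈ matrixCharacters K G, f ∈ B) {f : G → K} (hf : f ∈ virtualCharacters K G) :
    f ∈ B := by
  rw [virtualCharacters, Subring.mem_closure_iff, Submonoid.closure_eq] at hf
  exact (AddSubgroup.closure_le B).mpr hB hf

theorem virtualCharacters_comp {K G H : Type*} [Field K] [Group G] [Group H] (φ : H →* G)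
    {f : G → K} (hf : f ∈ virtualCharacters K G) : (fun h => f (φ h)) ∈ virtualCharacters K H := by
  let c : (G → K) →+ (H → K) := ⟨⟨fun f h => f (φ h), rfl⟩, fun _ _ => rfl⟩
  refine virtualCharacters_induction (B := (virtualCharacters K H).toAddSubgroup.comap c) ?_ hf
  rintro f ⟨n, r, hr⟩
  exact Subring.subset_closure ⟨n, r.comp φ, fun h => hr (φ h)⟩

theorem virtualCharacters_conj {K G : Type*} [Field K] [Group G]
    {f : G → K} (hf : f ∈ virtualCharacters K G) (x g : G) : f (x⁻¹ * g * x) = f g := by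
  refine virtualCharacters_induction (B := ⟨⟨⟨{f | f (x⁻¹ * g * x) = f g}, fun h h' => ?_⟩, rfl⟩,
    fun h => ?_⟩) ?_ hf
  · exact congrArg₂ (· + ·) h h'
  · exact congrArg (- ·) h
  · rintro f ⟨n, r, hr⟩
    change f _ = f _
    rw [hr, hr, map_mul, Matrix.trace_mul_comm, ← map_mul]
    simp

theorem monoidHom_mem_virtualCharacters {K G : Type*} [Field K] [Group G] (ψ : G →* K) :
    ⇑ψ ∈ virtualCharacters K G :=
  Subring.subset_closure ⟨1, (Matrix.scalar (Fin 1) : K →+* _).toMonoidHom.comp ψ, fun g => by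
    simp⟩

theorem character_mem_virtualCharacters {K G V : Type*} [Field K] [Group G] [AddCommGroup V]
    [Module K V] [FiniteDimensional K V] (ρ : Representation K G V) :
    ρ.character ∈ virtualCharacters K G := by
  let b := finBasis K V
  refine Subring.subset_closure ⟨finrank K V, ((LinearMap.toMatrixAlgEquiv b : _ →* _)).comp ρ,
    fun g => ?_⟩
  exact LinearMap.trace_eq_matrix_trace K b (ρ g)

/-- The induced function is the character of the left ideal generated by the idempotent of `ψ`. -/
theorem ind_mem_virtualCharacters {K G : Type*} [Field K] [CharZero K] [Group G] [Fintype G]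
    (H : Subgroup G) (ψ : H →* K) : ind H ψ ∈ virtualCharacters K G := by
  classical
  have : FiniteDimensional K K[G] :=
    Module.Finite.of_basis (Basis.ofRepr (MonoidAlgebra.coeffLinearEquiv K) : Basis G K K[G])
  have := finite_submodule (F := K) (Submodule.span K[G] {subgroupIdem H ψ})
  have h : ind H ψ = (Representation.ofModule' (k := K) (G := G)
      (Submodule.span K[G] {subgroupIdem H ψ})).character := by
    funext g
    refine Eq.trans ?_ (modChar_span_idempotent _ (subgroupIdem_mul_self H ψ) g).symm
    rw [ind, Finset.mul_sum]
    refine Finset.sum_congr rfl fun h _ => ?_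
    have e : (h⁻¹ * g⁻¹ * h)⁻¹ = h⁻¹ * g * h := by group
    rw [coeff_subgroupIdem]
    simp only [e]
    rfl
  rw [h]
  exact character_mem_virtualCharacters _

end VirtualCharacters

/-! ### Groups with a commutative subgroup of index at most two -/

section Decomposition

variable {K G : Type*} [Field K] [Group G]

/-- A subspace stable under `G`, as a submodule over the group algebra. -/
def invariantSubmodule {V : Type*} [AddCommGroup V] [Module K V] [Module K[G] V]
    [IsScalarTower K K[G] V] (p : Submodule K V)
    (hp : ∀ g : G, ∀ v ∈ p, MonoidAlgebra.of K G g • v ∈ p) : Submodule K[G] V where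
  carrier := p
  add_mem' := p.add_mem
  zero_mem' := p.zero_mem
  smul_mem' c v hv := by
    induction c using MonoidAlgebra.induction_on with
    | of g => exact hp g v hv
    | add a b ha hb => rw [add_smul]; exact p.add_mem ha hb
    | smul r a ha => rw [smul_assoc]; exact p.smul_mem r ha

/-- A commutative subgroup acting on a nonzero finite-dimensional space over an algebraically
closed field has a common eigenvector. -/
theorem exists_common_eigenvector [IsAlgClosed K] (A : Subgroup G)
    (hA : ∀ a ∈ A, ∀ b ∈ A, a * b = b * a) {V : Type*} [AddCommGroup V] [Module K V]
    [FiniteDimensional K V] [Nontrivial V] (ρ : Representation K G V) :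
    ∃ v : V, v ≠ 0 ∧ ∀ a ∈ A, ∃ c : K, ρ a v = c • v := by
  let P : ℕ → Prop := fun d => ∃ p : Submodule K V, p ≠ ⊥ ∧ (∀ a ∈ A, ∀ v ∈ p, ρ a v ∈ p) ∧
    finrank K p = d
  have hP : ∃ d, P d := ⟨_, ⊤, top_ne_bot, fun _ _ _ _ => Submodule.mem_top, rfl⟩
  classical
  obtain ⟨p, hp0, hpA, hpd⟩ := Nat.find_spec hP
  obtain ⟨v, hv, hv0⟩ := Submodule.exists_mem_ne_zero_of_ne_bot hp0
  refine ⟨v, hv0, fun a ha => ?_⟩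
  have : Nontrivial p := Submodule.nontrivial_iff_ne_bot.mpr hp0
  obtain ⟨c, hc⟩ := Module.End.exists_eigenvalue ((ρ a).restrict (hpA a ha))
  obtain ⟨w, hw⟩ := hc.exists_hasEigenvector
  have hw1 : ρ a w = c • (w : V) := congrArg Subtype.val hw.apply_eq_smul
  -- the eigenspace is stable, so it is everything by minimality
  let p' : Submodule K V := p ⊓ LinearMap.ker (ρ a - c • LinearMap.id)
  have hp'mem : ∀ x, x ∈ p' ↔ x ∈ p ∧ ρ a x = c • x := fun x => by
    simp [p', sub_eq_zero]
  have hp'0 : p' ≠ ⊥ := fun h => by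
    have h1 : (w : V) ∈ p' := (hp'mem _).mpr ⟨w.2, hw1⟩
    rw [h, Submodule.mem_bot] at h1
    exact hw.2 (Subtype.ext h1)
  have hp'A : ∀ b ∈ A, ∀ x ∈ p', ρ b x ∈ p' := fun b hb x hx => by
    rw [hp'mem] at hx ⊢
    refine ⟨hpA b hb x hx.1, ?_⟩
    rw [← Module.End.mul_apply, ← map_mul, hA a ha b hb, map_mul, Module.End.mul_apply, hx.2,
      map_smul]
  have hle : p' ≤ p := inf_le_left
  have heq : p' = p := Submodule.eq_of_le_of_finrank_le hle
    (hpd.le.trans (Nat.find_min' hP ⟨p', hp'0, hp'A, rfl⟩))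
  exact ⟨c, ((hp'mem v).mp (heq ▸ hv)).2⟩

/-- The eigenvalues of a subgroup on a common eigenvector form a character of degree one. -/
theorem exists_monoidHom_of_eigenvector (A : Subgroup G) {V : Type*} [AddCommGroup V] [Module K V]
    (ρ : Representation K G V) {v : V} (hv : v ≠ 0) (h : ∀ a ∈ A, ∃ c : K, ρ a v = c • v) :
    ∃ ψ : A →* K, ∀ a : A, ρ a v = ψ a • v := by
  choose c hc using fun a : A => h a a.2
  refine ⟨{ toFun := c, map_one' := ?_, map_mul' := fun a b => ?_ }, hc⟩
  · apply smul_left_injective K hv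
    simp only [← hc]
    simp
  · apply smul_left_injective K hv
    simp only [← hc]
    rw [Subgroup.coe_mul, map_mul, Module.End.mul_apply, hc b, map_smul, hc a, smul_smul, mul_comm]

/-- The trace of an operator stabilizing a line and its complementary line in a plane. -/
theorem trace_fin_two {W : Type*} [AddCommGroup W] [Module K W] (b : Basis (Fin 2) K W)
    (T : W →ₗ[K] W) {c c' d d' : K} (h0 : T (b 0) = c • b 0 + d • b 1)
    (h1 : T (b 1) = d' • b 0 + c' • b 1) : LinearMap.trace K W T = c + c' := by
  rw [LinearMap.trace_eq_matrix_trace K b, Matrix.trace, Fin.sum_univ_two, Matrix.diag_apply,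
    Matrix.diag_apply, LinearMap.toMatrix_apply, LinearMap.toMatrix_apply, h0, h1]
  simp

variable [CharZero K] [Fintype G]

/-- The induced character when `A` has index two and `s` represents the other coset. -/
theorem ind_index_two (A : Subgroup G) [A.Normal] {s : G} (hs : ∀ g, g ∉ A → s⁻¹ * g ∈ A)
    (hsA : s ∉ A) (ψ : A →* K) (g : G) :
    ind A ψ g = zeroExt A ψ g + zeroExt A ψ (s⁻¹ * g * s) := by
  classical
  have hAc : (Nat.card A : K) ≠ 0 := by exact_mod_cast Nat.card_pos.ne'
  have hconj : ∀ a ∈ A, ∀ z, zeroExt A ψ (a⁻¹ * z * a) = zeroExt A ψ z := fun a ha z => by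
    by_cases hz : z ∈ A
    · have hz' : a⁻¹ * z * a ∈ A := A.mul_mem (A.mul_mem (A.inv_mem ha) hz) ha
      rw [zeroExt_of_mem _ hz, zeroExt_of_mem _ hz']
      have : (⟨a⁻¹ * z * a, hz'⟩ : A) = ⟨a, ha⟩⁻¹ * ⟨z, hz⟩ * ⟨a, ha⟩ := rfl
      rw [this, map_mul, map_mul, mul_right_comm, ← map_mul]
      simp
    · rw [zeroExt_of_notMem _ hz, zeroExt_of_notMem]
      intro h
      apply hz
      have := A.mul_mem (A.mul_mem ha h) (A.inv_mem ha)
      convert this using 1; group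
  have hsplit : ∑ x : G, zeroExt A ψ (x⁻¹ * g * x) =
      ∑ a : A, zeroExt A ψ ((a : G)⁻¹ * g * a) +
        ∑ a : A, zeroExt A ψ ((s * a : G)⁻¹ * g * (s * a)) := by
    rw [← Finset.sum_filter_add_sum_filter_not Finset.univ (· ∈ A)]
    congr 1
    · exact Finset.sum_subtype _ (by simp) _
    · refine Finset.sum_bij' (fun x hx => ⟨s⁻¹ * x, hs x (Finset.mem_filter.mp hx).2⟩)
        (fun a _ => s * a) ?_ ?_ ?_ ?_ ?_
      · simp
      · intro a _
        simp only [Finset.mem_filter, Finset.mem_univ, true_and]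
        intro h
        exact hsA (by simpa using A.mul_mem h (A.inv_mem a.2))
      · simp
      · simp
      · simp
  rw [ind, hsplit, Finset.sum_congr rfl fun (a : A) _ => hconj a a.2 g]
  have h2 : ∀ a : A, zeroExt A ψ ((s * a : G)⁻¹ * g * (s * a)) = zeroExt A ψ (s⁻¹ * g * s) :=
    fun a => by
    rw [← hconj a a.2 (s⁻¹ * g * s)]
    congr 1; group
  rw [Finset.sum_congr rfl fun a _ => h2 a, Finset.sum_const, Finset.sum_const, Finset.card_univ,
    Fintype.card_eq_nat_card, ← smul_add, nsmul_eq_mul, inv_mul_cancel_left₀ hAc]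

/-- A module over a group with a commutative subgroup `A` of index at most two contains
a submodule which is a line or is induced from a line over `A`. -/
theorem exists_submodule_monomial [IsAlgClosed K] (A : Subgroup G)
    (hA : ∀ a ∈ A, ∀ b ∈ A, a * b = b * a) (hidx : A.index ≤ 2) (V : Type*) [AddCommGroup V]
    [Module K V] [Module K[G] V] [IsScalarTower K K[G] V] [FiniteDimensional K V] [Nontrivial V] :
    ∃ W : Submodule K[G] V, W ≠ ⊥ ∧
      ((∃ ψ : G →* K, modChar K W = ψ) ∨ ∃ ψ : A →* K, modChar K W = ind A ψ) := by
  let ρ := Representation.ofModule' (k := K) (G := G) V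
  obtain ⟨v, hv0, hv⟩ := exists_common_eigenvector A hA ρ
  have line : (∀ g : G, ∃ c : K, ρ g v = c • v) → ∃ W : Submodule K[G] V, W ≠ ⊥ ∧
      ∃ ψ : G →* K, modChar K W = ψ := by
    intro hall
    obtain ⟨ψ', hψ'⟩ := exists_monoidHom_of_eigenvector ⊤ ρ hv0 fun a _ => hall a
    let ψ : G →* K := ψ'.comp (Subgroup.topEquiv (G := G)).symm.toMonoidHom
    have hψ : ∀ g, ρ g v = ψ g • v := fun g => hψ' ⟨g, Subgroup.mem_top g⟩
    let W := invariantSubmodule (K := K) (G := G) (Submodule.span K {v}) fun g w hw => by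
      obtain ⟨c, rfl⟩ := Submodule.mem_span_singleton.mp hw
      have : MonoidAlgebra.of K G g • c • v = c • ψ g • v := by
        rw [← hψ]; exact (ρ g).map_smul c v
      rw [this]
      exact Submodule.smul_mem _ _ (Submodule.smul_mem _ _ (Submodule.mem_span_singleton_self v))
    have hvW : v ∈ W := Submodule.mem_span_singleton_self v
    refine ⟨W, fun h => hv0 (by rw [h] at hvW; exact hvW), ψ, ?_⟩
    funext g
    have h1 : Representation.ofModule' (k := K) (G := G) W g = ψ g • LinearMap.id := by
      ext ⟨w, hw⟩
      obtain ⟨c, rfl⟩ := Submodule.mem_span_singleton.mp hw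
      change ρ g (c • v) = ψ g • c • v
      rw [map_smul, hψ, smul_comm]
    have := finite_submodule (F := K) W
    have h2 : finrank K W = 1 := finrank_span_singleton hv0
    rw [modChar, Representation.character, h1, map_smul, LinearMap.trace_id, h2]
    simp
  obtain ⟨ψ, hψ⟩ := exists_monoidHom_of_eigenvector A ρ hv0 hv
  have hidx0 : A.index ≠ 0 := Subgroup.FiniteIndex.index_ne_zero
  by_cases h1 : A.index = 1
  · rw [Subgroup.index_eq_one] at h1
    obtain ⟨W, hW, h⟩ := line fun g => hv g (h1 ▸ Subgroup.mem_top g)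
    exact ⟨W, hW, Or.inl h⟩
  have h2 : A.index = 2 := by omega
  have hn : A.Normal := Subgroup.normal_of_index_eq_two h2
  obtain ⟨s, hsA⟩ : ∃ s, s ∉ A := by
    by_contra! hall
    exact h1 (Subgroup.index_eq_one.mpr ((Subgroup.eq_top_iff' A).mpr hall))
  have hs : ∀ g, g ∉ A → s⁻¹ * g ∈ A := fun g hg =>
    (Subgroup.mul_mem_iff_of_index_two h2).mpr (by simp [hsA, hg])
  have hcj : ∀ a ∈ A, s⁻¹ * a * s ∈ A := fun a ha => by
    simpa using hn.conj_mem a ha s⁻¹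
  by_cases hdep : ∃ c : K, ρ s v = c • v
  · obtain ⟨c, hc⟩ := hdep
    obtain ⟨W, hW, h⟩ := line fun g => by
      by_cases hg : g ∈ A
      · exact hv g hg
      · obtain ⟨d, hd⟩ := hv _ (hs g hg)
        refine ⟨d * c, ?_⟩
        have e : ρ g v = ρ (s * (s⁻¹ * g)) v := by rw [mul_inv_cancel_left]
        rw [e, map_mul, Module.End.mul_apply, hd, map_smul, hc, smul_smul]
    exact ⟨W, hW, Or.inl h⟩
  · have hdep' : ∀ c : K, ρ s v ≠ c • v := fun c hc => hdep ⟨c, hc⟩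
    have hli : LinearIndependent K ![v, ρ s v] := by
      rw [LinearIndependent.pair_iff' hv0]
      exact fun c hc => hdep' c hc.symm
    -- the action on the two basis vectors `v` and `s v`
    have act : ∀ g, ∃ c c' d d' : K, ρ g v = c • v + d • ρ s v ∧
        ρ g (ρ s v) = d' • v + c' • ρ s v ∧ c + c' = ind A ψ g := fun g => by
      by_cases hg : g ∈ A
      · refine ⟨ψ ⟨g, hg⟩, ψ ⟨_, hcj g hg⟩, 0, 0, by simpa using hψ ⟨g, hg⟩, ?_, ?_⟩
        · have : g * s = s * (s⁻¹ * g * s) := by group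
          rw [← Module.End.mul_apply, ← map_mul, this, map_mul, Module.End.mul_apply,
            hψ ⟨_, hcj g hg⟩]
          simp
        · rw [ind_index_two A hs hsA, zeroExt_of_mem _ hg, zeroExt_of_mem _ (hcj g hg)]
      · have hgs : g * s ∈ A := (Subgroup.mul_mem_iff_of_index_two h2).mpr (by simp [hsA, hg])
        refine ⟨0, 0, ψ ⟨_, hs g hg⟩, ψ ⟨_, hgs⟩, ?_, ?_, ?_⟩
        · have e : ρ g v = ρ (s * (s⁻¹ * g)) v := by rw [mul_inv_cancel_left]
          rw [e, map_mul, Module.End.mul_apply, hψ ⟨_, hs g hg⟩]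
          simp
        · rw [← Module.End.mul_apply, ← map_mul, hψ ⟨_, hgs⟩]
          simp
        · rw [ind_index_two A hs hsA, zeroExt_of_notMem _ hg, zeroExt_of_notMem, add_zero]
          intro h
          apply hg
          have := hn.conj_mem _ h s
          convert this using 1; group
    let W := invariantSubmodule (K := K) (G := G) (Submodule.span K (Set.range ![v, ρ s v]))
      fun g w hw => by
        have hle : Submodule.span K (Set.range ![v, ρ s v]) ≤
            (Submodule.span K (Set.range ![v, ρ s v])).comap (ρ g) := by
          rw [Submodule.span_le]
          have m0 : v ∈ Submodule.span K (Set.range ![v, ρ s v]) :=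
            Submodule.subset_span ⟨0, rfl⟩
          have m1 : ρ s v ∈ Submodule.span K (Set.range ![v, ρ s v]) :=
            Submodule.subset_span ⟨1, rfl⟩
          obtain ⟨c, c', d, d', e0, e1, -⟩ := act g
          rintro _ ⟨i, rfl⟩
          fin_cases i
          · change ρ g v ∈ Submodule.span K (Set.range ![v, ρ s v])
            rw [e0]; exact add_mem (Submodule.smul_mem _ _ m0) (Submodule.smul_mem _ _ m1)
          · change ρ g (ρ s v) ∈ Submodule.span K (Set.range ![v, ρ s v])
            rw [e1]; exact add_mem (Submodule.smul_mem _ _ m0) (Submodule.smul_mem _ _ m1)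
        exact hle hw
    have hvW : v ∈ W := Submodule.subset_span ⟨0, rfl⟩
    refine ⟨W, fun h => hv0 (by rw [h] at hvW; exact hvW), Or.inr ⟨ψ, ?_⟩⟩
    funext g
    let b : Basis (Fin 2) K W := Basis.span hli
    have b0 : (b 0 : V) = v := congrArg Subtype.val (Basis.span_apply hli 0)
    have b1 : (b 1 : V) = ρ s v := congrArg Subtype.val (Basis.span_apply hli 1)
    obtain ⟨c, c', d, d', e0, e1, e2⟩ := act g
    rw [modChar, Representation.character, ← e2]
    refine trace_fin_two b _ (d := d) (d' := d') (Subtype.ext ?_) (Subtype.ext ?_)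
    · change ρ g (b 0 : V) = c • (b 0 : V) + d • (b 1 : V)
      rw [b0, b1, e0]
    · change ρ g (b 1 : V) = d' • (b 0 : V) + c' • (b 1 : V)
      rw [b0, b1, e1]

/-- The virtual characters of a group with a commutative subgroup `A` of index at most two are
combinations of characters of degree one and of characters induced from `A`. -/
theorem mem_closure_of_index_le_two [IsAlgClosed K] (A : Subgroup G)
    (hA : ∀ a ∈ A, ∀ b ∈ A, a * b = b * a) (hidx : A.index ≤ 2) {f : G → K}
    (hf : f ∈ virtualCharacters K G) :
    f ∈ AddSubgroup.closure ({f : G → K | ∃ ψ : G →* K, f = ⇑ψ} ∪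
      {f : G → K | ∃ ψ : A →* K, f = ind A ψ}) := by
  set C := AddSubgroup.closure ({f : G → K | ∃ ψ : G →* K, f = ⇑ψ} ∪
      {f : G → K | ∃ ψ : A →* K, f = ind A ψ})
  have main : ∀ (n : ℕ) (V : Type _) [AddCommGroup V] [Module K V] [Module K[G] V]
      [IsScalarTower K K[G] V] [FiniteDimensional K V], finrank K V = n →
      (modChar K V : G → K) ∈ C := by
    intro n
    induction n using Nat.strong_induction_on with
    | _ n ih =>
    intro V _ _ _ _ _ hn
    rcases subsingleton_or_nontrivial V with hV | hV
    · have : (modChar K V : G → K) = 0 := by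
        funext g
        have : Representation.ofModule' (k := K) (G := G) V g = 0 := by
          ext x; exact Subsingleton.elim _ _
        rw [modChar, Representation.character, this, map_zero, Pi.zero_apply]
      rw [this]
      exact C.zero_mem
    · obtain ⟨W, hW0, hW⟩ := exists_submodule_monomial (K := K) A hA hidx V
      obtain ⟨W', hW'⟩ := exists_isCompl W
      have := finite_submodule (F := K) W
      have := finite_submodule (F := K) W'
      let e := Submodule.prodEquivOfIsCompl _ _ hW'
      have hadd : (modChar K V : G → K) = modChar K W + modChar K W' := by
        funext g
        rw [← modChar_congr e, modChar_prod]
        rfl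
      rw [hadd]
      refine C.add_mem (AddSubgroup.subset_closure hW) (ih _ ?_ W' rfl)
      have h1 : finrank K W + finrank K W' = n := by
        rw [← hn, ← (e.restrictScalars K).finrank_eq, finrank_prod]
      have h2 : finrank K W ≠ 0 := fun h => by
        have : Subsingleton W := Module.finrank_zero_iff.mp h
        exact hW0 ((Submodule.subsingleton_iff_eq_bot).mp this)
      omega
  refine virtualCharacters_induction (fun f hf => ?_) hf
  obtain ⟨n, r, hr⟩ := hf
  let ρ : Representation K G (Fin n → K) :=
    ((Matrix.toLinAlgEquiv' : Matrix (Fin n) (Fin n) K ≃ₐ[K] _) : _ →* _).comp r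
  have h := main n ρ.asModule (by
    rw [LinearEquiv.finrank_eq ρ.asModuleEquiv]; simp)
  convert h using 1
  funext g
  rw [hr, modChar, Representation.character,
    ← LinearMap.trace_conj' _ ρ.asModuleEquiv]
  have : ρ.asModuleEquiv.conj (Representation.ofModule' (k := K) (G := G) ρ.asModule g) = ρ g := by
    refine LinearMap.ext fun x => ?_
    rw [LinearEquiv.conj_apply_apply]
    change ρ.asModuleEquiv (MonoidAlgebra.of K G g • ρ.asModuleEquiv.symm x) = _
    rw [Representation.asModuleEquiv_map_smul]
    simp
  rw [this]
  exact (Matrix.trace_toLin'_eq (r g)).symm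

end Decomposition

/-! ### Ideals in rings of integral-valued functions -/

section Local

/-- Let `A` be a ring of integral-valued functions on a finite set. An ideal of `A` which has, at
each point, an integer prime to `q` among the integral combinations of its values contains
an integer prime to `q`. -/
theorem exists_int_mem_span {K G : Type*} [Field K] [Finite G] (A : Subring (G → K))
    (hA : ∀ f ∈ A, ∀ g, IsIntegral ℤ (f g)) (S : Set A) (q : ℕ) [hq : Fact q.Prime]
    (h : ∀ g : G, ∃ N : ℤ, ¬ (q : ℤ) ∣ N ∧
      (N : K) ∈ Submodule.span (integralClosure ℤ K) {x | ∃ s ∈ S, x = (s : G → K) g}) :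
    ∃ n : ℤ, ¬ (q : ℤ) ∣ n ∧ (n : A) ∈ Ideal.span S := by
  classical
  cases nonempty_fintype G
  by_contra! hcon
  let O := integralClosure ℤ K
  let φ : A →+* (G → O) :=
    { toFun := fun f g => ⟨(f : G → K) g, hA f f.2 g⟩
      map_one' := rfl
      map_mul' := fun _ _ => rfl
      map_zero' := rfl
      map_add' := fun _ _ => rfl }
  have hφ : Function.Injective φ := fun f f' hff => Subtype.ext <| funext fun g =>
    congrArg Subtype.val (congrFun hff g)
  have hBint : ∀ b : G → O, IsIntegral ℤ b := fun b => by
    have hb : b = ∑ g, (Pi.single g 1 : G → O) * (Pi.constAlgHom ℤ G O (b g)) := by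
      funext x
      simp [Finset.sum_apply, Pi.single_apply]
    rw [hb]
    refine IsIntegral.sum _ fun g _ => IsIntegral.mul ?_ ?_
    · refine ⟨Polynomial.X ^ 2 - Polynomial.X, ?_, ?_⟩
      · exact Polynomial.monic_X_pow_sub (by simp)
      · have : (Pi.single g 1 : G → O) ^ 2 = Pi.single g 1 := by
          rw [sq, ← Pi.single_mul, one_mul]
        simp [this]
    · exact (Algebra.IsIntegral.isIntegral (R := ℤ) (b g)).map (Pi.constAlgHom ℤ G O)
  let _ : Algebra A (G → O) := φ.toAlgebra
  have : Algebra.IsIntegral A (G → O) := ⟨fun b => (hBint b).tower_top⟩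
  have : Algebra.IsIntegral ℤ A := ⟨fun a =>
    (isIntegral_algHom_iff φ.toIntAlgHom hφ).mp (hBint (φ a))⟩
  let q0 : Ideal ℤ := Ideal.span {(q : ℤ)}
  have hq0 : q0.IsPrime :=
    (Ideal.span_singleton_prime (by exact_mod_cast hq.out.ne_zero)).mpr
      (Nat.prime_iff_prime_int.mp hq.out)
  obtain ⟨Q, hQI, hQp, hQ⟩ := Ideal.exists_ideal_over_prime_of_isIntegral q0
    (Ideal.span S) (fun n hn => by
      rw [Ideal.mem_span_singleton]
      by_contra hndvd
      exact hcon n hndvd (by simpa using hn))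
  obtain ⟨R, -, hRp, hR⟩ := Ideal.exists_ideal_over_prime_of_isIntegral (S := G → O) Q ⊥
    (fun a ha => by
      have : φ a = φ 0 := by rw [map_zero]; exact ha
      rw [hφ this]; exact Q.zero_mem)
  -- the prime `R` of the product of copies of `O` lives on a single factor `g`
  obtain ⟨g, hg⟩ : ∃ g, (Pi.single g 1 : G → O) ∉ R := by
    by_contra! hall
    apply hRp.ne_top
    rw [Ideal.eq_top_iff_one]
    have h1 : (1 : G → O) = ∑ g, Pi.single g 1 := by
      funext x
      simp [Finset.sum_apply, Pi.single_apply]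
    rw [h1]
    exact R.sum_mem fun g _ => hall g
  obtain ⟨N, hN, hspan⟩ := h g
  have key : ∀ x ∈ Submodule.span O {x | ∃ s ∈ S, x = (s : G → K) g},
      ∃ y : O, (y : K) = x ∧ (Pi.single g y : G → O) ∈ R := by
    intro x hx
    induction hx using Submodule.span_induction with
    | mem x hx =>
      obtain ⟨s, hs, rfl⟩ := hx
      refine ⟨φ s g, rfl, ?_⟩
      have h1 : φ s ∈ R := by
        have : s ∈ R.comap (algebraMap A (G → O)) := hR ▸ hQI (Ideal.subset_span hs)
        exact this
      have h2 : (Pi.single g (φ s g) : G → O) = Pi.single g 1 * φ s := by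
        funext x
        by_cases hx : x = g
        · subst hx; simp
        · simp [hx]
      rw [h2]
      exact R.mul_mem_left _ h1
    | zero => exact ⟨0, rfl, by simp⟩
    | add x y _ _ ihx ihy =>
      obtain ⟨x', rfl, hx⟩ := ihx
      obtain ⟨y', rfl, hy⟩ := ihy
      exact ⟨x' + y', rfl, by rw [Pi.single_add]; exact R.add_mem hx hy⟩
    | smul c x _ ihx =>
      obtain ⟨x', rfl, hx⟩ := ihx
      refine ⟨c * x', rfl, ?_⟩
      rw [Pi.single_mul]
      exact R.mul_mem_left _ hx
  obtain ⟨y, hy, hyR⟩ := key _ hspan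
  have hy' : y = (N : O) := Subtype.ext (hy.trans (by simp))
  have h3 : (Pi.single g y : G → O) = Pi.single g 1 * φ (N : A) := by
    rw [hy']
    funext x
    by_cases hx : x = g
    · subst hx; simp
    · simp [hx]
  rw [h3] at hyR
  have h4 : φ (N : A) ∈ R := (hRp.mem_or_mem hyR).resolve_left hg
  have h5 : (N : A) ∈ Q := by rw [← hR]; exact h4
  have h6 : N ∈ q0 := by rw [← hQ]; simpa using h5
  exact hN (Ideal.mem_span_singleton.mp h6)

end Local

/-! ### Brauer induction at one prime -/

section Brauer

variable {G : Type*} [Group G]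

/-- `IsElementary q x P` says that `P` is a `q`-group centralizing the element `x`, whose order is
prime to `q`; the subgroup `⟨x⟩ P` is then the direct product of `⟨x⟩` and `P`. -/
structure IsElementary (q : ℕ) (x : G) (P : Subgroup G) : Prop where
  isPGroup : IsPGroup q P
  comm : ∀ u ∈ P, Commute x u
  not_dvd : ¬ q ∣ orderOf x

variable [Fintype G]

theorem IsElementary.exists_equiv {q : ℕ} [hq : Fact q.Prime] {x : G} {P : Subgroup G}
    (h : IsElementary q x P) : ∃ e : Subgroup.zpowers x × P ≃* ↥(Subgroup.zpowers x ⊔ P),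
      ∀ a, (e a : G) = a.1 * a.2 := by
  have hc : ∀ (m : Subgroup.zpowers x) (n : P),
      Commute ((Subgroup.zpowers x).subtype m) (P.subtype n) := by
    rintro ⟨m, hm⟩ n
    obtain ⟨i, rfl⟩ := Subgroup.mem_zpowers_iff.mp hm
    exact (h.comm n n.2).zpow_left i
  have hinj : Function.Injective ((Subgroup.zpowers x).subtype.noncommCoprod P.subtype hc) := by
    rw [MonoidHom.noncommCoprod_injective]
    refine ⟨Subtype.val_injective, Subtype.val_injective, ?_⟩
    rw [Subgroup.range_subtype, Subgroup.range_subtype]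
    apply Subgroup.disjoint_of_coprime_natCard
    obtain ⟨n, hn⟩ := IsPGroup.iff_card.mp h.isPGroup
    rw [hn, Nat.card_zpowers]
    exact Nat.Coprime.pow_right _ ((Nat.Prime.coprime_iff_not_dvd hq.out).mpr h.not_dvd).symm
  refine ⟨(MonoidHom.ofInjective hinj).trans (MulEquiv.subgroupCongr ?_), fun a => rfl⟩
  rw [MonoidHom.noncommCoprod_range, Subgroup.range_subtype, Subgroup.range_subtype]

theorem IsElementary.card_sup {q : ℕ} [hq : Fact q.Prime] {x : G} {P : Subgroup G}
    (h : IsElementary q x P) :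
    Nat.card ↥(Subgroup.zpowers x ⊔ P) = orderOf x * Nat.card P := by
  obtain ⟨e, -⟩ := h.exists_equiv
  rw [← Nat.card_congr e.toEquiv, Nat.card_prod, Nat.card_zpowers]

/-- The character of `⟨x⟩ P` which is trivial on `P` and takes a primitive root of unity as value
at `x`. -/
theorem IsElementary.exists_character {K : Type*} [Field K] {q : ℕ} [hq : Fact q.Prime] {x : G}
    {P : Subgroup G} (h : IsElementary q x P) {ζ : K} (hζ : IsPrimitiveRoot ζ (orderOf x)) :
    ∃ κ : ↥(Subgroup.zpowers x ⊔ P) →* K, (∀ y, κ y ^ orderOf x = 1) ∧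
      ∀ y, κ y = ζ ↔ ∃ u ∈ P, (y : G) = x * u := by
  obtain ⟨e, he⟩ := h.exists_equiv
  have hx : 0 < orderOf x := orderOf_pos x
  let z : Kˣ := (hζ.isUnit hx.ne').unit
  let x' : Subgroup.zpowers x := ⟨x, Subgroup.mem_zpowers x⟩
  have hx' : ∀ y : Subgroup.zpowers x, y ∈ Subgroup.zpowers x' := by
    rintro ⟨y, hy⟩
    obtain ⟨i, rfl⟩ := Subgroup.mem_zpowers_iff.mp hy
    exact Subgroup.mem_zpowers_iff.mpr ⟨i, Subtype.ext (by simp [x'])⟩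
  have ho : orderOf x' = orderOf x := Subgroup.orderOf_mk x _
  have hz : IsPrimitiveRoot z (orderOf x) := IsPrimitiveRoot.coe_units_iff.mp hζ
  let c : Subgroup.zpowers x →* Kˣ := monoidHomOfForallMemZpowers (g' := z) hx'
    (by rw [ho, ← hz.eq_orderOf])
  have hc : c x' = z := monoidHomOfForallMemZpowers_apply_gen _ _
  have hcz : ∀ y, c y = z → y = x' := by
    intro y hy
    obtain ⟨i, rfl⟩ := Subgroup.mem_zpowers_iff.mp (hx' y)
    rw [map_zpow, hc] at hy
    have h1 : z ^ (i - 1) = 1 := by rw [zpow_sub, hy, zpow_one, mul_inv_cancel]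
    rw [hz.zpow_eq_one_iff_dvd, ← ho, orderOf_dvd_iff_zpow_eq_one] at h1
    rwa [zpow_sub, zpow_one, mul_inv_eq_one] at h1
  refine ⟨(Units.coeHom K).comp (c.comp ((MonoidHom.fst _ _).comp e.symm.toMonoidHom)),
    fun y => ?_, fun y => ?_⟩
  · rw [← map_pow]
    have : (e.symm y).1 ^ orderOf x = 1 := by
      rw [← Nat.card_zpowers]
      exact pow_card_eq_one'
    change ((c (e.symm (y ^ orderOf x)).1 : Kˣ) : K) = 1
    rw [map_pow, Prod.pow_fst, this, map_one, Units.val_one]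
  · obtain ⟨⟨a, u⟩, rfl⟩ := e.surjective y
    have hval : ((Units.coeHom K).comp (c.comp ((MonoidHom.fst _ _).comp e.symm.toMonoidHom)))
        (e (a, u)) = (c a : K) := by
      change ((c (e.symm (e (a, u))).1 : Kˣ) : K) = _
      rw [e.symm_apply_apply]
    rw [hval, he]
    constructor
    · intro h1
      have h2 : a = x' := hcz a (Units.ext h1)
      exact ⟨u, u.2, by rw [h2]⟩
    · rintro ⟨v, hv, h1⟩
      have h2 : e (a, u) = e (x', ⟨v, hv⟩) := Subtype.ext (by rw [he, he]; exact h1)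
      have h3 : a = x' := congrArg Prod.fst (e.injective h2)
      rw [h3, hc]
      rfl

/-- The decomposition of an element into a part of order prime to `q` and a `q`-part, both of which
are powers; raising to the power `E` extracts the first one. -/
theorem exists_primary_parts (q : ℕ) [hq : Fact q.Prime] (g : G) :
    ∃ (x u : G) (E b : ℕ), g = x * u ∧ Commute x u ∧ ¬ q ∣ orderOf x ∧ x ^ E = x ∧ g ^ E = x ∧
      q ^ b ∣ E ∧ u ^ q ^ b = 1 ∧ ∀ P : Subgroup G, IsPGroup q P → ∀ p ∈ P, p ^ q ^ b = 1 := by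
  obtain ⟨b, m, hm, hcard⟩ := Nat.exists_eq_pow_mul_and_not_dvd (Nat.card_pos (α := G)).ne' q
    hq.out.ne_one
  have hcop : (q ^ b).Coprime m :=
    Nat.Coprime.pow_left _ ((Nat.Prime.coprime_iff_not_dvd hq.out).mpr hm)
  obtain ⟨E, hE0, hE1⟩ := Nat.chineseRemainder hcop 0 1
  rw [Nat.modEq_zero_iff_dvd] at hE0
  have hE1' : (m : ℤ) ∣ (E : ℤ) - 1 := by
    simpa using Nat.modEq_iff_dvd.mp hE1.symm
  have hgc : ∀ (k : ℤ), ((q ^ b * m : ℕ) : ℤ) ∣ k → g ^ k = 1 := fun k hk => by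
    rw [← orderOf_dvd_iff_zpow_eq_one]
    exact (Int.natCast_dvd_natCast.mpr (hcard ▸ orderOf_dvd_natCard g)).trans hk
  have hxm : (g ^ E) ^ m = 1 := by
    rw [← pow_mul, ← zpow_natCast]
    apply hgc
    exact_mod_cast Nat.mul_dvd_mul_right hE0 m
  have hcomm : Commute (g ^ E) ((g ^ E)⁻¹ * g) :=
    ((Commute.refl _).inv_right).mul_right ((Commute.refl g).pow_left E)
  refine ⟨g ^ E, (g ^ E)⁻¹ * g, E, b, by simp, hcomm, ?_, ?_, rfl, hE0, ?_, ?_⟩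
  · intro hd
    exact hm (hd.trans (orderOf_dvd_of_pow_eq_one hxm))
  · have h1 : (g ^ E) ^ ((E : ℤ) - 1) = 1 := by
      rw [← orderOf_dvd_iff_zpow_eq_one]
      exact (Int.natCast_dvd_natCast.mpr (orderOf_dvd_of_pow_eq_one hxm)).trans hE1'
    rw [zpow_sub, zpow_one, mul_inv_eq_one] at h1
    exact_mod_cast h1
  · have h1 : (g ^ E)⁻¹ * g = g ^ (1 - (E : ℤ)) := by
      rw [zpow_sub, zpow_one, zpow_natCast]
      exact ((((Commute.refl g).pow_left E).inv_left).eq :)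
    rw [h1, ← zpow_natCast, ← zpow_mul]
    apply hgc
    rw [mul_comm]
    push_cast
    have h2 : (m : ℤ) ∣ 1 - (E : ℤ) := by rwa [← dvd_neg, neg_sub]
    exact mul_dvd_mul_right h2 _
  · intro P hP p hp
    obtain ⟨n, hn⟩ := IsPGroup.iff_card.mp hP
    have h1 : Nat.card P ∣ q ^ b := by
      have h2 : Nat.card P ∣ q ^ b * m := hcard ▸ P.card_subgroup_dvd_card
      refine Nat.Coprime.dvd_of_dvd_mul_right ?_ h2
      rw [hn]
      exact Nat.Coprime.pow_left _ ((Nat.Prime.coprime_iff_not_dvd hq.out).mpr hm)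
    rw [← orderOf_dvd_iff_pow_eq_one]
    exact (P.orderOf_dvd_natCard hp).trans h1

/-- For a `q`-element `u` and a Sylow `q`-subgroup `P`, the number of conjugators of `u` into `P`
is the order of `P` times the number of fixed points of `u` on the cosets of `P`, which is prime
to `q`. -/
theorem card_conj_mem_sylow {q : ℕ} [hq : Fact q.Prime] (P : Sylow q G) {u : G} {b : ℕ}
    (hu : u ^ q ^ b = 1) :
    ∃ N : ℕ, ¬ q ∣ N ∧ Nat.card {y : G // y⁻¹ * u * y ∈ P} = Nat.card P * N := by
  have hP : IsPGroup q (Subgroup.zpowers u) := by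
    rintro ⟨v, hv⟩
    obtain ⟨i, rfl⟩ := Subgroup.mem_zpowers_iff.mp hv
    refine ⟨b, Subtype.ext ?_⟩
    simp only [SubmonoidClass.mk_pow, OneMemClass.coe_one]
    rw [← zpow_natCast, zpow_comm, zpow_natCast, hu, one_zpow]
  let T : Set (G ⧸ (P : Subgroup G)) := MulAction.fixedPoints (Subgroup.zpowers u) _
  have hT : ∀ y : G, y ∈ (QuotientGroup.mk ⁻¹' T : Set G) ↔ y⁻¹ * u * y ∈ P := by
    intro y
    have h1 : y⁻¹ * u * y ∈ P ↔ u • (y : G ⧸ (P : Subgroup G)) = y := by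
      rw [← SetLike.mem_coe, ← Sylow.coe_coe, SetLike.mem_coe, ← Subgroup.inv_mem_iff,
        MulAction.Quotient.smul_coe, QuotientGroup.eq]
      simp [mul_assoc]
    rw [h1]
    constructor
    · intro h
      exact h ⟨u, Subgroup.mem_zpowers u⟩
    · rintro h ⟨v, hv⟩
      have : Subgroup.zpowers u ≤ MulAction.stabilizer G (y : G ⧸ (P : Subgroup G)) := by
        rw [Subgroup.zpowers_le]; exact h
      exact this hv
  refine ⟨Nat.card T, fun hd => P.not_dvd_index ?_, ?_⟩
  · have h1 := hP.card_modEq_card_fixedPoints (G ⧸ (P : Subgroup G))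
    rw [Subgroup.index_eq_card]
    exact (h1.dvd_iff dvd_rfl).mpr hd
  · rw [← Nat.card_prod, ← Nat.card_congr (QuotientGroup.preimageMkEquivSubgroupProdSet _ T)]
    exact Nat.card_congr (Equiv.subtypeEquivRight fun y => (hT y).symm)

/-- A combination of characters induced from `⟨x⟩ P` whose value at `g` is prime to `q`; here `x` is
the part of `g` of order prime to `q`, and `P` is a Sylow subgroup of its centralizer. -/
theorem exists_sum_ind_eq {K : Type*} [Field K] [CharZero K] [IsAlgClosed K] (q : ℕ)
    [hq : Fact q.Prime] (g : G) :
    ∃ (x : G) (P : Subgroup G) (ζ : K) (κ : ↥(Subgroup.zpowers x ⊔ P) →* K) (N : ℕ),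
      IsElementary q x P ∧ IsPrimitiveRoot ζ (orderOf x) ∧ (∀ y, κ y ^ orderOf x = 1) ∧ ¬ q ∣ N ∧
      ∑ j ∈ Finset.range (orderOf x), (ζ⁻¹) ^ j * ind (Subgroup.zpowers x ⊔ P) (κ ^ j) g = N := by
  classical
  obtain ⟨x, u, E, b, rfl, hcomm, hxq, hxE, hgE, hbE, hub, hPb⟩ := exists_primary_parts q g
  have hx : 0 < orderOf x := orderOf_pos x
  let Z : Subgroup G := Subgroup.centralizer {x}
  have hZ : ∀ {y}, y ∈ Z ↔ y * x = x * y := fun {y} => by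
    simp [Z, Subgroup.mem_centralizer_singleton_iff]
  let P : Sylow q Z := default
  let P' : Subgroup G := (P : Subgroup Z).map Z.subtype
  have hel : IsElementary q x P' :=
    { isPGroup := P.2.map _
      comm := by
        rintro _ ⟨v, -, rfl⟩
        exact (hZ.mp v.2).symm
      not_dvd := hxq }
  have : NeZero (orderOf x : K) := ⟨by exact_mod_cast hx.ne'⟩
  obtain ⟨ζ, hζ⟩ := HasEnoughRootsOfUnity.exists_primitiveRoot K (orderOf x)
  have hκ := hel.exists_character hζ
  have huZ : u ∈ Z := hZ.mpr hcomm.symm.eq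
  obtain ⟨N, hN, hcount⟩ := card_conj_mem_sylow P (u := (⟨u, huZ⟩ : Z)) (b := b) (Subtype.ext hub)
  set H := Subgroup.zpowers x ⊔ P' with hH
  obtain ⟨κ, hκ1, hκ⟩ := hκ
  refine ⟨x, P', ζ, κ, N, hel, hζ, hκ1, hN, ?_⟩
  have hζ0 : ζ ≠ 0 := hζ.ne_zero hx.ne'
  -- orthogonality of the powers of `κ`
  have horth : ∀ z : G, ∑ j ∈ Finset.range (orderOf x), (ζ⁻¹) ^ j * zeroExt H (κ ^ j) z =
      if ∃ v ∈ P', z = x * v then (orderOf x : K) else 0 := by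
    intro z
    by_cases hz : z ∈ H
    · have h1 : ∀ j, (ζ⁻¹) ^ j * zeroExt H ⇑(κ ^ j) z = (ζ⁻¹ * κ ⟨z, hz⟩) ^ j := fun j => by
        rw [zeroExt_of_mem _ hz, mul_pow, MonoidHom.pow_apply]
      simp only [h1]
      split_ifs with h
      · rw [(hκ ⟨z, hz⟩).mpr h, inv_mul_cancel₀ hζ0]
        simp
      · have h2 : ζ⁻¹ * κ ⟨z, hz⟩ ≠ 1 := fun h2 => h ((hκ ⟨z, hz⟩).mp (by
          rwa [inv_mul_eq_one₀ hζ0, eq_comm] at h2))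
        have h3 : (ζ⁻¹ * κ ⟨z, hz⟩) ^ orderOf x = 1 := by
          rw [mul_pow, hκ1, inv_pow, hζ.pow_eq_one, inv_one, one_mul]
        rw [geom_sum_eq h2, h3, sub_self, zero_div]
    · rw [if_neg]
      · exact Finset.sum_eq_zero fun j _ => by rw [zeroExt_of_notMem _ hz, mul_zero]
      · rintro ⟨v, hv, rfl⟩
        exact hz (H.mul_mem (Subgroup.mem_sup_left (Subgroup.mem_zpowers x))
          (Subgroup.mem_sup_right hv))
  -- an element conjugates `x u` into `x P'` only if it centralizes `x`
  have hconj : ∀ y : G, (∃ v ∈ P', y⁻¹ * (x * u) * y = x * v) ↔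
      ∃ hy : y ∈ Z, (⟨y, hy⟩ : Z)⁻¹ * ⟨u, huZ⟩ * ⟨y, hy⟩ ∈ P := by
    intro y
    constructor
    · rintro ⟨v, hv, h⟩
      have hvE : v ^ E = 1 := by
        obtain ⟨k, rfl⟩ := hbE
        rw [pow_mul, hPb P' hel.isPGroup v hv, one_pow]
      have h1 : y⁻¹ * x * y = x := by
        have h2 : (y⁻¹ * (x * u) * y) ^ E = y⁻¹ * (x * u) ^ E * y := by
          simpa using conj_pow (a := y⁻¹) (b := x * u) (i := E)
        rw [h, (hel.comm v hv).mul_pow, hvE, mul_one, hxE, hgE] at h2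
        exact h2.symm
      have hy : y ∈ Z := hZ.mpr (by
        have := congrArg (y * ·) h1
        simpa [mul_assoc] using this.symm)
      refine ⟨hy, ?_⟩
      have h2 : y⁻¹ * u * y = v := by
        have h3 : y⁻¹ * (x * u) * y = (y⁻¹ * x * y) * (y⁻¹ * u * y) := by group
        rw [h3, h1] at h
        exact mul_left_cancel h
      obtain ⟨w, hw, rfl⟩ := hv
      have h4 : (⟨y, hy⟩ : Z)⁻¹ * ⟨u, huZ⟩ * ⟨y, hy⟩ = w := Subtype.ext h2
      rw [h4]
      exact hw
    · rintro ⟨hy, h⟩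
      refine ⟨y⁻¹ * u * y, ⟨_, h, rfl⟩, ?_⟩
      have h1 : y⁻¹ * x = x * y⁻¹ := by
        rw [inv_mul_eq_iff_eq_mul, ← mul_assoc, hZ.mp hy, mul_inv_cancel_right]
      simp only [← mul_assoc, h1]
  have hcard : Nat.card {y : G // ∃ v ∈ P', y⁻¹ * (x * u) * y = x * v} = Nat.card P * N := by
    rw [← hcount]
    refine Nat.card_congr ((Equiv.subtypeEquivRight hconj).trans
      { toFun := fun y => ⟨⟨y, y.2.1⟩, y.2.2⟩
        invFun := fun y => ⟨y.1, y.1.2, y.2⟩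
        left_inv := fun _ => rfl
        right_inv := fun _ => rfl })
  have hsum : ∑ j ∈ Finset.range (orderOf x), (ζ⁻¹) ^ j * ind H (κ ^ j) (x * u) =
      (Nat.card H : K)⁻¹ * ∑ y : G, if ∃ v ∈ P', y⁻¹ * (x * u) * y = x * v then
        (orderOf x : K) else 0 := by
    simp only [ind]
    rw [Finset.sum_congr rfl fun y _ => (horth (y⁻¹ * (x * u) * y)).symm, Finset.sum_comm,
      Finset.mul_sum]
    refine Finset.sum_congr rfl fun j _ => ?_
    rw [mul_left_comm, Finset.mul_sum]
  have hP' : Nat.card P' = Nat.card P :=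
    Nat.card_congr ((P : Subgroup Z).equivMapOfInjective _ Z.subtype_injective).toEquiv.symm
  have hP0 : (Nat.card P : K) ≠ 0 := by exact_mod_cast Nat.card_pos.ne'
  have hx0 : (orderOf x : K) ≠ 0 := by exact_mod_cast hx.ne'
  rw [hsum, ← Finset.sum_filter, Finset.sum_const, ← Fintype.card_subtype,
    Fintype.card_eq_nat_card, hcard, hel.card_sup, hP', nsmul_eq_mul]
  push_cast
  field_simp

/-- The local form of Brauer's induction theorem at a prime `q`. -/
theorem exists_zsmul_mem_of_isElementary {K : Type*} [Field K] [CharZero K] [IsAlgClosed K] (q : ℕ)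
    [hq : Fact q.Prime] (A : Subring (G → K)) (hA : ∀ f ∈ A, ∀ g, IsIntegral ℤ (f g))
    (hAc : ∀ f ∈ A, ∀ x g, f (x⁻¹ * g * x) = f g)
    (hAi : ∀ (x : G) (P : Subgroup G), IsElementary q x P →
      ∀ η : ↥(Subgroup.zpowers x ⊔ P) →* K, (∀ y, η y ^ orderOf x = 1) → ind _ η ∈ A)
    (B : AddSubgroup (G → K))
    (hB : ∀ f ∈ A, ∀ (x : G) (P : Subgroup G), IsElementary q x P →
      ∀ η : ↥(Subgroup.zpowers x ⊔ P) →* K, (∀ y, η y ^ orderOf x = 1) →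
        ind (Subgroup.zpowers x ⊔ P) (fun h => f h * η h) ∈ B) :
    ∃ n : ℤ, ¬ (q : ℤ) ∣ n ∧ ∀ f ∈ A, n • f ∈ B := by
  let S : Set A := {s | ∃ (x : G) (P : Subgroup G) (_ : IsElementary q x P)
    (η : ↥(Subgroup.zpowers x ⊔ P) →* K), (∀ y, η y ^ orderOf x = 1) ∧ (s : G → K) = ind _ η}
  obtain ⟨n, hn, hnS⟩ := exists_int_mem_span A hA S q fun g => by
    obtain ⟨x, P, ζ, κ, N, hel, hζ, hκ, hN, hsum⟩ := exists_sum_ind_eq (K := K) q g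
    refine ⟨N, by exact_mod_cast hN, ?_⟩
    rw [Int.cast_natCast, ← hsum]
    have hκj : ∀ (j : ℕ) (y), (κ ^ j) y ^ orderOf x = 1 := fun j y => by
      rw [MonoidHom.pow_apply, ← pow_mul, mul_comm, pow_mul, hκ, one_pow]
    refine Submodule.sum_mem _ fun j _ => ?_
    have hint : IsIntegral ℤ (ζ⁻¹ ^ j) := IsIntegral.pow (hζ.inv.isIntegral (orderOf_pos x)) j
    exact Submodule.smul_mem _ (⟨_, hint⟩ : integralClosure ℤ K)
      (Submodule.subset_span ⟨⟨_, hAi x P hel (κ ^ j) (hκj j)⟩,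
        ⟨x, P, hel, κ ^ j, hκj j, rfl⟩, rfl⟩)
  refine ⟨n, hn, fun f hf => ?_⟩
  have key : ∀ a ∈ Ideal.span S, ∀ f ∈ A, f * (a : G → K) ∈ B := by
    intro a ha
    induction ha using Submodule.span_induction with
    | mem a ha =>
      obtain ⟨x, P, hel, η, hη, ha⟩ := ha
      intro f hf
      rw [ha, mul_ind _ _ _ (hAc f hf)]
      exact hB f hf x P hel η hη
    | zero => intro f _; simp
    | add a b _ _ iha ihb =>
      intro f hf
      rw [Subring.coe_add, mul_add]
      exact B.add_mem (iha f hf) (ihb f hf)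
    | smul c a _ iha =>
      intro f hf
      rw [smul_eq_mul, Subring.coe_mul, ← mul_assoc]
      exact iha _ (A.mul_mem hf c.2)
  have h1 := key _ hnS f hf
  have h2 : f * (((n : A) : G → K)) = n • f := by
    rw [zsmul_eq_mul, mul_comm]
    rfl
  rwa [h2] at h1

end Brauer

/-! ### Brauer's induction theorem -/

section BrauerGlobal

/-- An inclusion of subgroups of an abelian group holds if it holds locally at each prime. -/
theorem mem_of_forall_prime {M : Type*} [AddCommGroup M] {A B : AddSubgroup M}
    (h : ∀ q : ℕ, q.Prime → ∃ n : ℤ, ¬ (q : ℤ) ∣ n ∧ ∀ f ∈ A, n • f ∈ B) : A ≤ B := by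
  let I : Ideal ℤ :=
    { carrier := {n | ∀ f ∈ A, n • f ∈ B}
      add_mem' := fun {a b} ha hb f hf => by
        rw [add_smul]; exact B.add_mem (ha f hf) (hb f hf)
      zero_mem' := fun f _ => by rw [zero_smul]; exact B.zero_mem
      smul_mem' := fun c a ha f hf => by
        rw [smul_assoc]; exact B.zsmul_mem (ha f hf) c }
  have hI : ∀ n, n ∈ I ↔ Submodule.IsPrincipal.generator I ∣ n := fun n =>
    Submodule.IsPrincipal.mem_iff_generator_dvd I
  have h1 : (Submodule.IsPrincipal.generator I).natAbs = 1 := by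
    by_contra hne
    obtain ⟨q, hq, hqd⟩ := Nat.exists_prime_and_dvd hne
    obtain ⟨n, hn, hnI⟩ := h q hq
    exact hn ((Int.natCast_dvd.mpr hqd).trans ((hI n).mp hnI))
  intro f hf
  have h2 : (1 : ℤ) ∈ I := (hI 1).mpr (Int.isUnit_iff_natAbs_eq.mpr h1).dvd
  simpa using h2 f hf

variable {K G : Type*} [Field K] [CharZero K] [IsAlgClosed K] [Group G] [Fintype G]

/-- The virtual characters of a commutative group are combinations of characters of degree one. -/
theorem mem_closure_of_comm (hG : ∀ a b : G, a * b = b * a) {f : G → K}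
    (hf : f ∈ virtualCharacters K G) :
    f ∈ AddSubgroup.closure {f : G → K | ∃ ψ : G →* K, f = ⇑ψ} := by
  refine (AddSubgroup.closure_le _).mpr ?_
    (mem_closure_of_index_le_two ⊤ (fun a _ b _ => hG a b) (by simp) hf)
  rintro _ (⟨ψ, rfl⟩ | ⟨ψ, rfl⟩)
  · exact AddSubgroup.subset_closure ⟨ψ, rfl⟩
  · refine AddSubgroup.subset_closure
      ⟨ψ.comp (Subgroup.topEquiv (G := G)).symm.toMonoidHom, ?_⟩
    exact ind_top (fun g => ψ ⟨g, Subgroup.mem_top g⟩) fun x g => by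
      congr 1
      exact Subtype.ext (by rw [hG (x⁻¹ * g) x, mul_inv_cancel_left])

/-- The values of virtual characters are integral combinations of roots of unity, by restriction
to cyclic subgroups. -/
theorem virtualCharacters_apply_mem {f : G → K} (hf : f ∈ virtualCharacters K G) (g : G) :
    f g ∈ AddSubgroup.closure {z : K | z ^ orderOf g = 1} := by
  have h1 := virtualCharacters_comp (Subgroup.zpowers g).subtype hf
  have h2 := mem_closure_of_comm (fun a b => mul_comm' a b) h1
  let ev : (Subgroup.zpowers g → K) →+ K := Pi.evalAddMonoidHom _ ⟨g, Subgroup.mem_zpowers g⟩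
  have h3 : AddSubgroup.closure {f : Subgroup.zpowers g → K | ∃ ψ : Subgroup.zpowers g →* K,
      f = ⇑ψ} ≤ (AddSubgroup.closure {z : K | z ^ orderOf g = 1}).comap ev := by
    rw [AddSubgroup.closure_le]
    rintro _ ⟨ψ, rfl⟩
    refine AddSubgroup.subset_closure ?_
    change ψ _ ^ orderOf g = 1
    rw [← map_pow, show (⟨g, Subgroup.mem_zpowers g⟩ : Subgroup.zpowers g) ^ orderOf g = 1 from
      Subtype.ext (pow_orderOf_eq_one g), map_one]
  exact h3 h2

theorem isIntegral_of_mem_virtualCharacters {f : G → K} (hf : f ∈ virtualCharacters K G) (g : G) :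
    IsIntegral ℤ (f g) := by
  have : AddSubgroup.closure {z : K | z ^ orderOf g = 1} ≤
      (integralClosure ℤ K).toSubring.toAddSubgroup := by
    rw [AddSubgroup.closure_le]
    intro z hz
    exact ⟨Polynomial.X ^ orderOf g - 1, Polynomial.monic_X_pow_sub_C 1 (orderOf_pos g).ne',
      by simpa [sub_eq_zero] using hz⟩
  exact this (virtualCharacters_apply_mem hf g)

theorem IsElementary.exists_subgroup {q : ℕ} [Fact q.Prime] {x : G} {P : Subgroup G}
    (h : IsElementary q x P) (A : Subgroup P) (hA : ∀ a ∈ A, ∀ b ∈ A, a * b = b * a) :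
    ∃ A' : Subgroup ↥(Subgroup.zpowers x ⊔ P),
      (∀ a ∈ A', ∀ b ∈ A', a * b = b * a) ∧ A'.index = A.index := by
  obtain ⟨e, -⟩ := h.exists_equiv
  refine ⟨((⊤ : Subgroup (Subgroup.zpowers x)).prod A).comap e.symm.toMonoidHom, ?_, ?_⟩
  · intro a ha b hb
    apply e.symm.injective
    rw [map_mul, map_mul]
    exact Prod.ext (mul_comm' _ _) (hA _ ha.2 _ hb.2)
  · rw [Subgroup.index_comap_of_surjective _ e.symm.surjective, Subgroup.index_prod,
      Subgroup.index_top, one_mul]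

/-- Brauer's induction theorem, for the groups whose `q`-subgroups have a commutative subgroup of
index at most two. -/
theorem virtualCharacters_le_monomialSpan (n : ℕ) (hn : ∀ g : G, g ^ n = 1)
    (hP : ∀ q : ℕ, q.Prime → ∀ P : Subgroup G, IsPGroup q P →
      ∃ A : Subgroup P, (∀ a ∈ A, ∀ b ∈ A, a * b = b * a) ∧ A.index ≤ 2) :
    (virtualCharacters K G).toAddSubgroup ≤ monomialSpan K n G := by
  refine mem_of_forall_prime fun q hq => ?_
  have := Fact.mk hq
  refine exists_zsmul_mem_of_isElementary q (virtualCharacters K G)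
    (fun f hf => isIntegral_of_mem_virtualCharacters hf) (fun f hf => virtualCharacters_conj hf)
    (fun x P _ η _ => ind_mem_virtualCharacters _ η) _ fun f hf x P hel η hη => ?_
  have hn' : ∀ (H : Subgroup G) (h : H), h ^ n = 1 := fun H h => Subtype.ext (hn h)
  obtain ⟨A, hA, hidx⟩ := hP q hq P hel.isPGroup
  obtain ⟨A', hA', hidx'⟩ := hel.exists_subgroup A hA
  classical
  refine ind_mem_monomialSpan_of_mem _ ?_
  have hθ : (fun h : ↥(Subgroup.zpowers x ⊔ P) => f h * η h) ∈
      virtualCharacters K ↥(Subgroup.zpowers x ⊔ P) :=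
    Subring.mul_mem _ (virtualCharacters_comp (Subgroup.subtype _) hf)
      (monoidHom_mem_virtualCharacters η)
  refine (AddSubgroup.closure_le _).mpr ?_
    (mem_closure_of_index_le_two A' hA' (hidx'.trans_le hidx) hθ)
  rintro _ (⟨ψ, rfl⟩ | ⟨ψ, rfl⟩)
  · exact monoidHom_mem_monomialSpan ψ fun h => by rw [← map_pow, hn', map_one]
  · refine AddSubgroup.subset_closure ⟨A', ψ, fun h => ?_, rfl⟩
    rw [← map_pow, show h ^ n = 1 from Subtype.ext (hn' _ _), map_one]

end BrauerGlobal

/-! ### Projections between cyclotomic fields -/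

section Cyclotomic

theorem cyclotomicSubfield_eq_adjoin {n : ℕ} {ζ : QBar} (hn : 0 < n) (hζ : IsPrimitiveRoot ζ n) :
    cyclotomicSubfield n = IntermediateField.adjoin ℚ {ζ} := by
  apply le_antisymm
  · rw [cyclotomicSubfield, IntermediateField.adjoin_le_iff]
    intro z hz
    have : NeZero n := ⟨hn.ne'⟩
    obtain ⟨i, -, rfl⟩ := hζ.eq_pow_of_pow_eq_one hz
    exact pow_mem (IntermediateField.mem_adjoin_simple_self ℚ ζ) i
  · rw [cyclotomicSubfield]
    refine IntermediateField.adjoin.mono _ _ _ ?_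
    rintro _ rfl
    exact hζ.pow_eq_one

theorem minpoly_natDegree_eq_totient {n : ℕ} {ζ : QBar} (hn : 0 < n) (hζ : IsPrimitiveRoot ζ n) :
    (minpoly ℚ ζ).natDegree = n.totient := by
  rw [← Polynomial.cyclotomic_eq_minpoly_rat hζ hn, Polynomial.natDegree_cyclotomic]

theorem exists_isPrimitiveRoot {n : ℕ} (hn : 0 < n) : ∃ ζ : QBar, IsPrimitiveRoot ζ n := by
  have : NeZero (n : QBar) := ⟨by exact_mod_cast hn.ne'⟩
  exact HasEnoughRootsOfUnity.exists_primitiveRoot QBar n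

/-- If `r` divides `n`, then the extension `ℚ(ζ_{nr}) / ℚ(ζ_n)` has degree `r`, and it is
generated by `ζ_{nr}`. -/
theorem linearIndependent_pow_cyclotomic {n r : ℕ} (hn : 0 < n) (hr' : r.Prime) (hr : r ∣ n)
    {ζ : QBar} (hζ : IsPrimitiveRoot ζ (n * r)) :
    LinearIndependent (cyclotomicSubfield n) (fun i : Fin r => ζ ^ (i : ℕ)) := by
  have hr0 : 0 < r := hr'.pos
  obtain ⟨ω, hω⟩ := exists_isPrimitiveRoot hn
  have hint : IsIntegral (cyclotomicSubfield n) ζ := by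
    have : IsIntegral ℚ ζ := (hζ.isIntegral (Nat.mul_pos hn hr0)).tower_top
    exact this.tower_top
  let L := IntermediateField.adjoin (cyclotomicSubfield n) {ζ}
  have hF : finrank ℚ (cyclotomicSubfield n) = n.totient := by
    rw [cyclotomicSubfield_eq_adjoin hn hω, IntermediateField.adjoin.finrank
      (hω.isIntegral hn).tower_top, minpoly_natDegree_eq_totient hn hω]
  have hFpos : 0 < n.totient := Nat.totient_pos.mpr hn
  have hfin : FiniteDimensional ℚ (cyclotomicSubfield n) :=
    FiniteDimensional.of_finrank_pos (by rw [hF]; exact hFpos)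
  have hfinL : FiniteDimensional (cyclotomicSubfield n) L :=
    IntermediateField.adjoin.finiteDimensional hint
  have hfinQ : FiniteDimensional ℚ L := FiniteDimensional.trans ℚ (cyclotomicSubfield n) L
  have hdeg : r ≤ (minpoly (cyclotomicSubfield n) ζ).natDegree := by
    have h1 : finrank (cyclotomicSubfield n) L =
        (minpoly (cyclotomicSubfield n) ζ).natDegree := IntermediateField.adjoin.finrank hint
    have h2 := Module.finrank_mul_finrank ℚ (cyclotomicSubfield n) L
    have h3 : (minpoly ℚ (⟨ζ, IntermediateField.mem_adjoin_simple_self _ ζ⟩ : L)).natDegree ≤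
      finrank ℚ L := minpoly.natDegree_le _
    have h4 : minpoly ℚ (⟨ζ, IntermediateField.mem_adjoin_simple_self _ ζ⟩ : L) = minpoly ℚ ζ :=
      (minpoly.algebraMap_eq (B := L) (B' := QBar) (A := ℚ) Subtype.val_injective _).symm
    rw [h4, minpoly_natDegree_eq_totient (Nat.mul_pos hn hr0) hζ, mul_comm n,
      Nat.totient_mul_of_prime_of_dvd hr' hr, ← h2, hF, h1, mul_comm] at h3
    exact Nat.le_of_mul_le_mul_left h3 hFpos
  exact (linearIndependent_pow (K := cyclotomicSubfield n) ζ).comp (Fin.castLE hdeg)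
    (Fin.castLE_injective hdeg)

/-- A `ℚ(ζ_n)`-linear projection that kills the `nr`-th roots of unity outside `ℚ(ζ_n)`. -/
theorem exists_cyclotomic_projection {n r : ℕ} (hn : 0 < n) (hr' : r.Prime) (hr : r ∣ n) :
    ∃ π : QBar →ₗ[cyclotomicSubfield n] QBar, π 1 = 1 ∧
      ∀ z : QBar, z ^ (n * r) = 1 → z ^ n ≠ 1 → π z = 0 := by
  have hr0 : 0 < r := hr'.pos
  obtain ⟨ζ, hζ⟩ := exists_isPrimitiveRoot (Nat.mul_pos hn hr0)
  have hli := linearIndependent_pow_cyclotomic hn hr' hr hζ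
  have : NeZero (n * r) := ⟨(Nat.mul_pos hn hr0).ne'⟩
  let F := cyclotomicSubfield n
  let b := Basis.span hli
  obtain ⟨f, hf⟩ := LinearMap.exists_extend (b.coord ⟨0, hr0⟩)
  have hb : ∀ i : Fin r, f (ζ ^ (i : ℕ)) = if i = ⟨0, hr0⟩ then 1 else 0 := fun i => by
    have h1 := LinearMap.congr_fun hf (b i)
    rw [Basis.coord_apply, Basis.repr_self, Finsupp.single_apply] at h1
    rw [← h1, LinearMap.comp_apply]
    congr 1
    exact (congrArg Subtype.val (Basis.span_apply hli i)).symm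
  refine ⟨(Algebra.linearMap F QBar).comp f, ?_, fun z hz hzn => ?_⟩
  · have h1 := hb ⟨0, hr0⟩
    simp only [pow_zero, if_true] at h1
    rw [LinearMap.comp_apply, h1]
    simp
  · obtain ⟨i, -, rfl⟩ := hζ.eq_pow_of_pow_eq_one hz
    have hmod : i % r ≠ 0 := fun h => hzn (by
      rw [← pow_mul, hζ.pow_eq_one_iff_dvd, mul_comm]
      exact Nat.mul_dvd_mul_right (Nat.dvd_of_mod_eq_zero h) n)
    have hmem : (ζ ^ r) ^ (i / r) ∈ F := by
      refine pow_mem (IntermediateField.subset_adjoin ℚ _ ?_) _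
      change (ζ ^ r) ^ n = 1
      rw [← pow_mul, mul_comm, hζ.pow_eq_one]
    have h2 : ζ ^ i = (⟨_, hmem⟩ : F) • ζ ^ (i % r) := by
      rw [Algebra.smul_def]
      change _ = (ζ ^ r) ^ (i / r) * _
      rw [← pow_mul, ← pow_add, Nat.div_add_mod]
    have h3 := hb ⟨i % r, Nat.mod_lt _ hr0⟩
    rw [if_neg (by simpa using hmod)] at h3
    rw [LinearMap.comp_apply, h2, map_smul, h3, smul_zero, map_zero]

end Cyclotomic

/-! ### Brauer induction for cyclotomic-valued characters -/

section RationalBrauer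

/-- The restriction of `ψ` to a normal subgroup induces a multiple of the extension by zero. -/
theorem ind_restrict_of_normal {K H : Type*} [Field K] [CharZero K] [Group H] [Fintype H]
    (N : Subgroup H) [N.Normal] (ψ : H →* K) :
    ind N (fun h => ψ h) = N.index • zeroExt N (fun h => ψ h) := by
  funext g
  have hN : (Nat.card N : K) ≠ 0 := by exact_mod_cast Nat.card_pos.ne'
  have h1 : ∀ x : H, zeroExt N (fun h => ψ h) (x⁻¹ * g * x) = zeroExt N (fun h => ψ h) g := by
    intro x
    by_cases hg : g ∈ N
    · have hg' : x⁻¹ * g * x ∈ N := by simpa using ‹N.Normal›.conj_mem g hg x⁻¹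
      rw [zeroExt_of_mem _ hg, zeroExt_of_mem _ hg']
      change ψ (x⁻¹ * g * x) = ψ g
      rw [map_mul, mul_comm, ← map_mul]
      simp
    · rw [zeroExt_of_notMem _ hg, zeroExt_of_notMem]
      intro h
      apply hg
      have := ‹N.Normal›.conj_mem _ h x
      convert this using 1; group
  rw [ind, Finset.sum_congr rfl fun x _ => h1 x, Finset.sum_const, Finset.card_univ,
    Fintype.card_eq_nat_card, Pi.smul_apply, ← N.card_mul_index, nsmul_eq_mul, nsmul_eq_mul]
  push_cast
  field_simp

/-- The subgroup on which a character of degree one takes `n`-th roots of unity as values. -/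
def rootKernel {K H : Type*} [Field K] [Group H] (n : ℕ) (ψ : H →* K) : Subgroup H :=
  (ψ.toHomUnits ^ n).ker

theorem mem_rootKernel {K H : Type*} [Field K] [Group H] {n : ℕ} {ψ : H →* K} {h : H} :
    h ∈ rootKernel n ψ ↔ ψ h ^ n = 1 := by
  rw [rootKernel, MonoidHom.mem_ker, Units.ext_iff]
  simp

instance {K H : Type*} [Field K] [Group H] (n : ℕ) (ψ : H →* K) : (rootKernel n ψ).Normal :=
  inferInstanceAs (ψ.toHomUnits ^ n).ker.Normal

theorem rootKernel_index_dvd {H : Type*} [Group H] {n r : ℕ} (hr : 0 < r) (ψ : H →* QBar)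
    (hψ : ∀ h, ψ h ^ (n * r) = 1) : (rootKernel n ψ).index ∣ r := by
  have : NeZero (r : QBar) := ⟨by exact_mod_cast hr.ne'⟩
  have : NeZero r := ⟨hr.ne'⟩
  rw [rootKernel, Subgroup.index_ker, ← HasEnoughRootsOfUnity.natCard_rootsOfUnity QBar r]
  apply Subgroup.card_dvd_of_le
  rintro _ ⟨h, rfl⟩
  rw [mem_rootsOfUnity, Units.ext_iff]
  simp [← pow_mul, hψ]

variable {n r : ℕ} {π : QBar →ₗ[cyclotomicSubfield n] QBar}

theorem projection_mul (c z : QBar) (hc : c ∈ cyclotomicSubfield n) : π (c * z) = c * π z :=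
  π.map_smul (⟨c, hc⟩ : cyclotomicSubfield n) z

theorem projection_of_mem (hπ1 : π 1 = 1) {c : QBar} (hc : c ∈ cyclotomicSubfield n) :
    π c = c := by
  simpa [hπ1] using projection_mul (π := π) c 1 hc

theorem mem_cyclotomicSubfield_of_pow {z : QBar} (hz : z ^ n = 1) : z ∈ cyclotomicSubfield n :=
  IntermediateField.subset_adjoin ℚ _ hz

/-- The projection of a character of degree one to `ℚ(ζ_n)`: its values outside `ℚ(ζ_n)` are
replaced by zero. -/
theorem projection_character {H : Type*} [Group H] (hπ1 : π 1 = 1)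
    (hπ0 : ∀ z : QBar, z ^ (n * r) = 1 → z ^ n ≠ 1 → π z = 0) (ψ : H →* QBar)
    (hψ : ∀ h, ψ h ^ (n * r) = 1) :
    (fun h => π (ψ h)) = zeroExt (rootKernel n ψ) (fun h => ψ h) := by
  funext h
  by_cases hh : h ∈ rootKernel n ψ
  · rw [zeroExt_of_mem _ hh]
    exact projection_of_mem hπ1 (mem_cyclotomicSubfield_of_pow (mem_rootKernel.mp hh))
  · rw [zeroExt_of_notMem _ hh]
    exact hπ0 _ (hψ h) fun h1 => hh (mem_rootKernel.mpr h1)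

theorem ind_rootKernel_mem {H : Type*} [Group H] [Fintype H] (ψ : H →* QBar) :
    (rootKernel n ψ).index • zeroExt (rootKernel n ψ) (fun h => ψ h) ∈ monomialSpan QBar n H := by
  rw [← ind_restrict_of_normal]
  exact AddSubgroup.subset_closure
    ⟨_, ψ.comp (Subgroup.subtype _), fun h => mem_rootKernel.mp h.2, rfl⟩

/-- The projection onto `ℚ(ζ_n)` of an `nr`-monomial combination is `n`-monomial after
multiplication by `r`. -/
theorem smul_projection_mem {G : Type*} [Group G] [Fintype G] (hr : 0 < r) (hπ1 : π 1 = 1)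
    (hπ0 : ∀ z : QBar, z ^ (n * r) = 1 → z ^ n ≠ 1 → π z = 0) {f : G → QBar}
    (hf : f ∈ monomialSpan QBar (n * r) G) :
    (r • fun g => π (f g)) ∈ monomialSpan QBar n G := by
  let Φ : (G → QBar) →+ (G → QBar) :=
    { toFun := fun f => r • fun g => π (f g)
      map_zero' := by funext g; simp
      map_add' := fun f f' => by funext g; simp }
  have : monomialSpan QBar (n * r) G ≤ (monomialSpan QBar n G).comap Φ := by
    rw [monomialSpan, AddSubgroup.closure_le]
    rintro _ ⟨H, ψ, hψ, rfl⟩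
    classical
    have h1 : (fun g => π (ind H ψ g)) = ind H (fun h => π (ψ h)) := by
      funext g
      have h2 : ∀ z, π (zeroExt H ψ z) = zeroExt H (fun h => π (ψ h)) z := fun z => by
        by_cases hz : z ∈ H
        · rw [zeroExt_of_mem _ hz, zeroExt_of_mem _ hz]
        · rw [zeroExt_of_notMem _ hz, zeroExt_of_notMem _ hz, map_zero]
      rw [ind, projection_mul _ _ (inv_mem (natCast_mem _ _)), map_sum, ind]
      simp only [h2]
    change r • (fun g => π (ind H ψ g)) ∈ monomialSpan QBar n G
    rw [h1, projection_character hπ1 hπ0 ψ hψ, ← indHom_apply, ← map_nsmul, indHom_apply]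
    apply ind_mem_monomialSpan_of_mem
    obtain ⟨t, ht⟩ := rootKernel_index_dvd hr ψ hψ
    nth_rewrite 1 [ht]
    rw [mul_comm, mul_smul]
    exact AddSubgroup.nsmul_mem _ (ind_rootKernel_mem ψ) t
  exact this hf

/-- The virtual characters with values in `ℚ(ζ_n)`. -/
def cyclotomicCharacters (n : ℕ) (G : Type*) [Group G] : Subring (G → QBar) where
  carrier := {f | f ∈ virtualCharacters QBar G ∧ ∀ g, f g ∈ cyclotomicSubfield n}
  mul_mem' h h' := ⟨mul_mem h.1 h'.1, fun g => mul_mem (h.2 g) (h'.2 g)⟩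
  one_mem' := ⟨one_mem _, fun _ => one_mem _⟩
  add_mem' h h' := ⟨add_mem h.1 h'.1, fun g => add_mem (h.2 g) (h'.2 g)⟩
  zero_mem' := ⟨zero_mem _, fun _ => zero_mem _⟩
  neg_mem' h := ⟨neg_mem h.1, fun g => neg_mem (h.2 g)⟩

/-- The multiplicities in a virtual character of a commutative group `H`. The characters of degree
one are written as homomorphisms to a group `U` embedded in `ℚ̄`, for instance its unit group. -/
theorem exists_multiplicities {H U : Type*} [Group H] [Fintype H] [CommGroup U] (v : U →* QBar)
    (hv : Function.Injective v) (hlift : ∀ ψ : H →* QBar, ∃ ψ' : H →* U, ψ = v.comp ψ')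
    (hH : ∀ a b : H, a * b = b * a)
    {θ : H → QBar} (hθ : θ ∈ virtualCharacters QBar H) :
    ∃ m : (H →* U) →₀ ℤ, (θ = m.sum fun ψ c => c • fun h => v (ψ h)) ∧
      ∀ ψ : H →* U, ∑ h, θ h * v (ψ h)⁻¹ = (m ψ : QBar) * Nat.card H := by
  classical
  have h1 : ∃ m : (H →* U) →₀ ℤ, θ = m.sum fun ψ c => c • fun h => v (ψ h) := by
    have h2 : AddSubgroup.closure {f : H → QBar | ∃ ψ : H →* QBar, f = ⇑ψ} ≤
        (LinearMap.range (Finsupp.linearCombination ℤ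
          fun (ψ : H →* U) (h : H) => v (ψ h))).toAddSubgroup := by
      rw [AddSubgroup.closure_le]
      rintro _ ⟨ψ, rfl⟩
      obtain ⟨ψ, rfl⟩ := hlift ψ
      refine ⟨Finsupp.single ψ 1, ?_⟩
      rw [Finsupp.linearCombination_single, one_smul]
      rfl
    obtain ⟨m, hm⟩ := h2 (mem_closure_of_comm hH hθ)
    exact ⟨m, hm.symm⟩
  obtain ⟨m, hm⟩ := h1
  refine ⟨m, hm, fun ψ => ?_⟩
  have horth : ∀ φ : H →* U, ∑ h, v (φ h) * v (ψ h)⁻¹ =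
      if φ = ψ then (Nat.card H : QBar) else 0 := fun φ => by
    have h3 : ∀ h, v (φ h) * v (ψ h)⁻¹ = (v.comp (φ / ψ)) h :=
      fun h => by
      rw [MonoidHom.comp_apply, MonoidHom.div_apply, div_eq_mul_inv, map_mul]
    simp only [h3]
    split_ifs with h
    · have h5 : φ / ψ = 1 := by rw [h]; exact div_self' ψ
      simp [h5]
    · refine sum_hom_units_eq_zero _ fun h4 => h ?_
      rw [← div_eq_one]
      ext x
      exact hv ((DFunLike.congr_fun h4 x).trans (map_one v).symm)
  have h4 : ∀ h, θ h * v (ψ h)⁻¹ =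
      ∑ φ ∈ m.support, (m φ : QBar) * (v (φ h) * v (ψ h)⁻¹) := fun h => by
    rw [hm, Finsupp.sum, Finset.sum_apply, Finset.sum_mul]
    refine Finset.sum_congr rfl fun φ _ => ?_
    rw [Pi.smul_apply, zsmul_eq_mul, mul_assoc]
  rw [Finset.sum_congr rfl fun h _ => h4 h, Finset.sum_comm]
  simp only [← Finset.mul_sum, horth]
  rw [Finset.sum_congr rfl fun φ _ => mul_ite_zero _ _ _, Finset.sum_ite_eq']
  split_ifs with h
  · rfl
  · rw [Finsupp.notMem_support_iff.mp h]; simp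

/-- A form of `mem_monomialSpan_of_comm` in which the characters of degree one are homomorphisms to
a commutative group `U`, so that they form a group. The Galois orbit of such a character `ψ` over
`ℚ(ζ_n)` is its coset modulo the powers of `ψ ^ n`. -/
theorem mem_monomialSpan_of_comm_aux {H U : Type*} [Group H] [Fintype H] [CommGroup U]
    (v : U →* QBar) (hv : Function.Injective v)
    (hlift : ∀ ψ : H →* QBar, ∃ ψ' : H →* U, ψ = v.comp ψ') (hH : ∀ a b : H, a * b = b * a)
    (hn : 0 < n) (hr : r.Prime) (hrn : r ∣ n) (hexp : ∀ h : H, h ^ (n * r) = 1)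
    {θ : H → QBar} (hθ : θ ∈ cyclotomicCharacters n H) : θ ∈ monomialSpan QBar n H := by
  classical
  obtain ⟨π, hπ1, hπ0⟩ := exists_cyclotomic_projection hn hr hrn
  obtain ⟨m, hm, hmult⟩ := exists_multiplicities v hv hlift hH hθ.1
  have hc : ∀ (ψ : H →* U), (ψ ^ n) ^ r = 1 := fun ψ => by
    rw [← pow_mul]
    ext h
    simp [← map_pow, hexp]
  have hcn : ∀ (ψ : H →* U) (c : H →* U), c ∈ Subgroup.zpowers (ψ ^ n) → c ^ n = 1 := by
    rintro ψ c hc'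
    obtain ⟨i, rfl⟩ := Subgroup.mem_zpowers_iff.mp hc'
    obtain ⟨t, rfl⟩ := hrn
    rw [← zpow_natCast, zpow_comm, zpow_natCast, pow_mul, hc, one_pow, one_zpow]
  -- the multiplicities are constant on the orbits
  have hconst : ∀ ψ φ : H →* U, φ / ψ ∈ Subgroup.zpowers (ψ ^ n) → m φ = m ψ := by
    intro ψ φ hφ
    have hpow : φ ^ n = ψ ^ n := by
      have h1 := hcn ψ _ hφ
      rwa [div_pow, div_eq_one] at h1
    have hval : ∀ h, (ψ h) ^ n = 1 → φ h = ψ h := by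
      intro h hh
      obtain ⟨i, hi⟩ := Subgroup.mem_zpowers_iff.mp hφ
      have h1 : (φ / ψ) h = 1 := by
        rw [← hi]
        change ((ψ h) ^ n) ^ i = 1
        rw [hh, one_zpow]
      exact div_eq_one.mp h1
    have hπinv : ∀ h, π (v (φ h)⁻¹) = π (v (ψ h)⁻¹) := by
      intro h
      have hn' : (φ h) ^ n = (ψ h) ^ n := DFunLike.congr_fun hpow h
      by_cases hh : (ψ h) ^ n = 1
      · rw [hval h hh]
      · have key : ∀ χ : H →* U, (χ h) ^ n ≠ 1 → π (v (χ h)⁻¹) = 0 := by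
          intro χ hχ
          apply hπ0
          · rw [← map_pow, inv_pow, ← map_pow, hexp, map_one, inv_one, map_one]
          · rw [← map_pow, inv_pow]
            intro h1
            exact hχ (inv_eq_one.mp (hv (h1.trans (map_one v).symm)))
        rw [key φ (by rwa [hn']), key ψ hh]
    have hsum : ∀ χ : H →* U, ∑ h, θ h * π (v (χ h)⁻¹) = (m χ : QBar) * Nat.card H := by
      intro χ
      rw [← projection_of_mem (π := π) hπ1 (c := (m χ : QBar) * Nat.card H)
        (mul_mem (intCast_mem _ _) (natCast_mem _ _)), ← hmult χ, map_sum]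
      exact Finset.sum_congr rfl fun h _ => (projection_mul _ _ (hθ.2 h)).symm
    have h1 := hsum φ
    simp only [hπinv, hsum ψ] at h1
    have hHc : (Nat.card H : QBar) ≠ 0 := by exact_mod_cast Nat.card_pos.ne'
    exact_mod_cast (mul_right_cancel₀ hHc h1).symm
  -- the sums over the orbits are induced characters
  let orb : (H →* U) → Finset (H →* U) := fun ψ =>
    m.support.filter fun φ => φ / ψ ∈ Subgroup.zpowers (ψ ^ n)
  have horb : ∀ ψ ∈ m.support, ∀ φ ∈ m.support, orb φ = orb ψ ↔ φ ∈ orb ψ := by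
    intro ψ hψ φ hφ
    constructor
    · intro h
      rw [← h]
      exact Finset.mem_filter.mpr ⟨hφ, by rw [div_self']; exact one_mem _⟩
    · intro h
      have h1 := (Finset.mem_filter.mp h).2
      have h2 : φ ^ n = ψ ^ n := by
        have h3 := hcn ψ _ h1
        rwa [div_pow, div_eq_one] at h3
      ext x
      simp only [orb, Finset.mem_filter, h2]
      refine and_congr_right fun _ => ?_
      rw [← div_mul_div_cancel x φ ψ, Subgroup.mul_mem_cancel_right _ h1]
  have hrk : ∀ (ψ : H →* U) (h : H), h ∈ rootKernel n (v.comp ψ) ↔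
      (ψ h) ^ n = 1 := fun ψ h => by
    rw [mem_rootKernel, MonoidHom.comp_apply, ← map_pow, map_eq_one_iff v hv]
  have horbsum : ∀ ψ ∈ m.support, (∑ φ ∈ orb ψ, fun h => v (φ h)) ∈ monomialSpan QBar n H := by
    intro ψ hψ
    have hfin : IsOfFinOrder (ψ ^ n) := isOfFinOrder_iff_pow_eq_one.mpr ⟨r, hr.pos, hc ψ⟩
    have h1 : orb ψ = (Finset.range (orderOf (ψ ^ n))).image fun i => ψ * (ψ ^ n) ^ i := by
      ext φ
      simp only [orb, Finset.mem_filter, hfin.mem_zpowers_iff_mem_range_orderOf, Finset.mem_image]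
      constructor
      · rintro ⟨-, i, hi, h⟩
        exact ⟨i, hi, by rw [h, mul_div_cancel]⟩
      · rintro ⟨i, hi, rfl⟩
        have h2 : ψ * (ψ ^ n) ^ i / ψ = (ψ ^ n) ^ i := mul_div_cancel_left _ _
        refine ⟨?_, i, hi, h2.symm⟩
        rw [Finsupp.mem_support_iff, hconst ψ _ (by rw [h2]; exact Subgroup.npow_mem_zpowers _ _)]
        exact Finsupp.mem_support_iff.mp hψ
    have h2 : (∑ φ ∈ orb ψ, fun h => v (φ h)) = orderOf (ψ ^ n) •
        zeroExt (rootKernel n (v.comp ψ))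
          (fun h => (v.comp ψ) h) := by
      funext h
      rw [h1, Finset.sum_image fun i hi j hj hij => ?_]
      · rw [Finset.sum_apply, Pi.smul_apply]
        have h3 : ∀ i, v ((ψ * (ψ ^ n) ^ i) h) =
            v (ψ h) * (v (ψ h) ^ n) ^ i := fun i => by
          simp
        simp only [h3, ← Finset.mul_sum]
        by_cases hh : (ψ h) ^ n = 1
        · rw [zeroExt_of_mem _ ((hrk ψ h).mpr hh)]
          have h4 : v (ψ h) ^ n = 1 := by rw [← map_pow, hh, map_one]
          simp [h4, mul_comm]
        · rw [zeroExt_of_notMem _ fun h4 => hh ((hrk ψ h).mp h4)]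
          have h4 : v (ψ h) ^ n ≠ 1 := fun h4 => hh (hv (by rw [map_pow, h4, map_one]))
          have h5 : (v (ψ h) ^ n) ^ orderOf (ψ ^ n) = 1 := by
            have h6 := DFunLike.congr_fun (pow_orderOf_eq_one (ψ ^ n)) h
            rw [← map_pow, ← map_pow]
            exact (congrArg v h6).trans (map_one v)
          rw [geom_sum_eq h4, h5, sub_self, zero_div, mul_zero, smul_zero]
      · exact pow_injOn_Iio_orderOf (Finset.mem_range.mp hi) (Finset.mem_range.mp hj)
          (mul_left_cancel hij)
    have h3 : orderOf (ψ ^ n) = (rootKernel n (v.comp ψ)).index := by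
      have h4 : (rootKernel n (v.comp ψ)).index ∣ r :=
        rootKernel_index_dvd hr.pos _ fun h => by rw [← map_pow, hexp, map_one]
      have h5 : orderOf (ψ ^ n) ∣ r := orderOf_dvd_of_pow_eq_one (hc ψ)
      have h6 : orderOf (ψ ^ n) = 1 ↔ (rootKernel n (v.comp ψ)).index = 1 := by
        rw [orderOf_eq_one_iff, Subgroup.index_eq_one, Subgroup.eq_top_iff']
        simp only [hrk, DFunLike.ext_iff]
        rfl
      rcases (Nat.dvd_prime hr).mp h4 with h7 | h7 <;> rcases (Nat.dvd_prime hr).mp h5 with h8 | h8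
      · rw [h7, h8]
      · rw [h6.mpr h7, h7]
      · rw [h6.mp h8, h8]
      · rw [h7, h8]
    rw [h2, h3]
    exact ind_rootKernel_mem _
  rw [hm, Finsupp.sum, ← Finset.sum_fiberwise_of_maps_to
    (t := m.support.image orb) (g := orb) fun ψ hψ => Finset.mem_image_of_mem _ hψ]
  refine AddSubgroup.sum_mem _ fun o ho => ?_
  obtain ⟨ψ, hψ, rfl⟩ := Finset.mem_image.mp ho
  have h1 : m.support.filter (fun φ => orb φ = orb ψ) = orb ψ := by
    ext φ
    rw [Finset.mem_filter]
    constructor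
    · rintro ⟨h2, h3⟩
      exact (horb ψ hψ φ h2).mp h3
    · intro h2
      have h3 := (Finset.mem_filter.mp h2).1
      exact ⟨h3, (horb ψ hψ φ h3).mpr h2⟩
  have h2 : ∀ φ ∈ orb ψ, (m φ • fun h => v (φ h)) = m ψ • fun h => v (φ h) :=
    fun φ hφ => by rw [hconst ψ φ (Finset.mem_filter.mp hφ).2]
  rw [h1, Finset.sum_congr rfl h2, ← Finset.smul_sum]
  exact AddSubgroup.zsmul_mem _ (horbsum ψ hψ) _

/-- A `ℚ(ζ_n)`-valued virtual character of a commutative group of exponent dividing `nr` is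
a combination of characters induced from characters with values in the `n`-th roots of unity: its
multiplicities are constant on the Galois orbits, and the orbit sums are induced characters. -/
theorem mem_monomialSpan_of_comm {H : Type*} [Group H] [Fintype H] (hH : ∀ a b : H, a * b = b * a)
    (hn : 0 < n) (hr : r.Prime) (hrn : r ∣ n) (hexp : ∀ h : H, h ^ (n * r) = 1)
    {θ : H → QBar} (hθ : θ ∈ cyclotomicCharacters n H) : θ ∈ monomialSpan QBar n H :=
  mem_monomialSpan_of_comm_aux (Units.coeHom QBar) Units.val_injective
    (fun ψ => ⟨ψ.toHomUnits, rfl⟩) hH hn hr hrn hexp hθ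

/-- A subgroup with a commutative subgroup of exponent dividing `n` and of index at most two, whose
characters of degree one have `n`-th roots of unity as values. -/
def IsRationallyMonomial {G : Type*} [Group G] (n : ℕ) (H : Subgroup G) : Prop :=
  (∃ A : Subgroup H, (∀ a ∈ A, ∀ b ∈ A, a * b = b * a) ∧ A.index ≤ 2 ∧ ∀ a ∈ A, a ^ n = 1) ∧
    ∀ (ψ : H →* QBar) (h : H), ψ h ^ n = 1

/-- A form of Brauer's induction theorem for virtual characters with values in `ℚ(ζ_n)`, for groups
of exponent dividing `nr` with a prime factor `r` of `n`. At the primes other than `r`, it follows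
from the theorem for `nr` by projection to `ℚ(ζ_n)`. -/
theorem cyclotomicCharacters_le_monomialSpan {G : Type*} [Group G] [Fintype G] {n r : ℕ}
    (hn : 0 < n) (hr : r.Prime) (hrn : r ∣ n) (hexp : ∀ g : G, g ^ (n * r) = 1)
    (hP : ∀ q : ℕ, q.Prime → ∀ P : Subgroup G, IsPGroup q P →
      ∃ A : Subgroup P, (∀ a ∈ A, ∀ b ∈ A, a * b = b * a) ∧ A.index ≤ 2)
    (hH : ∀ (x : G) (P : Subgroup G), IsElementary r x P →
      (∀ a ∈ P, ∀ b ∈ P, a * b = b * a) ∨ IsRationallyMonomial n (Subgroup.zpowers x ⊔ P)) :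
    (cyclotomicCharacters n G).toAddSubgroup ≤ monomialSpan QBar n G := by
  refine mem_of_forall_prime fun q hq => ?_
  by_cases hqr : q = r
  · subst hqr
    have := Fact.mk hq
    have hord : ∀ x : G, ¬ q ∣ orderOf x → orderOf x ∣ n := fun x hx =>
      (((Nat.Prime.coprime_iff_not_dvd hq).mpr hx).symm).dvd_of_dvd_mul_right
        (orderOf_dvd_of_pow_eq_one (hexp x))
    have hval : ∀ x : G, ¬ q ∣ orderOf x → ∀ z : QBar, z ^ orderOf x = 1 →
        z ∈ cyclotomicSubfield n := fun x hx z hz => by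
      obtain ⟨t, ht⟩ := hord x hx
      exact mem_cyclotomicSubfield_of_pow (by rw [ht, pow_mul, hz, one_pow])
    refine exists_zsmul_mem_of_isElementary q (cyclotomicCharacters n G)
      (fun f hf => isIntegral_of_mem_virtualCharacters hf.1)
      (fun f hf => virtualCharacters_conj hf.1) (fun x P hel η hη => ?_) _
      fun f hf x P hel η hη => ?_
    · refine ⟨ind_mem_virtualCharacters _ η, fun g => mul_mem (inv_mem (natCast_mem _ _))
        (sum_mem fun y _ => ?_)⟩
      by_cases hy : y⁻¹ * g * y ∈ Subgroup.zpowers x ⊔ P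
      · rw [zeroExt_of_mem _ hy]
        exact hval x hel.not_dvd _ (hη _)
      · rw [zeroExt_of_notMem _ hy]
        exact zero_mem _
    · classical
      refine ind_mem_monomialSpan_of_mem _ ?_
      have hθ : (fun h : ↥(Subgroup.zpowers x ⊔ P) => f h * η h) ∈
          virtualCharacters QBar ↥(Subgroup.zpowers x ⊔ P) :=
        mul_mem (virtualCharacters_comp (Subgroup.subtype _) hf.1)
          (monoidHom_mem_virtualCharacters η)
      rcases hH x P hel with hc | ⟨⟨A, hA, hidx, hAn⟩, hψ⟩
      · obtain ⟨e, -⟩ := hel.exists_equiv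
        refine mem_monomialSpan_of_comm (fun a b => ?_) hn hr hrn
          (fun h => Subtype.ext (hexp h))
          ⟨hθ, fun h => mul_mem (hf.2 h) (hval x hel.not_dvd _ (hη h))⟩
        apply e.symm.injective
        rw [map_mul, map_mul]
        exact Prod.ext (mul_comm' _ _) (Subtype.ext (hc _ (SetLike.coe_mem _) _ (SetLike.coe_mem _)))
      · refine (AddSubgroup.closure_le _).mpr ?_ (mem_closure_of_index_le_two A hA hidx hθ)
        rintro _ (⟨ψ, rfl⟩ | ⟨ψ, rfl⟩)
        · exact monoidHom_mem_monomialSpan ψ (hψ ψ)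
        · refine AddSubgroup.subset_closure ⟨A, ψ, fun h => ?_, rfl⟩
          rw [← map_pow, show h ^ n = 1 from Subtype.ext (hAn h h.2), map_one]
  · refine ⟨r, fun h => hqr ((Nat.prime_dvd_prime_iff_eq hq hr).mp (by exact_mod_cast h)),
      fun f hf => ?_⟩
    obtain ⟨π, hπ1, hπ0⟩ := exists_cyclotomic_projection hn hr hrn
    have h1 := smul_projection_mem hr.pos hπ1 hπ0
      (virtualCharacters_le_monomialSpan (n * r) hexp hP hf.1)
    have h2 : (fun g => π (f g)) = f := funext fun g => projection_of_mem hπ1 (hf.2 g)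
    rw [h2] at h1
    simpa using h1

end RationalBrauer

/-! ### Simple groups and their Sylow subgroups -/

section SimpleGroups

variable {G : Type*} [Group G] [IsSimpleGroup G]

theorem not_comm_of_card_not_prime (h : ¬ (Nat.card G).Prime) : ¬ ∀ a b : G, a * b = b * a :=
  fun hc => h (by
    let _ : CommGroup G := { ‹Group G› with mul_comm := hc }
    exact IsSimpleGroup.prime_card)

variable [Finite G]

/-- Burnside's transfer argument: in a simple noncommutative group, the normalizer of a commutative
Sylow subgroup centralizes no nontrivial element of it. -/
theorem eq_one_of_commute_normalizer (hnc : ¬ ∀ a b : G, a * b = b * a) {p : ℕ} [Fact p.Prime]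
    (P : Sylow p G) (hP : ∀ a ∈ P, ∀ b ∈ P, a * b = b * a) {g : G} (hg : g ∈ P)
    (h : ∀ n ∈ Subgroup.normalizer (P : Set G), n * g = g * n) : g = 1 := by
  have hc : IsMulCommutative ↥(P : Subgroup G) :=
    ⟨⟨fun a b => Subtype.ext (hP a a.2 b b.2)⟩⟩
  have key : ∀ (k : ℕ) (g₀ : G), g₀⁻¹ * g ^ k * g₀ ∈ (P : Subgroup G) →
      g₀⁻¹ * g ^ k * g₀ = g ^ k := by
    intro k g₀ hk
    obtain ⟨n, hn, h1⟩ := Sylow.conj_eq_normalizer_conj_of_mem P (g ^ k) g₀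
      ((P : Subgroup G).pow_mem hg k) hk
    rw [h1, mul_assoc, inv_mul_eq_iff_eq_mul]
    exact (Commute.pow_right (h n hn) k).eq.symm
  let _ : CommGroup ↥(P : Subgroup G) := { (P : Subgroup G).toGroup with
    mul_comm := fun a b => Subtype.ext (hP a a.2 b b.2) }
  let T := MonoidHom.transfer (H := (P : Subgroup G)) (A := ↥(P : Subgroup G)) (MonoidHom.id _)
  have htriv : T g = 1 := by
    have hker : T.ker.Normal := inferInstance
    rcases hker.eq_bot_or_eq_top with h1 | h1
    · exfalso
      apply hnc
      intro a b
      apply (MonoidHom.ker_eq_bot_iff _).mp h1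
      rw [map_mul, map_mul, mul_comm]
    · exact MonoidHom.mem_ker.mp (h1 ▸ Subgroup.mem_top g)
  rw [show T g = _ from MonoidHom.transfer_eq_pow _ g key] at htriv
  have h2 : g ^ (P : Subgroup G).index = 1 := congrArg Subtype.val htriv
  obtain ⟨n, hn⟩ := IsPGroup.iff_orderOf.mp P.2 ⟨g, hg⟩
  rw [Subgroup.orderOf_mk] at hn
  have h3 := orderOf_dvd_of_pow_eq_one h2
  have hcop : Nat.Coprime (orderOf g) (P : Subgroup G).index := by
    rw [hn]
    exact Nat.Coprime.pow_left _
      ((Nat.Prime.coprime_iff_not_dvd Fact.out).mpr P.not_dvd_index)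
  rw [← orderOf_eq_one_iff]
  exact hcop.eq_one_of_dvd h3

/-- The order of a simple group divides the factorial of the index of a proper subgroup. -/
theorem card_dvd_factorial_index {H : Subgroup G} (hH : H ≠ ⊤) :
    Nat.card G ∣ H.index.factorial := by
  have hinj : (MulAction.toPermHom G (G ⧸ H)).ker = ⊥ := by
    have hker : (MulAction.toPermHom G (G ⧸ H)).ker.Normal := inferInstance
    rcases hker.eq_bot_or_eq_top with h1 | h1
    · exact h1
    · exfalso
      apply hH
      rw [Subgroup.eq_top_iff']
      intro g
      have h2 : MulAction.toPermHom G (G ⧸ H) g = 1 :=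
        MonoidHom.mem_ker.mp (h1 ▸ Subgroup.mem_top g)
      have h3 : g • ((1 : G) : G ⧸ H) = ((1 : G) : G ⧸ H) :=
        DFunLike.congr_fun h2 ((1 : G) : G ⧸ H)
      rw [MulAction.Quotient.smul_coe, eq_comm, QuotientGroup.eq] at h3
      simpa using h3
  have h2 := Subgroup.card_dvd_of_injective _ ((MonoidHom.ker_eq_bot_iff _).mp hinj)
  rwa [Nat.card_perm, ← Subgroup.index_eq_card] at h2

/-- In a simple group, only the identity normalizes all Sylow subgroups for a prime dividing the
order. -/
theorem eq_one_of_forall_mem_normalizer (hnc : ¬ ∀ a b : G, a * b = b * a) {p : ℕ}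
    [hp : Fact p.Prime] (hpG : p ∣ Nat.card G) {w : G}
    (h : ∀ S : Sylow p G, w ∈ Subgroup.normalizer (S : Set G)) : w = 1 := by
  have hker : (MulAction.toPermHom G (Sylow p G)).ker.Normal := inferInstance
  have hw : w ∈ (MulAction.toPermHom G (Sylow p G)).ker := by
    rw [MonoidHom.mem_ker]
    ext1 S
    exact Sylow.smul_eq_iff_mem_normalizer.mpr (h S)
  rcases hker.eq_bot_or_eq_top with h1 | h1
  · rw [h1] at hw
    exact hw
  · exfalso
    let P : Sylow p G := default
    have hn : (P : Subgroup G).Normal := by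
      rw [← Subgroup.normalizer_eq_top_iff, Subgroup.eq_top_iff']
      intro g
      have h2 : MulAction.toPermHom G (Sylow p G) g = 1 :=
        MonoidHom.mem_ker.mp (h1 ▸ Subgroup.mem_top g)
      exact Sylow.smul_eq_iff_mem_normalizer.mp (Equiv.Perm.congr_fun h2 P)
    rcases hn.eq_bot_or_eq_top with h2 | h2
    · have h3 := P.card_eq_multiplicity
      rw [h2, Subgroup.card_bot] at h3
      have h4 : 0 < (Nat.card G).factorization p :=
        hp.out.factorization_pos_of_dvd Nat.card_pos.ne' hpG
      exact (Nat.one_lt_pow h4.ne' hp.out.one_lt).ne h3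
    · -- a simple group of prime power order is commutative
      have h3 : IsPGroup p G := by
        have := P.2
        rw [h2] at this
        exact this.of_equiv Subgroup.topEquiv
      have : Nontrivial G := inferInstance
      have h4 := h3.center_nontrivial
      rcases (inferInstance : (Subgroup.center G).Normal).eq_bot_or_eq_top with h5 | h5
      · rw [h5] at h4
        exact not_nontrivial _ h4
      · exact hnc fun a b => ((Subgroup.mem_center_iff.mp (h5 ▸ Subgroup.mem_top b)) a)

theorem normalizer_sylow_ne_top (hnc : ¬ ∀ a b : G, a * b = b * a) {p : ℕ}
    [hp : Fact p.Prime] (hpG : p ∣ Nat.card G) (P : Sylow p G) :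
    Subgroup.normalizer (P : Set G) ≠ ⊤ := by
  intro h
  have h1 : Nat.card (Sylow p G) = 1 := by
    rw [P.card_eq_index_normalizer, h, Subgroup.index_top]
  have : Subsingleton (Sylow p G) := (Nat.card_eq_one_iff_unique.mp h1).1
  have h2 : ∀ w : G, w = 1 := fun w => eq_one_of_forall_mem_normalizer hnc hpG fun S => by
    rw [Subsingleton.elim S P, h]
    exact Subgroup.mem_top w
  exact hnc fun a b => by rw [h2 a, h2 b]

/-- If all Sylow `p`-subgroups but `P` form a regular orbit under `P`, then every element
centralizing `P` of prime order `q ≠ p` fixes a second Sylow subgroup, hence all of them, which is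
impossible in a noncommutative simple group. -/
theorem not_orderOf_prime_of_commute_sylow (hnc : ¬ ∀ a b : G, a * b = b * a) {p q : ℕ}
    [hp : Fact p.Prime] [hq : Fact q.Prime] (hpq : p ≠ q) (hpG : p ∣ Nat.card G)
    (P S₁ : Sylow p G) (hcard : Nat.card (Sylow p G) = Nat.card P + 1)
    (hS : (P : Subgroup G) ⊓ S₁ = ⊥) {w : G} (hw : ∀ a ∈ P, w * a = a * w) : orderOf w ≠ q := by
  intro hwq
  have hPS : P ≠ S₁ := by
    rintro rfl
    rw [inf_idem] at hS
    have h3 := P.card_eq_multiplicity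
    rw [hS, Subgroup.card_bot] at h3
    have h4 : 0 < (Nat.card G).factorization p :=
      hp.out.factorization_pos_of_dvd Nat.card_pos.ne' hpG
    exact (Nat.one_lt_pow h4.ne' hp.out.one_lt).ne h3
  have hfixP : ∀ x ∈ P, x • P = P := fun x hx =>
    Sylow.smul_eq_iff_mem_normalizer.mpr (Subgroup.le_normalizer hx)
  -- the orbit of `S₁`
  have horb : ∀ S : Sylow p G, S ≠ P → ∃ x ∈ P, S = x • S₁ := by
    let f : ↥(P : Subgroup G) → {S : Sylow p G // S ≠ P} := fun x => ⟨(x : G) • S₁, fun h => hPS (by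
      exact (MulAction.injective (x : G) (h.trans (hfixP x x.2).symm)).symm)⟩
    have hf : Function.Injective f := by
      intro x y hxy
      have h1 : (x : G) • S₁ = (y : G) • S₁ := congrArg Subtype.val hxy
      have h2 : ((y : G)⁻¹ * x) ∈ Subgroup.normalizer (S₁ : Set G) := by
        rw [← Sylow.smul_eq_iff_mem_normalizer, mul_smul, h1, inv_smul_smul]
      have h3 : ((y : G)⁻¹ * x) ∈ (P : Subgroup G) ⊓ Subgroup.normalizer (S₁ : Set G) :=
        ⟨Subgroup.mul_mem _ (Subgroup.inv_mem _ y.2) x.2, h2⟩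
      rw [IsPGroup.inf_normalizer_sylow P.2, hS, Subgroup.mem_bot, inv_mul_eq_one] at h3
      exact Subtype.ext h3.symm
    have hb : Function.Bijective f := by
      refine (Nat.bijective_iff_injective_and_card f).mpr ⟨hf, ?_⟩
      classical
      cases nonempty_fintype (Sylow p G)
      have h1 : Nat.card {S : Sylow p G // S ≠ P} = Nat.card (Sylow p G) - 1 := by
        rw [Nat.card_eq_fintype_card, Nat.card_eq_fintype_card, Fintype.card_subtype_compl,
          Fintype.card_subtype_eq]
      rw [h1, hcard, Nat.add_sub_cancel]
    intro S hSP
    obtain ⟨x, hx⟩ := hb.2 ⟨S, hSP⟩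
    exact ⟨x, x.2, (congrArg Subtype.val hx).symm⟩
  have hwP : w • P = P := by
    rw [Sylow.smul_eq_iff_mem_normalizer]
    refine Subgroup.mem_normalizer_iff.mpr fun h => ?_
    change h ∈ P ↔ w * h * w⁻¹ ∈ P
    constructor
    · intro hh
      rw [hw h hh, mul_inv_cancel_right]
      exact hh
    · intro hh
      have h1 := hw _ hh
      have h2 : w * h * w⁻¹ = h := by
        have : w * (w * h * w⁻¹) = w * h := by rw [h1]; group
        exact mul_left_cancel this
      rwa [h2] at hh
  -- a second fixed point
  obtain ⟨S, hSP, hwS⟩ : ∃ S : Sylow p G, S ≠ P ∧ w • S = S := by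
    by_contra! hno
    have hW : IsPGroup q (Subgroup.zpowers w) :=
      IsPGroup.of_card (n := 1) (by rw [Nat.card_zpowers, hwq, pow_one])
    have h1 := hW.card_modEq_card_fixedPoints (Sylow p G)
    have h2 : Nat.card (MulAction.fixedPoints (Subgroup.zpowers w) (Sylow p G)) = 1 := by
      rw [Nat.card_eq_one_iff_unique]
      refine ⟨⟨?_⟩, ⟨⟨P, ?_⟩⟩⟩
      · have h3 : ∀ S : MulAction.fixedPoints (Subgroup.zpowers w) (Sylow p G), S.1 = P :=
          fun S => by
            by_contra hne
            exact hno S hne (S.2 ⟨w, Subgroup.mem_zpowers w⟩)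
        exact fun S S' => Subtype.ext ((h3 S).trans (h3 S').symm)
      · rintro ⟨v, hv⟩
        have : Subgroup.zpowers w ≤ MulAction.stabilizer G P := by
          rw [Subgroup.zpowers_le]; exact hwP
        exact this hv
    rw [h2, hcard] at h1
    have h3 : q ∣ Nat.card P := by
      have := (Nat.modEq_iff_dvd' (Nat.le_add_left 1 _)).mp h1.symm
      simpa using this
    obtain ⟨n, hn⟩ := IsPGroup.iff_card.mp P.2
    rw [hn] at h3
    exact hpq ((Nat.prime_dvd_prime_iff_eq hq.out hp.out).mp (hq.out.dvd_of_dvd_pow h3)).symm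
  have hall : ∀ T : Sylow p G, w ∈ Subgroup.normalizer (T : Set G) := by
    intro T
    rw [← Sylow.smul_eq_iff_mem_normalizer]
    by_cases hT : T = P
    · rw [hT, hwP]
    · obtain ⟨x, hx, rfl⟩ := horb T hT
      obtain ⟨y, hy, rfl⟩ := horb S hSP
      have h1 : x • S₁ = (x * y⁻¹) • y • S₁ := by rw [mul_smul, inv_smul_smul]
      rw [h1, ← mul_smul, hw _ (mul_mem hx (inv_mem hy)), mul_smul, hwS]
  have := eq_one_of_forall_mem_normalizer hnc hpG hall
  rw [this, orderOf_one] at hwq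
  exact hq.out.one_lt.ne hwq

end SimpleGroups

/-! ### Groups of small prime power order -/

section SmallGroups

theorem comm_of_forall_sq_eq_one {P : Type*} [Group P] (h : ∀ g : P, g ^ 2 = 1) (a b : P) :
    a * b = b * a := by
  have hinv : ∀ g : P, g⁻¹ = g := fun g => inv_eq_of_mul_eq_one_left (by rw [← sq, h])
  calc a * b = (a * b)⁻¹ := (hinv _).symm
    _ = b * a := by rw [mul_inv_rev, hinv, hinv]

/-- A group of order dividing `8` has a commutative subgroup of index at most two. -/
theorem exists_comm_subgroup_of_card_dvd_eight {P : Type*} [Group P] [Finite P]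
    (h : Nat.card P ∣ 8) :
    ∃ A : Subgroup P, (∀ a ∈ A, ∀ b ∈ A, a * b = b * a) ∧ A.index ≤ 2 := by
  by_cases hsq : ∀ g : P, g ^ 2 = 1
  · exact ⟨⊤, fun a _ b _ => comm_of_forall_sq_eq_one hsq a b, by simp⟩
  · push Not at hsq
    obtain ⟨g, hg⟩ := hsq
    refine ⟨Subgroup.zpowers g, ?_, ?_⟩
    · rintro _ ⟨i, rfl⟩ _ ⟨j, rfl⟩
      exact (Commute.zpow_zpow (Commute.refl g) i j).eq
    · have h1 := (Subgroup.zpowers g).card_mul_index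
      rw [Nat.card_zpowers] at h1
      have h2 : ¬ orderOf g ∣ 2 := fun hd => hg (orderOf_dvd_iff_pow_eq_one.mp hd)
      have h3 : orderOf g ∣ 8 := (orderOf_dvd_natCard g).trans h
      have h4 : Nat.card P ≤ 8 := Nat.le_of_dvd (by norm_num) h
      have h5 : 4 ≤ orderOf g := by
        have h6 : orderOf g ≤ 8 := Nat.le_of_dvd (by norm_num) h3
        by_contra hlt
        interval_cases orderOf g <;> omega
      nlinarith

theorem comm_of_card_eq_prime_pow {P : Type*} [Group P] [Finite P] {q k : ℕ} [Fact q.Prime]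
    (hk : Nat.card P = q ^ k) (hk2 : k ≤ 2) (a b : P) : a * b = b * a := by
  interval_cases k
  · have : Subsingleton P := (Nat.card_eq_one_iff_unique.mp (by simpa using hk)).1
    exact Subsingleton.elim _ _
  · have : IsCyclic P := isCyclic_of_prime_card (p := q) (by simpa using hk)
    exact mul_comm' a b
  · have := IsPGroup.isMulCommutative_of_card_eq_prime_sq hk
    exact mul_comm' a b

/-- The bound `2520 = 2 ^ 3 * 3 ^ 2 * 5 * 7` is the least common multiple of `168`, `504` and `360`. -/
theorem exists_comm_subgroup_of_isPGroup {P : Type*} [Group P] [Finite P] {q : ℕ}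
    [hq : Fact q.Prime] (hP : IsPGroup q P) (h : Nat.card P ∣ 2520) :
    ∃ A : Subgroup P, (∀ a ∈ A, ∀ b ∈ A, a * b = b * a) ∧ A.index ≤ 2 := by
  obtain ⟨k, hk⟩ := IsPGroup.iff_card.mp hP
  rw [hk] at h
  by_cases hk2 : k ≤ 2
  · exact ⟨⊤, fun a _ b _ => comm_of_card_eq_prime_pow hk hk2 a b, by simp⟩
  · have h3 : q ^ 3 ∣ 2520 := (pow_dvd_pow q (by omega)).trans h
    have hq13 : q ≤ 13 := by
      by_contra hlt
      have h5 := Nat.le_of_dvd (by norm_num) h3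
      have : 14 ^ 3 ≤ q ^ 3 := Nat.pow_le_pow_left (by omega) 3
      omega
    have hq2 : q = 2 := by
      have := hq.out.two_le
      interval_cases q <;> first | rfl | (exfalso; revert h3; decide)
    subst hq2
    have hk3 : k ≤ 3 := by
      by_contra hlt
      have : 2 ^ 4 ∣ 2520 := (pow_dvd_pow 2 (by omega)).trans h
      omega
    have hk' : k = 3 := by omega
    subst hk'
    exact exists_comm_subgroup_of_card_dvd_eight (by rw [hk]; norm_num)

theorem exists_mem_sylow_of_orderOf {G : Type*} [Group G] {p k : ℕ} [Fact p.Prime]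
    {g : G} (hg : orderOf g = p ^ k) :
    ∃ P : Sylow p G, g ∈ P := by
  obtain ⟨P, hP⟩ := IsPGroup.exists_le_sylow
    (IsPGroup.of_card (p := p) (n := k) (G := Subgroup.zpowers g) (by rw [Nat.card_zpowers, hg]))
  exact ⟨P, hP (Subgroup.mem_zpowers g)⟩

end SmallGroups

/-! ### Sylow subgroups of order eight in simple groups -/

section SylowTwo

variable {G : Type*} [Group G] [Finite G] [IsSimpleGroup G]

/-- If the `m`-th power map has trivial square on a commutative Sylow subgroup of order `8`, then its
image has at most one nontrivial element. The normalizer centralizes it, so that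
`eq_one_of_commute_normalizer` applies. -/
theorem pow_eq_one_of_comm_sylow_aux (hnc : ¬ ∀ a b : G, a * b = b * a) (P : Sylow 2 G)
    (hP8 : Nat.card P = 8) (hP : ∀ a ∈ P, ∀ b ∈ P, a * b = b * a) (m : ℕ)
    (hm : ∀ h ∈ P, h ^ (m * m) = 1) {g : G} (hg : g ∈ P) : g ^ m = 1 := by
  by_contra hgm
  let _ : CommGroup ↥(P : Subgroup G) := { (P : Subgroup G).toGroup with
    mul_comm := fun a b => Subtype.ext (hP a a.2 b b.2) }
  let φ : ↥(P : Subgroup G) →* ↥(P : Subgroup G) := powMonoidHom m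
  have hφ : ∀ x, φ x = x ^ m := fun x => rfl
  have h1 : φ.range ≤ φ.ker := by
    rintro _ ⟨x, rfl⟩
    rw [MonoidHom.mem_ker, hφ, hφ, ← pow_mul]
    exact Subtype.ext (hm x x.2)
  have h2 : Nat.card φ.range ≤ Nat.card φ.ker := Subgroup.card_le_of_le h1
  have h3 : Nat.card φ.ker * Nat.card φ.range = 8 := by
    rw [← Subgroup.index_ker, Subgroup.card_mul_index]
    exact hP8
  have h4 : Nat.card φ.range ≤ 2 := by
    by_contra hlt
    have h5 : Nat.card φ.range ∣ 8 := ⟨_, by rw [mul_comm]; exact h3.symm⟩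
    nlinarith
  -- the nontrivial element of the image is unique, so it is centralized by the normalizer
  have huniq : ∀ x ∈ P, x ^ m ≠ 1 → x ^ m = g ^ m := by
    intro x hx hxm
    by_contra hne
    have h5 : ({1, φ ⟨g, hg⟩, φ ⟨x, hx⟩} : Set ↥(P : Subgroup G)) ⊆ φ.range := by
      rintro y (rfl | rfl | rfl)
      · exact φ.range.one_mem
      · exact ⟨_, rfl⟩
      · exact ⟨_, rfl⟩
    have h6 := Set.ncard_le_ncard h5 (Set.toFinite _)
    rw [Set.ncard_eq_three.mpr ⟨_, _, _, ?_, ?_, ?_, rfl⟩, ← Nat.card_coe_set_eq] at h6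
    · exact absurd (h6.trans h4) (by norm_num)
    · exact fun h => hgm (congrArg Subtype.val h).symm
    · exact fun h => hxm (congrArg Subtype.val h).symm
    · exact fun h => hne (congrArg Subtype.val h).symm
  refine hgm (eq_one_of_commute_normalizer hnc P hP ((P : Subgroup G).pow_mem hg m) fun n hn => ?_)
  have h5 : n * g * n⁻¹ ∈ P := (Subgroup.mem_normalizer_iff.mp hn g).mp hg
  have h6 : (n * g * n⁻¹) ^ m = n * g ^ m * n⁻¹ := conj_pow
  have h7 := huniq _ h5 (by
    rw [h6]
    intro h
    exact hgm (by simpa using h))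
  rw [h6, mul_inv_eq_iff_eq_mul] at h7
  exact h7

/-- In a simple noncommutative group whose Sylow `2`-subgroups have order `8`, a commutative Sylow
`2`-subgroup is elementary abelian. -/
theorem sq_eq_one_of_comm_sylow (hnc : ¬ ∀ a b : G, a * b = b * a) (P : Sylow 2 G)
    (hP8 : Nat.card P = 8) (hP : ∀ a ∈ P, ∀ b ∈ P, a * b = b * a) {g : G} (hg : g ∈ P) :
    g ^ 2 = 1 := by
  refine pow_eq_one_of_comm_sylow_aux hnc P hP8 hP 2 (fun h hh => ?_) hg
  refine pow_eq_one_of_comm_sylow_aux hnc P hP8 hP 4 (fun h hh => ?_) hh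
  have h1 : orderOf h ∣ 8 := hP8 ▸ (P : Subgroup G).orderOf_dvd_natCard hh
  rw [← orderOf_dvd_iff_pow_eq_one]
  exact h1.trans (by norm_num)

theorem orderOf_ne_eight (hnc : ¬ ∀ a b : G, a * b = b * a)
    (hP8 : ∀ P : Sylow 2 G, Nat.card P = 8) (g : G) : orderOf g ≠ 8 := by
  intro hg
  obtain ⟨P, hP⟩ := exists_mem_sylow_of_orderOf (p := 2) (k := 3) (g := g) (by rw [hg]; rfl)
  have h1 : Subgroup.zpowers g = P := Subgroup.eq_of_le_of_card_ge
    (Subgroup.zpowers_le.mpr hP) (by rw [Nat.card_zpowers, hg]; exact (hP8 P).le)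
  have h2 := sq_eq_one_of_comm_sylow hnc P (hP8 P) (fun a ha b hb => by
    have ha' : a ∈ Subgroup.zpowers g := h1 ▸ ha
    have hb' : b ∈ Subgroup.zpowers g := h1 ▸ hb
    obtain ⟨i, rfl⟩ := ha'
    obtain ⟨j, rfl⟩ := hb'
    exact (Commute.zpow_zpow (Commute.refl g) i j).eq) hP
  have h3 := orderOf_dvd_of_pow_eq_one h2
  rw [hg] at h3
  omega

/-- An element of order four is conjugate to its inverse in each Sylow subgroup containing it. -/
theorem exists_conj_eq_inv (hnc : ¬ ∀ a b : G, a * b = b * a) (P : Sylow 2 G)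
    (hP8 : Nat.card P = 8) {g : G} (hg : g ∈ P) (hg4 : orderOf g = 4) :
    ∃ s ∈ P, s * g * s⁻¹ = g⁻¹ := by
  classical
  let g' : ↥(P : Subgroup G) := ⟨g, hg⟩
  have hg' : orderOf g' = 4 := by rw [Subgroup.orderOf_mk]; exact hg4
  let A : Subgroup ↥(P : Subgroup G) := Subgroup.zpowers g'
  have hA : A.index = 2 := by
    have h1 := A.card_mul_index
    rw [Nat.card_zpowers, hg'] at h1
    have h2 : Nat.card ↥(P : Subgroup G) = 8 := hP8
    omega
  obtain ⟨s, hs⟩ : ∃ s, s ∉ A := by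
    by_contra! hall
    rw [Subgroup.index_eq_one.mpr ((Subgroup.eq_top_iff' A).mpr hall)] at hA
    omega
  have hn := Subgroup.normal_of_index_eq_two hA
  refine ⟨s, s.2, ?_⟩
  have h1 : s * g' * s⁻¹ ∈ A := hn.conj_mem _ (Subgroup.mem_zpowers g') s
  have h2 : orderOf (s * g' * s⁻¹) = 4 := by
    rw [← hg']
    exact orderOf_injective (MulAut.conj s).toMonoidHom (MulAut.conj s).injective g'
  obtain ⟨i, hi, h3⟩ := (isOfFinOrder_of_finite g').mem_zpowers_iff_mem_range_orderOf.mp h1 |>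
    Finset.mem_image.mp
  rw [hg', Finset.mem_range] at hi
  have hcomm : s * g' * s⁻¹ ≠ g' := by
    intro h
    have hsg : s * g' = g' * s := by rwa [mul_inv_eq_iff_eq_mul] at h
    have hPc : ∀ a b : ↥(P : Subgroup G), a * b = b * a := by
      have hd : ∀ a : ↥(P : Subgroup G), ∃ (j : ℕ) (i : ℤ), a = s ^ j * g' ^ i := fun a => by
        by_cases ha : a ∈ A
        · obtain ⟨i, rfl⟩ := ha
          exact ⟨0, i, by simp⟩
        · have h4 : s⁻¹ * a ∈ A := (Subgroup.mul_mem_iff_of_index_two hA).mpr (by simp [hs, ha])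
          obtain ⟨i, hi⟩ := h4
          exact ⟨1, i, by simp only at hi; rw [hi]; simp⟩
      intro a b
      obtain ⟨j, i, rfl⟩ := hd a
      obtain ⟨j', i', rfl⟩ := hd b
      have c1 : Commute s g' := hsg
      exact ((((Commute.refl s).pow_pow j j').mul_right (c1.pow_left j |>.zpow_right i')).mul_left
        (((c1.symm.zpow_left i).pow_right j').mul_right ((Commute.refl g').zpow_zpow i i'))).eq
    have h4 := sq_eq_one_of_comm_sylow hnc P hP8
      (fun a ha b hb => congrArg Subtype.val (hPc ⟨a, ha⟩ ⟨b, hb⟩)) hg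
    have h5 := orderOf_dvd_of_pow_eq_one h4
    rw [hg4] at h5
    omega
  have h4 : g' ^ 4 = 1 := by rw [← hg']; exact pow_orderOf_eq_one g'
  have h5 : s * g' * s⁻¹ = g'⁻¹ := by
    interval_cases i
    · rw [← h3, pow_zero, orderOf_one] at h2
      omega
    · exact absurd (by rw [← h3, pow_one]) hcomm
    · have h6 := orderOf_dvd_of_pow_eq_one (x := s * g' * s⁻¹) (n := 2) (by
        rw [← h3, ← pow_mul]; exact h4)
      rw [h2] at h6
      omega
    · rw [← h3, eq_inv_iff_mul_eq_one, ← pow_succ, h4]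
  exact congrArg Subtype.val h5

end SylowTwo

/-! ### Counting with Sylow subgroups -/

section SylowCounting

theorem card_sylow_eq {G : Type*} [Group G] [Finite G] {p k m : ℕ} [hp : Fact p.Prime]
    (h : Nat.card G = p ^ k * m) (hm : ¬ p ∣ m) (P : Sylow p G) : Nat.card P = p ^ k := by
  have hm0 : m ≠ 0 := fun h0 => hm (h0 ▸ dvd_zero p)
  rw [P.card_eq_multiplicity, h, Nat.factorization_mul (pow_ne_zero _ hp.out.ne_zero) hm0,
    Finsupp.add_apply, hp.out.factorization_pow, Finsupp.single_eq_same,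
    Nat.factorization_eq_zero_of_not_dvd hm, add_zero]

variable {G : Type*} [Group G] [Finite G]

theorem exists_sylow_eq_zpowers {p k : ℕ} [Fact p.Prime] (hP : ∀ P : Sylow p G, Nat.card P = p ^ k)
    {x : G} (hx : orderOf x = p ^ k) : ∃ P : Sylow p G, Subgroup.zpowers x = P := by
  obtain ⟨P, hxP⟩ := exists_mem_sylow_of_orderOf hx
  exact ⟨P, Subgroup.eq_of_le_of_card_ge (Subgroup.zpowers_le.mpr hxP)
    (by rw [Nat.card_zpowers, hx]; exact (hP P).le)⟩

/-- Subgroups with pairwise trivial intersections: if their nontrivial elements are numerous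
enough, then they cover the group, and they cannot be too numerous. -/
theorem card_le_and_exists_mem_of_disjoint {I : Type*} [Fintype I] (S : I → Subgroup G)
    (hS : ∀ i j, i ≠ j → S i ⊓ S j = ⊥) :
    1 + ∑ i, (Nat.card (S i) - 1) ≤ Nat.card G ∧
      (Nat.card G ≤ 1 + ∑ i, (Nat.card (S i) - 1) → ∀ g : G, g ≠ 1 → ∃ i, g ∈ S i) := by
  classical
  cases nonempty_fintype G
  let T : I → Finset G := fun i => Finset.univ.filter fun g => g ∈ S i ∧ g ≠ 1
  have hT : ∀ i, (T i).card = Nat.card (S i) - 1 := by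
    intro i
    have h1 : (Finset.univ.filter fun g => g ∈ S i).card = Nat.card (S i) := by
      rw [Nat.card_eq_fintype_card, Fintype.card_subtype]
    have h2 : T i = (Finset.univ.filter fun g => g ∈ S i).erase 1 := by
      ext g
      simp [T, and_comm]
    rw [h2, Finset.card_erase_of_mem (by simp [(S i).one_mem]), h1]
  have hdisj : ((Finset.univ : Finset I) : Set I).PairwiseDisjoint T := by
    intro i _ j _ hij
    rw [Function.onFun, Finset.disjoint_left]
    intro g hg hg'
    simp only [T, Finset.mem_filter, Finset.mem_univ, true_and] at hg hg'
    have : g ∈ S i ⊓ S j := ⟨hg.1, hg'.1⟩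
    rw [hS i j hij] at this
    exact hg.2 this
  have hcard : (insert 1 (Finset.univ.biUnion T)).card = 1 + ∑ i, (Nat.card (S i) - 1) := by
    rw [Finset.card_insert_of_notMem (by simp [T]), Finset.card_biUnion hdisj, add_comm]
    simp only [hT]
  constructor
  · rw [← hcard, Nat.card_eq_fintype_card]
    exact Finset.card_le_univ _
  · intro hle g hg
    have h1 : insert 1 (Finset.univ.biUnion T) = Finset.univ := by
      rw [← Finset.card_eq_iff_eq_univ, hcard]
      exact le_antisymm (by rw [← hcard]; exact Finset.card_le_univ _)
        (by rwa [← Nat.card_eq_fintype_card])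
    have h2 := Finset.mem_univ g
    rw [← h1, Finset.mem_insert, Finset.mem_biUnion] at h2
    obtain ⟨i, -, hi⟩ := h2.resolve_left hg
    simp only [T, Finset.mem_filter, Finset.mem_univ, true_and] at hi
    exact ⟨i, hi.1⟩

variable [IsSimpleGroup G]

/-- The restrictions on the number of Sylow subgroups of a simple group. -/
theorem card_sylow_restrictions (hnc : ¬ ∀ a b : G, a * b = b * a) {p k m : ℕ} [hp : Fact p.Prime]
    (h : Nat.card G = p ^ k * m) (hk : k ≠ 0) (hm : ¬ p ∣ m) (P : Sylow p G) :
    Nat.card P = p ^ k ∧ ∃ c, Nat.card ↥(Subgroup.normalizer (P : Set G)) = p ^ k * c ∧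
      Nat.card (Sylow p G) * c = m ∧ Nat.card (Sylow p G) % p = 1 ∧
      Nat.card G ∣ (Nat.card (Sylow p G)).factorial := by
  have hP := card_sylow_eq h hm P
  obtain ⟨c, hc⟩ : Nat.card P ∣ Nat.card ↥(Subgroup.normalizer (P : Set G)) :=
    Subgroup.card_dvd_of_le Subgroup.le_normalizer
  rw [hP] at hc
  refine ⟨hP, c, hc, ?_, ?_, ?_⟩
  · have h1 := (Subgroup.normalizer (P : Set G)).index_mul_card
    rw [hc, h, mul_left_comm, ← P.card_eq_index_normalizer] at h1
    exact Nat.eq_of_mul_eq_mul_left (pow_pos hp.out.pos k) h1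
  · have h1 := card_sylow_modEq_one p G
    rwa [Nat.ModEq, Nat.mod_eq_of_lt hp.out.one_lt] at h1
  · rw [P.card_eq_index_normalizer]
    exact card_dvd_factorial_index
      (normalizer_sylow_ne_top hnc (h ▸ (dvd_pow_self p hk).mul_right m) P)

/-- The centralizer of a generator of a cyclic Sylow subgroup is a proper subgroup of the normalizer. -/
theorem card_centralizer_of_zpowers (hnc : ¬ ∀ a b : G, a * b = b * a) {p : ℕ} [hp : Fact p.Prime]
    (P : Sylow p G) {x : G} (hx : Subgroup.zpowers x = P) (hx1 : x ≠ 1) :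
    Nat.card P ∣ Nat.card ↥(Subgroup.centralizer {x}) ∧
      Nat.card ↥(Subgroup.centralizer {x}) ∣ Nat.card ↥(Subgroup.normalizer (P : Set G)) ∧
      Nat.card ↥(Subgroup.centralizer {x}) ≠ Nat.card ↥(Subgroup.normalizer (P : Set G)) := by
  have hxP : x ∈ P := by
    have := Subgroup.mem_zpowers x
    rwa [hx] at this
  have hle : Subgroup.centralizer {x} ≤ Subgroup.normalizer (P : Set G) := by
    intro y hy
    rw [Subgroup.mem_centralizer_singleton_iff] at hy
    have h1 : ∀ h ∈ Subgroup.zpowers x, y * h * y⁻¹ = h := by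
      rintro _ ⟨i, rfl⟩
      rw [mul_inv_eq_iff_eq_mul]
      exact (Commute.zpow_right hy i).eq
    refine Subgroup.mem_normalizer_iff.mpr fun h => ?_
    rw [← hx]
    constructor
    · intro hh
      rwa [h1 h hh]
    · intro hh
      have h2 := h1 _ hh
      have h3 : y * h * y⁻¹ = h := by
        have : y * (y * h * y⁻¹) * y⁻¹ = y * h * y⁻¹ := h2
        simpa using this
      rwa [h3] at hh
  refine ⟨Subgroup.card_dvd_of_le ?_, Subgroup.card_dvd_of_le hle, fun heq => hx1 ?_⟩
  · rw [← hx, Subgroup.zpowers_le, Subgroup.mem_centralizer_singleton_iff]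
  · have h1 := Subgroup.eq_of_le_of_card_ge hle heq.ge
    refine eq_one_of_commute_normalizer hnc P ?_ hxP fun n hn => ?_
    · intro a ha b hb
      have ha' : a ∈ Subgroup.zpowers x := hx ▸ ha
      have hb' : b ∈ Subgroup.zpowers x := hx ▸ hb
      obtain ⟨i, rfl⟩ := ha'
      obtain ⟨j, rfl⟩ := hb'
      exact (Commute.zpow_zpow (Commute.refl x) i j).eq
    · rw [← h1] at hn
      exact Subgroup.mem_centralizer_singleton_iff.mp hn

end SylowCounting

/-! ### Orders of centralizers -/

section Centralizers

variable {G : Type*} [Group G] [Finite G]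

theorem exists_pow_orderOf_eq {g : G} {d : ℕ} (h : d ∣ orderOf g) : ∃ t, orderOf (g ^ t) = d := by
  obtain ⟨t, ht⟩ := h
  have ht0 : t ≠ 0 := by
    rintro rfl
    exact (orderOf_pos g).ne' (by simpa using ht)
  exact ⟨t, by rw [orderOf_pow_of_dvd ht0 (ht ▸ Dvd.intro_left d rfl), ht,
    Nat.mul_div_cancel _ (Nat.pos_of_ne_zero ht0)]⟩

/-- If the elements of prime order `p` have centralizers of order `c`, then the order of each
element of order divisible by `p` divides `c`. -/
theorem orderOf_dvd_of_card_centralizer {p c : ℕ}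
    (h : ∀ x : G, orderOf x = p → Nat.card ↥(Subgroup.centralizer {x}) = c) {g : G}
    (hg : p ∣ orderOf g) : orderOf g ∣ c := by
  obtain ⟨t, hx⟩ := exists_pow_orderOf_eq hg
  rw [← h _ hx]
  refine Subgroup.orderOf_dvd_natCard _ ?_
  rw [Subgroup.mem_centralizer_singleton_iff]
  exact ((Commute.refl g).pow_right t).eq

/-- If no element of order `q` lies in a centralizer of an element of order `p`, then `p` does not
divide the order of the centralizer of an element of order `q`. -/
theorem not_dvd_card_centralizer {p q c : ℕ} [hp : Fact p.Prime] (hq : ¬ q ∣ c)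
    (h : ∀ x : G, orderOf x = p → Nat.card ↥(Subgroup.centralizer {x}) = c) {z : G}
    (hz : orderOf z = q) : ¬ p ∣ Nat.card ↥(Subgroup.centralizer {z}) := by
  intro hd
  obtain ⟨x, hx⟩ := exists_prime_orderOf_dvd_card' p hd
  apply hq
  rw [← h x (by rwa [Subgroup.orderOf_coe]), ← hz]
  refine Subgroup.orderOf_dvd_natCard _ ?_
  have := Subgroup.mem_centralizer_singleton_iff.mp x.2
  rw [Subgroup.mem_centralizer_singleton_iff]
  exact this.symm

end Centralizers

/-! ### Simple groups of order 168: Sylow subgroups and element orders -/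

section Order168

variable {G : Type*} [Group G] [Finite G] [IsSimpleGroup G]

theorem card_normalizer_seven_of_168 (hG : Nat.card G = 168) (hnc : ¬ ∀ a b : G, a * b = b * a)
    (P : Sylow 7 G) : Nat.card (Sylow 7 G) = 8 ∧ Nat.card P = 7 ∧
      Nat.card ↥(Subgroup.normalizer (P : Set G)) = 21 := by
  have := Fact.mk (by norm_num : Nat.Prime 7)
  obtain ⟨hP, c, hc, h1, h2, h3⟩ := card_sylow_restrictions (k := 1) (m := 24) hnc
    (by rw [hG]; norm_num) one_ne_zero (by norm_num) P
  rw [hG] at h3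
  have hle := Nat.le_of_dvd (by norm_num) (Dvd.intro c h1)
  refine ⟨?_, hP, ?_⟩ <;> rw [hc] at * <;>
    interval_cases Nat.card (Sylow 7 G) <;> first | omega | (exfalso; revert h3; decide)

theorem card_sylow_three_of_168 (hG : Nat.card G = 168) (hnc : ¬ ∀ a b : G, a * b = b * a)
    (P : Sylow 3 G) : Nat.card P = 3 ∧ Nat.card ↥(Subgroup.normalizer (P : Set G)) = 6 := by
  have := Fact.mk (by norm_num : Nat.Prime 7)
  have := Fact.mk (by norm_num : Nat.Prime 3)
  obtain ⟨hP, c, hc, h1, h2, h3⟩ := card_sylow_restrictions (k := 1) (m := 56) hnc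
    (by rw [hG]; norm_num) one_ne_zero (by norm_num) P
  rw [hG] at h3
  -- if the normalizer has order `24`, then `P` normalizes all Sylow `7`-subgroups
  have h7 : Nat.card (Sylow 3 G) ≠ 7 := by
    intro hn
    have hall : ∀ x ∈ P, x = 1 := fun x hx => by
      refine eq_one_of_forall_mem_normalizer (p := 7) hnc (by rw [hG]; norm_num) fun S => ?_
      obtain ⟨hS8, -, hS⟩ := card_normalizer_seven_of_168 hG hnc S
      set N := Subgroup.normalizer (P : Set G)
      set M := Subgroup.normalizer (S : Set G)
      have hNi : N.index = 7 := by rw [← P.card_eq_index_normalizer, hn]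
      have hMi : M.index = 8 := by rw [← S.card_eq_index_normalizer, hS8]
      have h4 : (N ⊓ M).index ≤ 56 := by
        have := Subgroup.index_inf_le (H := N) (K := M)
        rwa [hNi, hMi] at this
      have h5 := (N ⊓ M).card_mul_index
      rw [hG] at h5
      have h6 : Nat.card ↥(N ⊓ M) ∣ 3 := by
        have h7 : Nat.card ↥(N ⊓ M) ∣ 24 := by
          have h8 : Nat.card N = 24 := by
            rw [hc]; rw [hn] at h1; omega
          exact h8 ▸ Subgroup.card_dvd_of_le inf_le_left
        have h8 : Nat.card ↥(N ⊓ M) ∣ 21 := hS ▸ Subgroup.card_dvd_of_le inf_le_right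
        exact Nat.dvd_gcd h7 h8
      have h7 : Nat.card ↥(N ⊓ M) = 3 := by
        rcases (Nat.dvd_prime (by norm_num)).mp h6 with h8 | h8
        · rw [h8] at h5; omega
        · exact h8
      have h8 : IsPGroup 3 ↥(N ⊓ M) := IsPGroup.of_card (n := 1) (by rw [h7]; rfl)
      have h9 := IsPGroup.inf_normalizer_sylow h8 P
      have h10 : (N ⊓ M) ⊓ N = N ⊓ M := inf_eq_left.mpr inf_le_left
      have h11 : N ⊓ M ≤ P := by
        rw [← h10]
        exact h9.le.trans inf_le_right
      have h12 : N ⊓ M = P := Subgroup.eq_of_le_of_card_ge h11 (by rw [h7]; exact hP.le)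
      have h13 : x ∈ N ⊓ M := by rw [h12]; exact hx
      exact h13.2
    have h4 : (P : Subgroup G) = ⊥ := (Subgroup.eq_bot_iff_forall _).mpr hall
    rw [h4, Subgroup.card_bot] at hP
    omega
  have hle := Nat.le_of_dvd (by norm_num) (Dvd.intro c h1)
  refine ⟨hP, ?_⟩
  rw [hc]
  by_cases h28 : Nat.card (Sylow 3 G) = 28
  · rw [h28] at h1
    omega
  · exfalso
    interval_cases Nat.card (Sylow 3 G) <;> first | omega | (revert h3; decide)

theorem card_centralizer_seven_of_168 (hG : Nat.card G = 168) (hnc : ¬ ∀ a b : G, a * b = b * a)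
    (x : G) (hx : orderOf x = 7) : Nat.card ↥(Subgroup.centralizer {x}) = 7 := by
  have := Fact.mk (by norm_num : Nat.Prime 7)
  obtain ⟨P, hP⟩ := exists_sylow_eq_zpowers (p := 7) (k := 1)
    (fun P => (card_normalizer_seven_of_168 hG hnc P).2.1) hx
  obtain ⟨-, h1, h2⟩ := card_normalizer_seven_of_168 hG hnc P
  obtain ⟨h3, h4, h5⟩ := card_centralizer_of_zpowers hnc P hP (by
    rintro rfl; rw [orderOf_one] at hx; omega)
  rw [h1] at h3
  rw [h2] at h4 h5
  have := Nat.le_of_dvd (by norm_num) h4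
  interval_cases Nat.card ↥(Subgroup.centralizer {x}) <;> omega

theorem card_centralizer_three_of_168 (hG : Nat.card G = 168) (hnc : ¬ ∀ a b : G, a * b = b * a)
    (x : G) (hx : orderOf x = 3) : Nat.card ↥(Subgroup.centralizer {x}) = 3 := by
  have := Fact.mk (by norm_num : Nat.Prime 3)
  obtain ⟨P, hP⟩ := exists_sylow_eq_zpowers (p := 3) (k := 1)
    (fun P => (card_sylow_three_of_168 hG hnc P).1) hx
  obtain ⟨h1, h2⟩ := card_sylow_three_of_168 hG hnc P
  obtain ⟨h3, h4, h5⟩ := card_centralizer_of_zpowers hnc P hP (by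
    rintro rfl; rw [orderOf_one] at hx; omega)
  rw [h1] at h3
  rw [h2] at h4 h5
  have := Nat.le_of_dvd (by norm_num) h4
  interval_cases Nat.card ↥(Subgroup.centralizer {x}) <;> omega

theorem card_sylow_two_of_168 {G : Type*} [Group G] [Finite G] (hG : Nat.card G = 168)
    (P : Sylow 2 G) : Nat.card P = 8 :=
  card_sylow_eq (k := 3) (m := 21) (by rw [hG]; norm_num) (by norm_num) P

/-- The orders of the elements of a simple group of order `168`. -/
theorem orderOf_of_168 (hG : Nat.card G = 168) (hnc : ¬ ∀ a b : G, a * b = b * a) (g : G) :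
    orderOf g ∣ 42 ∨ orderOf g = 4 := by
  by_cases h7 : 7 ∣ orderOf g
  · exact Or.inl ((orderOf_dvd_of_card_centralizer
      (card_centralizer_seven_of_168 hG hnc) h7).trans (by norm_num))
  by_cases h3 : 3 ∣ orderOf g
  · exact Or.inl ((orderOf_dvd_of_card_centralizer
      (card_centralizer_three_of_168 hG hnc) h3).trans (by norm_num))
  have h1 : orderOf g ∣ 8 := by
    have h2 : orderOf g ∣ 8 * (3 * 7) := by
      have := orderOf_dvd_natCard g
      rwa [hG] at this
    refine Nat.Coprime.dvd_of_dvd_mul_right (Nat.Coprime.mul_right ?_ ?_) h2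
    · exact ((Nat.Prime.coprime_iff_not_dvd (by norm_num)).mpr h3).symm
    · exact ((Nat.Prime.coprime_iff_not_dvd (by norm_num)).mpr h7).symm
  have h8 := orderOf_ne_eight hnc (card_sylow_two_of_168 hG) g
  have hle := Nat.le_of_dvd (by norm_num) h1
  interval_cases orderOf g <;> omega

theorem card_centralizer_two_of_168 (hG : Nat.card G = 168) (hnc : ¬ ∀ a b : G, a * b = b * a)
    {z : G} (hz : orderOf z = 2) : Nat.card ↥(Subgroup.centralizer {z}) ∣ 8 := by
  have := Fact.mk (by norm_num : Nat.Prime 7)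
  have := Fact.mk (by norm_num : Nat.Prime 3)
  have h3 := not_dvd_card_centralizer (by norm_num) (card_centralizer_three_of_168 hG hnc) hz
  have h7 := not_dvd_card_centralizer (by norm_num) (card_centralizer_seven_of_168 hG hnc) hz
  have h2 : Nat.card ↥(Subgroup.centralizer {z}) ∣ 8 * (3 * 7) := by
    have := (Subgroup.centralizer {z}).card_subgroup_dvd_card
    rwa [hG] at this
  refine Nat.Coprime.dvd_of_dvd_mul_right (Nat.Coprime.mul_right ?_ ?_) h2
  · exact ((Nat.Prime.coprime_iff_not_dvd (by norm_num)).mpr h3).symm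
  · exact ((Nat.Prime.coprime_iff_not_dvd (by norm_num)).mpr h7).symm

theorem inf_eq_bot_of_prime_card {G : Type*} [Group G] [Finite G] {p : ℕ} (hp : p.Prime)
    {H K : Subgroup G} (hH : Nat.card H = p) (hK : Nat.card K = p) (hne : H ≠ K) : H ⊓ K = ⊥ := by
  have h1 : Nat.card ↥(H ⊓ K) ∣ p := hH ▸ Subgroup.card_dvd_of_le inf_le_left
  rcases (Nat.dvd_prime hp).mp h1 with h2 | h2
  · exact Subgroup.card_eq_one.mp h2
  · exfalso
    have h3 : H ⊓ K = H := Subgroup.eq_of_le_of_card_ge inf_le_left (by rw [h2, hH])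
    have h4 : H ⊓ K = K := Subgroup.eq_of_le_of_card_ge inf_le_right (by rw [h2, hK])
    exact hne (h3.symm.trans h4)

/-- The Sylow `2`-subgroups of a simple group of order `168` are not quaternion groups: if each had
a single involution, then they would be the centralizers of their involutions, which gives
`21 * 7` elements, besides the `8 * 6` elements of order `7`. -/
theorem exists_involution_ne_of_168 (hG : Nat.card G = 168) (hnc : ¬ ∀ a b : G, a * b = b * a)
    (P : Sylow 2 G) {z : G} (hzP : z ∈ P) (hz : orderOf z = 2) :
    ∃ t ∈ P, orderOf t = 2 ∧ t ≠ z := by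
  classical
  by_contra! huniq
  have := Fact.mk (by norm_num : Nat.Prime 7)
  -- uniqueness of the involution in each Sylow subgroup
  have huniq' : ∀ Q : Sylow 2 G, ∀ w ∈ Q, ∀ w' ∈ Q, orderOf w = 2 → orderOf w' = 2 → w = w' := by
    intro Q w hw w' hw' ho ho'
    let e := Sylow.equiv Q P
    have h1 : ∀ (v : G) (hv : v ∈ Q), orderOf v = 2 → (e ⟨v, hv⟩ : G) = z := fun v hv hov => by
      refine huniq _ (e ⟨v, hv⟩).2 ?_
      rw [Subgroup.orderOf_coe, MulEquiv.orderOf_eq, Subgroup.orderOf_mk, hov]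
    have h2 := (h1 w hw ho).trans (h1 w' hw' ho').symm
    exact congrArg Subtype.val (e.injective (Subtype.ext h2))
  have hconj : ∀ (Q : Sylow 2 G) (w : G), w ∈ Q → orderOf w = 2 →
      ∀ n ∈ Subgroup.normalizer (Q : Set G), n ∈ Subgroup.centralizer {w} := by
    intro Q w hw ho n hn
    have h1 : n * w * n⁻¹ ∈ Q := (Subgroup.mem_normalizer_iff.mp hn w).mp hw
    have h2 : orderOf (n * w * n⁻¹) = 2 := by
      rw [← ho]
      exact orderOf_injective (MulAut.conj n).toMonoidHom (MulAut.conj n).injective w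
    have h3 := huniq' Q _ h1 w hw h2 ho
    rw [Subgroup.mem_centralizer_singleton_iff]
    rwa [mul_inv_eq_iff_eq_mul] at h3
  have hcent : ∀ (Q : Sylow 2 G) (w : G), w ∈ Q → orderOf w = 2 →
      (Q : Subgroup G) = Subgroup.centralizer {w} := by
    intro Q w hw ho
    refine Subgroup.eq_of_le_of_card_ge (fun n hn => hconj Q w hw ho n (Subgroup.le_normalizer hn))
      ?_
    have h1 := Nat.le_of_dvd (by norm_num) (card_centralizer_two_of_168 hG hnc ho)
    rwa [← card_sylow_two_of_168 hG Q] at h1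
  have hnorm : Nat.card ↥(Subgroup.normalizer (P : Set G)) = 8 := by
    have h1 : (P : Subgroup G) = Subgroup.normalizer (P : Set G) :=
      le_antisymm Subgroup.le_normalizer fun n hn => by
        rw [hcent P z hzP hz]
        exact hconj P z hzP hz n hn
    rw [← h1]
    exact card_sylow_two_of_168 hG P
  have hn2 : Nat.card (Sylow 2 G) = 21 := by
    have h1 := (Subgroup.normalizer (P : Set G)).card_mul_index
    rw [← P.card_eq_index_normalizer, hnorm, hG] at h1
    omega
  let S7 : Sylow 7 G := default
  have hn7 := (card_normalizer_seven_of_168 hG hnc S7).1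
  cases nonempty_fintype (Sylow 2 G)
  cases nonempty_fintype (Sylow 7 G)
  let F : Sylow 2 G ⊕ Sylow 7 G → Subgroup G := Sum.elim (fun Q => Q) (fun S => S)
  have hcop : ∀ (Q : Sylow 2 G) (S : Sylow 7 G), (Q : Subgroup G) ⊓ S = ⊥ := fun Q S => by
    rw [← disjoint_iff]
    apply Subgroup.disjoint_of_coprime_natCard
    rw [card_sylow_two_of_168 hG Q, (card_normalizer_seven_of_168 hG hnc S).2.1]
    norm_num
  have hF : ∀ i j, i ≠ j → F i ⊓ F j = ⊥ := by
    rintro (Q | S) (Q' | S') hne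
    · rw [Subgroup.eq_bot_iff_forall]
      intro x hx
      by_contra hx1
      -- some power of `x` is an involution in both subgroups
      have h1 : orderOf x ∣ 8 := by
        rw [← card_sylow_two_of_168 hG Q]
        exact (Q : Subgroup G).orderOf_dvd_natCard hx.1
      have h2 : 2 ∣ orderOf x := by
        have h3 : orderOf x ≠ 1 := fun h => hx1 (orderOf_eq_one_iff.mp h)
        have hle := Nat.le_of_dvd (by norm_num) h1
        interval_cases orderOf x <;> omega
      obtain ⟨t, h3⟩ := exists_pow_orderOf_eq h2
      have h4 := hcent Q _ ((Q : Subgroup G).pow_mem hx.1 t) h3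
      have h5 := hcent Q' _ ((Q' : Subgroup G).pow_mem hx.2 t) h3
      exact hne (congrArg Sum.inl (Sylow.ext (h4.trans h5.symm)))
    · exact hcop Q S'
    · rw [inf_comm]; exact hcop Q' S
    · exact inf_eq_bot_of_prime_card (p := 7) (by norm_num)
        (card_normalizer_seven_of_168 hG hnc S).2.1 (card_normalizer_seven_of_168 hG hnc S').2.1
        fun h => hne (congrArg Sum.inr (Sylow.ext h))
  have h1 := (card_le_and_exists_mem_of_disjoint F hF).1
  have h2 : ∑ Q : Sylow 2 G, (Nat.card (F (Sum.inl Q)) - 1) = 21 * 7 := by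
    rw [Finset.sum_congr rfl fun Q _ => (by
      rw [show Nat.card (F (Sum.inl Q)) = 8 from card_sylow_two_of_168 hG Q] :
        Nat.card (F (Sum.inl Q)) - 1 = 7), Finset.sum_const, Finset.card_univ,
      Fintype.card_eq_nat_card, hn2, smul_eq_mul]
  have h3 : ∑ S : Sylow 7 G, (Nat.card (F (Sum.inr S)) - 1) = 8 * 6 := by
    rw [Finset.sum_congr rfl fun S _ => (by
      rw [show Nat.card (F (Sum.inr S)) = 7 from (card_normalizer_seven_of_168 hG hnc S).2.1] :
        Nat.card (F (Sum.inr S)) - 1 = 6), Finset.sum_const, Finset.card_univ,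
      Fintype.card_eq_nat_card, hn7, smul_eq_mul]
  rw [Fintype.sum_sum_type, h2, h3, hG] at h1
  omega

end Order168

/-! ### Klein four-subgroups -/

section KleinFour

/-- The subgroup generated by two commuting elements `c` and `t` with trivial squares. -/
def kleinSubgroup {P : Type*} [Group P] (c t : P) (hc : c * c = 1) (ht : t * t = 1)
    (hct : t * c = c * t) : Subgroup P where
  carrier := {x | x = 1 ∨ x = c ∨ x = t ∨ x = c * t}
  one_mem' := Or.inl rfl
  mul_mem' := by
    have h1 : ∀ x, c * (c * x) = x := fun x => by rw [← mul_assoc, hc, one_mul]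
    have h2 : ∀ x, t * (c * x) = c * (t * x) := fun x => by rw [← mul_assoc, hct, mul_assoc]
    rintro x y (rfl | rfl | rfl | rfl) (rfl | rfl | rfl | rfl) <;>
      simp [mul_assoc, hc, ht, hct, h1, h2]
  inv_mem' := by
    have h1 : c⁻¹ = c := inv_eq_of_mul_eq_one_left hc
    have h2 : t⁻¹ = t := inv_eq_of_mul_eq_one_left ht
    rintro x (rfl | rfl | rfl | rfl) <;> simp [h1, h2, hct]

theorem sq_of_mem_kleinSubgroup {P : Type*} [Group P] {c t : P} {hc : c * c = 1} {ht : t * t = 1}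
    {hct : t * c = c * t} {x : P} (hx : x ∈ kleinSubgroup c t hc ht hct) : x ^ 2 = 1 := by
  have h3 : t * (c * t) = c := by rw [← mul_assoc, hct, mul_assoc, ht, mul_one]
  rcases hx with rfl | rfl | rfl | rfl
  · simp
  · rw [sq, hc]
  · rw [sq, ht]
  · rw [sq, mul_assoc, h3, hc]

/-- A group of order `8` with two involutions has a Klein four-subgroup. -/
theorem exists_elementary_subgroup {P : Type*} [Group P] [Finite P] (hP : Nat.card P = 8)
    {z t : P} (hz : orderOf z = 2) (ht : orderOf t = 2) (hzt : t ≠ z) :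
    ∃ A : Subgroup P, A.index ≤ 2 ∧ ∀ a ∈ A, a ^ 2 = 1 := by
  have h2P : IsPGroup 2 P := IsPGroup.of_card (n := 3) (by rw [hP]; norm_num)
  have : Nontrivial P := ⟨t, z, hzt⟩
  have hZ := h2P.center_nontrivial
  have hZ2 : 2 ∣ Nat.card (Subgroup.center P) := by
    have h1 : Nat.card (Subgroup.center P) ∣ 8 := hP ▸ Subgroup.card_subgroup_dvd_card _
    have h2 := (Nat.card_pos (α := Subgroup.center P))
    have h3 : Nat.card (Subgroup.center P) ≠ 1 := fun h =>
      not_subsingleton _ (Nat.card_eq_one_iff_unique.mp h).1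
    have hle := Nat.le_of_dvd (by norm_num) h1
    interval_cases Nat.card (Subgroup.center P) <;> omega
  obtain ⟨⟨c, hcZ⟩, hc⟩ := exists_prime_orderOf_dvd_card' 2 hZ2
  rw [Subgroup.orderOf_mk] at hc
  obtain ⟨t', ht', htc⟩ : ∃ t' : P, orderOf t' = 2 ∧ t' ≠ c := by
    by_cases h : t = c
    · exact ⟨z, hz, fun h' => hzt (h.trans h'.symm)⟩
    · exact ⟨t, ht, h⟩
  have sq1 : ∀ {w : P}, orderOf w = 2 → w * w = 1 := fun {w} hw => by
    rw [← sq, ← hw, pow_orderOf_eq_one]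
  have ne1 : ∀ {w : P}, orderOf w = 2 → w ≠ 1 := fun {w} hw h => by
    rw [h, orderOf_one] at hw; omega
  let A := kleinSubgroup c t' (sq1 hc) (sq1 ht') (Subgroup.mem_center_iff.mp hcZ t')
  refine ⟨A, ?_, fun a ha => sq_of_mem_kleinSubgroup ha⟩
  have h1 : ({1, c, t'} : Set P) ⊆ A := by
    rintro x (rfl | rfl | rfl)
    · exact Or.inl rfl
    · exact Or.inr (Or.inl rfl)
    · exact Or.inr (Or.inr (Or.inl rfl))
  have h2 := Set.ncard_le_ncard h1 (Set.toFinite _)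
  rw [Set.ncard_eq_three.mpr ⟨_, _, _, (ne1 hc).symm, (ne1 ht').symm, htc.symm, rfl⟩,
    ← Nat.card_coe_set_eq] at h2
  have h3 := A.card_mul_index
  rw [hP] at h3
  have h4 : 3 ≤ Nat.card A := h2
  have h5 : Nat.card A ∣ 8 := ⟨_, h3.symm⟩
  by_contra hlt
  have h6 : 3 ≤ A.index := by omega
  nlinarith

end KleinFour

/-! ### Simple groups of order 168: induction of characters -/

section Order168

variable {G : Type*} [Group G] [Finite G] [IsSimpleGroup G]

/-- A noncommutative `2`-subgroup is a Sylow subgroup of order `8` with elements of order four and two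
involutions. The latter give a Klein four-subgroup. The characters of degree one have values `±1`,
as elements of order four are conjugate to their inverses. -/
theorem isRationallyMonomial_of_168 (hG : Nat.card G = 168) (hnc : ¬ ∀ a b : G, a * b = b * a)
    (P : Subgroup G) (hP : IsPGroup 2 P) (hPc : ¬ ∀ a ∈ P, ∀ b ∈ P, a * b = b * a) :
    IsRationallyMonomial 42 P ∧ ∃ g ∈ P, orderOf g = 4 := by
  obtain ⟨S, hPS⟩ := hP.exists_le_sylow
  have hS := card_sylow_two_of_168 hG S
  have hPeq : P = S := by
    obtain ⟨k, hk⟩ := IsPGroup.iff_card.mp hP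
    refine Subgroup.eq_of_le_of_card_ge hPS ?_
    rw [hS, hk]
    by_contra hlt
    have hk2 : k ≤ 2 := by
      by_contra hk3
      exact hlt (by
        calc 8 = 2 ^ 3 := by norm_num
          _ ≤ 2 ^ k := Nat.pow_le_pow_right (by norm_num) (by omega))
    exact hPc fun a ha b hb =>
      congrArg Subtype.val (comm_of_card_eq_prime_pow hk hk2 (⟨a, ha⟩ : P) ⟨b, hb⟩)
  subst hPeq
  have hord : ∀ g ∈ S, g ^ 2 = 1 ∨ orderOf g = 4 := fun g hg => by
    have h1 : orderOf g ∣ 8 := hS ▸ (S : Subgroup G).orderOf_dvd_natCard hg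
    rcases orderOf_of_168 hG hnc g with h2 | h2
    · left
      rw [← orderOf_dvd_iff_pow_eq_one]
      exact (Nat.dvd_gcd h1 h2).trans (by norm_num)
    · exact Or.inr h2
  obtain ⟨g, hg, hg4⟩ : ∃ g ∈ S, orderOf g = 4 := by
    by_contra! hno
    refine hPc fun a ha b hb => ?_
    exact congrArg Subtype.val (comm_of_forall_sq_eq_one (P := ↥(S : Subgroup G))
      (fun x => Subtype.ext ((hord x x.2).resolve_right (hno x x.2))) ⟨a, ha⟩ ⟨b, hb⟩)
  have hz : orderOf (g ^ 2) = 2 := by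
    rw [orderOf_pow_of_dvd (by norm_num) (by rw [hg4]; norm_num), hg4]
  obtain ⟨t, htS, ht, hne⟩ := exists_involution_ne_of_168 hG hnc S
    ((S : Subgroup G).pow_mem hg 2) hz
  obtain ⟨A, hA, hA2⟩ := exists_elementary_subgroup (P := ↥(S : Subgroup G)) hS
    (z := ⟨g ^ 2, (S : Subgroup G).pow_mem hg 2⟩) (t := ⟨t, htS⟩)
    (by rw [Subgroup.orderOf_mk, hz]) (by rw [Subgroup.orderOf_mk, ht])
    (fun h => hne (congrArg Subtype.val h))
  refine ⟨⟨⟨A, fun a ha b hb => ?_, hA, fun a ha => ?_⟩, fun ψ h => ?_⟩, g, hg, hg4⟩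
  · exact congrArg Subtype.val (comm_of_forall_sq_eq_one (P := A)
      (fun x => Subtype.ext (hA2 x x.2)) ⟨a, ha⟩ ⟨b, hb⟩)
  · rw [show 42 = 2 * 21 by norm_num, pow_mul, hA2 a ha, one_pow]
  · have h2 : ψ h ^ 2 = 1 := by
      rcases hord h h.2 with h1 | h1
      · rw [← map_pow, show h ^ 2 = 1 from Subtype.ext h1, map_one]
      · obtain ⟨s, hs, hsh⟩ := exists_conj_eq_inv hnc S hS h.2 h1
        have h3 : (⟨s, hs⟩ : ↥(S : Subgroup G)) * h * ⟨s, hs⟩⁻¹ = h⁻¹ := Subtype.ext hsh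
        have h4 : ψ h = ψ h⁻¹ := by
          rw [← h3, map_mul, map_mul, mul_right_comm, ← map_mul, mul_inv_cancel, map_one, one_mul]
        rw [sq]
        nth_rewrite 2 [h4]
        rw [← map_mul, mul_inv_cancel, map_one]
    rw [show 42 = 2 * 21 by norm_num, pow_mul, h2, one_pow]

theorem add_inv_mem_closure {G : Type*} [Group G] [Finite G] {f : G → QBar}
    (hf : f ∈ virtualCharacters QBar G) (g : G) :
    f g + f g⁻¹ ∈ AddSubgroup.closure {z : QBar | ∃ w, w ^ orderOf g = 1 ∧ z = w + w⁻¹} := by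
  cases nonempty_fintype G
  have h1 := virtualCharacters_comp (Subgroup.zpowers g).subtype hf
  have h2 := mem_closure_of_comm (fun a b => mul_comm' a b) h1
  let x : Subgroup.zpowers g := ⟨g, Subgroup.mem_zpowers g⟩
  let ev : (Subgroup.zpowers g → QBar) →+ QBar :=
    Pi.evalAddMonoidHom (fun _ : Subgroup.zpowers g => QBar) x +
      Pi.evalAddMonoidHom (fun _ : Subgroup.zpowers g => QBar) x⁻¹
  have h3 : AddSubgroup.closure {f : Subgroup.zpowers g → QBar | ∃ ψ : Subgroup.zpowers g →* QBar,
      f = ⇑ψ} ≤ (AddSubgroup.closure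
        {z : QBar | ∃ w, w ^ orderOf g = 1 ∧ z = w + w⁻¹}).comap ev := by
    rw [AddSubgroup.closure_le]
    rintro _ ⟨ψ, rfl⟩
    refine AddSubgroup.subset_closure ⟨ψ x, ?_, ?_⟩
    · rw [← map_pow, show x ^ orderOf g = 1 from Subtype.ext (pow_orderOf_eq_one g), map_one]
    · change ψ x + ψ x⁻¹ = _
      rw [eq_inv_of_mul_eq_one_left (show ψ x⁻¹ * ψ x = 1 by
        rw [← map_mul, inv_mul_cancel, map_one])]
  exact h3 h2

/-- All characters of a simple group of order `168` have values in `ℚ(ζ_42)`: the elements of order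
four, which are the ones of order not dividing `42`, are conjugate to their inverses. -/
theorem mem_cyclotomicCharacters_of_168 (hG : Nat.card G = 168)
    (hnc : ¬ ∀ a b : G, a * b = b * a) {f : G → QBar} (hf : f ∈ virtualCharacters QBar G) :
    f ∈ cyclotomicCharacters 42 G := by
  cases nonempty_fintype G
  refine ⟨hf, fun g => ?_⟩
  rcases orderOf_of_168 hG hnc g with ⟨t, ht⟩ | h4
  · have h1 : AddSubgroup.closure {z : QBar | z ^ orderOf g = 1} ≤
        (cyclotomicSubfield 42).toSubfield.toSubring.toAddSubgroup := by
      rw [AddSubgroup.closure_le]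
      intro z hz
      have hz' : z ^ orderOf g = 1 := hz
      exact mem_cyclotomicSubfield_of_pow (by rw [ht, pow_mul, hz', one_pow])
    exact h1 (virtualCharacters_apply_mem hf g)
  · obtain ⟨P, hP⟩ := exists_mem_sylow_of_orderOf (p := 2) (k := 2) (g := g) (by rw [h4]; norm_num)
    obtain ⟨s, -, hs⟩ := exists_conj_eq_inv hnc P (card_sylow_two_of_168 hG P) hP h4
    have h1 : f g⁻¹ = f g := by
      rw [← hs]
      simpa using virtualCharacters_conj hf s⁻¹ g
    have h2 : AddSubgroup.closure {z : QBar | ∃ w, w ^ orderOf g = 1 ∧ z = w + w⁻¹} ≤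
        (cyclotomicSubfield 42).toSubfield.toSubring.toAddSubgroup := by
      rw [AddSubgroup.closure_le]
      rintro _ ⟨w, hw, rfl⟩
      rw [h4] at hw
      change w + w⁻¹ ∈ cyclotomicSubfield 42
      have hw0 : w ≠ 0 := by
        rintro rfl
        norm_num at hw
      have h5 : (w ^ 2 - 1) * (w ^ 2 + 1) = 0 := by linear_combination hw
      rcases mul_eq_zero.mp h5 with h6 | h6
      · have h7 : w ^ 2 = 1 := sub_eq_zero.mp h6
        have h8 : w ∈ cyclotomicSubfield 42 := mem_cyclotomicSubfield_of_pow (by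
          rw [show 42 = 2 * 21 by norm_num, pow_mul, h7, one_pow])
        exact add_mem h8 (inv_mem h8)
      · have h7 : w + w⁻¹ = 0 := by
          field_simp
          rw [h6, mul_zero]
        rw [h7]
        exact zero_mem _
    have h3 : f g + f g⁻¹ ∈ cyclotomicSubfield 42 := h2 (add_inv_mem_closure hf g)
    rw [h1, ← two_mul] at h3
    have h4 : f g = 2⁻¹ * (2 * f g) := by simp
    rw [h4]
    exact mul_mem (inv_mem (ofNat_mem _ 2)) h3

theorem exists_comm_subgroup_of_card_dvd {G : Type*} [Group G] [Finite G]
    (hG : Nat.card G ∣ 2520) (q : ℕ) (hq : q.Prime) (P : Subgroup G) (hP : IsPGroup q P) :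
    ∃ A : Subgroup P, (∀ a ∈ A, ∀ b ∈ A, a * b = b * a) ∧ A.index ≤ 2 :=
  have := Fact.mk hq
  exists_comm_subgroup_of_isPGroup hP (P.card_subgroup_dvd_card.trans hG)

theorem virtualCharacters_le_monomialSpan_of_168 [Fintype G] (hG : Nat.card G = 168)
    (hnc : ¬ ∀ a b : G, a * b = b * a) :
    (virtualCharacters QBar G).toAddSubgroup ≤ monomialSpan QBar 42 G := by
  refine le_trans (fun f hf => mem_cyclotomicCharacters_of_168 hG hnc hf)
    (cyclotomicCharacters_le_monomialSpan (r := 2) (by norm_num) (by norm_num) (by norm_num)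
      (fun g => ?_) (exists_comm_subgroup_of_card_dvd (by rw [hG]; norm_num)) fun x P hel => ?_)
  · rw [← orderOf_dvd_iff_pow_eq_one]
    rcases orderOf_of_168 hG hnc g with h | h
    · exact h.trans (by norm_num)
    · rw [h]; norm_num
  · by_cases hPc : ∀ a ∈ P, ∀ b ∈ P, a * b = b * a
    · exact Or.inl hPc
    · right
      obtain ⟨hmon, g, hg, hg4⟩ := isRationallyMonomial_of_168 hG hnc P hel.isPGroup hPc
      have hx : orderOf x = 1 := by
        have hcop : (orderOf x).Coprime (orderOf g) := by
          rw [hg4]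
          exact Nat.Coprime.pow_right 2
            ((Nat.Prime.coprime_iff_not_dvd (by norm_num)).mpr hel.not_dvd).symm
        have h1 := (hel.comm g hg).orderOf_mul_eq_mul_orderOf_of_coprime hcop
        rw [hg4] at h1
        rcases orderOf_of_168 hG hnc (x * g) with h | h <;> rw [h1] at h
        · exact absurd ((Dvd.intro_left _ rfl).trans h) (by norm_num : ¬ 4 ∣ 42)
        · omega
      rw [orderOf_eq_one_iff] at hx
      subst hx
      rwa [Subgroup.zpowers_one_eq_bot, bot_sup_eq]

end Order168

/-! ### Normalizers of cyclic subgroups -/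

section NormalizerAction

variable {G : Type*} [Group G] [Finite G]

/-- The normalizer of a cyclic group modulo its centralizer acts faithfully on it. -/
theorem exists_card_centralizer_mul_eq {P : Subgroup G} {x : G} (hx : Subgroup.zpowers x = P) :
    ∃ d, d ∣ (Nat.card P).totient ∧ Nat.card ↥(Subgroup.centralizer {x}) * d =
      Nat.card ↥(Subgroup.normalizer (P : Set G)) := by
  subst hx
  set P := Subgroup.zpowers x
  let φ := P.normalizerMonoidHom
  refine ⟨φ.ker.index, ?_, ?_⟩
  · rw [← IsCyclic.card_mulAut, Subgroup.index_ker]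
    exact Subgroup.card_subgroup_dvd_card _
  · have h1 : φ.ker.map (Subgroup.normalizer (P : Set G)).subtype = Subgroup.centralizer {x} := by
      ext y
      constructor
      · rintro ⟨n, hn, rfl⟩
        have h2 : n ∈ (Subgroup.centralizer (P : Set G)).subgroupOf
            (Subgroup.normalizer (P : Set G)) := by
          rw [← Subgroup.normalizerMonoidHom_ker]; exact hn
        rw [Subgroup.mem_centralizer_singleton_iff]
        exact ((Subgroup.mem_centralizer_iff.mp (Subgroup.mem_subgroupOf.mp h2)) x
          (Subgroup.mem_zpowers x)).symm
      · intro hy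
        rw [Subgroup.mem_centralizer_singleton_iff] at hy
        have h2 : y ∈ Subgroup.centralizer (P : Set G) := by
          rw [Subgroup.mem_centralizer_iff]
          rintro _ ⟨i, rfl⟩
          exact ((Commute.zpow_right hy i).eq).symm
        have h3 : y ∈ Subgroup.normalizer (P : Set G) := Subgroup.centralizer_le_normalizer _ h2
        refine ⟨⟨y, h3⟩, ?_, rfl⟩
        have h4 : (⟨y, h3⟩ : Subgroup.normalizer (P : Set G)) ∈
            (Subgroup.centralizer (P : Set G)).subgroupOf (Subgroup.normalizer (P : Set G)) :=
          Subgroup.mem_subgroupOf.mpr h2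
        rw [← Subgroup.normalizerMonoidHom_ker] at h4
        exact h4
    rw [← h1, Subgroup.card_map_of_injective (Subgroup.subtype_injective _),
      Subgroup.card_mul_index]

end NormalizerAction

/-! ### Simple groups of order 360 -/

section Order360

variable {G : Type*} [Group G] [Finite G] [IsSimpleGroup G]

/-- A cyclic Sylow `3`-subgroup would have `10` or `40` conjugates. In the first case, an involution
centralizes it, as its automorphism group has order `6`, and `not_orderOf_prime_of_commute_sylow`
applies; in the second case, it is its own normalizer, which is excluded by transfer. -/
theorem orderOf_ne_nine_of_360 (hG : Nat.card G = 360) (hnc : ¬ ∀ a b : G, a * b = b * a)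
    (c : G) : orderOf c ≠ 9 := by
  intro hc
  have := Fact.mk (by norm_num : Nat.Prime 3)
  obtain ⟨P, hP⟩ := exists_sylow_eq_zpowers (p := 3) (k := 2)
    (fun P => card_sylow_eq (m := 40) (by rw [hG]; norm_num) (by norm_num) P) hc
  obtain ⟨hP9, b, hb, h1, h2, h3⟩ := card_sylow_restrictions (k := 2) (m := 40) hnc
    (by rw [hG]; norm_num) two_ne_zero (by norm_num) P
  have hc1 : c ≠ 1 := by rintro rfl; rw [orderOf_one] at hc; omega
  obtain ⟨h4, h5, h6⟩ := card_centralizer_of_zpowers hnc P hP hc1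
  rw [hG] at h3
  have h10 : Nat.card (Sylow 3 G) = 10 ∨ Nat.card (Sylow 3 G) = 40 := by
    have hle := Nat.le_of_dvd (by norm_num) (Dvd.intro b h1)
    interval_cases Nat.card (Sylow 3 G) <;> first | omega | (exfalso; revert h3; decide)
  rcases h10 with h10 | h10
  · -- an involution commutes with `c`
    have hb4 : b = 4 := by rw [h10] at h1; omega
    obtain ⟨d, hd, h7⟩ : ∃ d, d ∣ (Nat.card P).totient ∧
        Nat.card ↥(Subgroup.centralizer {c}) * d =
          Nat.card ↥(Subgroup.normalizer (P : Set G)) := exists_card_centralizer_mul_eq hP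
    rw [hP9, show Nat.totient (3 ^ 2) = 6 by decide] at hd
    rw [hb, hb4] at h7
    have h8 : 2 ∣ Nat.card ↥(Subgroup.centralizer {c}) := by
      have := Nat.le_of_dvd (by norm_num) hd
      interval_cases d <;> omega
    obtain ⟨w, hw⟩ := exists_prime_orderOf_dvd_card' 2 h8
    have hwc : (w : G) * c = c * w := Subgroup.mem_centralizer_singleton_iff.mp w.2
    -- a Sylow subgroup with trivial intersection with `P`
    obtain ⟨S, hS⟩ : ∃ S : Sylow 3 G, c ^ 3 ∉ S := by
      by_contra! hall
      have h9 := eq_one_of_forall_mem_normalizer (p := 3) hnc (by rw [hG]; norm_num)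
        fun S => Subgroup.le_normalizer (hall S)
      have h11 := orderOf_dvd_of_pow_eq_one h9
      rw [hc] at h11
      omega
    have hPS : (P : Subgroup G) ⊓ S = ⊥ := by
      rw [Subgroup.eq_bot_iff_forall]
      rintro x ⟨hxP, hxS⟩
      by_contra hx1
      have hxP' : x ∈ Subgroup.zpowers c := hP ▸ hxP
      have h9 : orderOf x ∣ 9 := by
        have := (P : Subgroup G).orderOf_dvd_natCard hxP
        rwa [show Nat.card ↥(P : Subgroup G) = 9 from hP9] at this
      have h11 : 3 ∣ orderOf x := by
        have h12 : orderOf x ≠ 1 := fun h => hx1 (orderOf_eq_one_iff.mp h)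
        have := Nat.le_of_dvd (by norm_num) h9
        interval_cases orderOf x <;> omega
      obtain ⟨t, ht⟩ := exists_pow_orderOf_eq h11
      obtain ⟨i, hi⟩ := (Subgroup.zpowers c).pow_mem hxP' t
      have hi : c ^ i = x ^ t := hi
      have h12 : (9 : ℤ) ∣ i * 3 := by
        have h13 : (orderOf c : ℤ) ∣ i * 3 := by
          rw [orderOf_dvd_iff_zpow_eq_one, zpow_mul, hi]
          exact_mod_cast ht ▸ pow_orderOf_eq_one (x ^ t)
        rw [hc] at h13
        exact_mod_cast h13
      obtain ⟨j, rfl⟩ : (3 : ℤ) ∣ i := by omega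
      have h13 : Subgroup.zpowers (x ^ t) = Subgroup.zpowers (c ^ 3) := by
        refine Subgroup.eq_of_le_of_card_ge (Subgroup.zpowers_le.mpr ⟨j, ?_⟩) ?_
        · change (c ^ 3) ^ j = x ^ t
          rw [← hi, zpow_mul]; norm_cast
        · rw [Nat.card_zpowers, Nat.card_zpowers, ht,
            orderOf_pow_of_dvd (by norm_num) (by rw [hc]; norm_num), hc]
      apply hS
      have h14 : Subgroup.zpowers (x ^ t) ≤ S :=
        Subgroup.zpowers_le.mpr ((S : Subgroup G).pow_mem hxS t)
      rw [h13] at h14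
      exact h14 (Subgroup.mem_zpowers _)
    refine not_orderOf_prime_of_commute_sylow (p := 3) (q := 2) hnc (by norm_num)
      (by rw [hG]; norm_num) P S (by rw [h10, hP9]; norm_num) hPS (w := w) (fun a ha => ?_)
      (by rwa [Subgroup.orderOf_coe])
    have ha' : a ∈ Subgroup.zpowers c := hP ▸ ha
    obtain ⟨i, rfl⟩ := ha'
    exact (Commute.zpow_right hwc i).eq
  · have hb1 : b = 1 := by rw [h10] at h1; omega
    rw [hb, hb1] at h5 h6
    rw [hP9] at h4
    exact h6 (Nat.dvd_antisymm h5 h4)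

theorem pow_eq_one_of_360 (hG : Nat.card G = 360) (hnc : ¬ ∀ a b : G, a * b = b * a)
    (g : G) : g ^ 60 = 1 := by
  rw [← orderOf_dvd_iff_pow_eq_one]
  have h1 : orderOf g ∣ 360 := hG ▸ orderOf_dvd_natCard g
  have h8 : ¬ 8 ∣ orderOf g := fun h => by
    obtain ⟨t, ht⟩ := exists_pow_orderOf_eq h
    exact orderOf_ne_eight hnc (card_sylow_eq (k := 3) (m := 45) (by rw [hG]; norm_num)
      (by norm_num)) _ ht
  have h9 : ¬ 9 ∣ orderOf g := fun h => by
    obtain ⟨t, ht⟩ := exists_pow_orderOf_eq h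
    exact orderOf_ne_nine_of_360 hG hnc _ ht
  have key : ∀ d ∈ Nat.divisors 360, ¬ 8 ∣ d → ¬ 9 ∣ d → d ∣ 60 := by decide +kernel
  exact key _ (Nat.mem_divisors.mpr ⟨h1, by norm_num⟩) h8 h9

end Order360

/-! ### Inverting involutions -/

section Involutions

variable {G : Type*} [Group G]

/-- If conjugation by an involution maps `y` to an element commuting with `y`, then it commutes with the
product of `y` and its image. -/
theorem commute_mul_conj {t y : G} (ht : orderOf t = 2) (hy : Commute y (t * y * t⁻¹)) :
    Commute t (y * (t * y * t⁻¹)) := by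
  have h1 : t * t = 1 := by rw [← sq, ← ht, pow_orderOf_eq_one]
  have h2 : t⁻¹ = t := inv_eq_of_mul_eq_one_left h1
  rw [h2] at hy ⊢
  change t * (y * (t * y * t)) = y * (t * y * t) * t
  calc t * (y * (t * y * t)) = (t * y * t) * (y * t) := by simp only [mul_assoc]
    _ = y * (t * y * t) * t := by rw [← mul_assoc, ← hy.eq]

theorem mem_normalizer_zpowers {y g : G} (h : g * y * g⁻¹ = y ∨ g * y * g⁻¹ = y⁻¹) :
    g ∈ Subgroup.normalizer (Subgroup.zpowers y : Set G) := by
  rw [Subgroup.mem_normalizer_iff_map_conj_eq, MonoidHom.map_zpowers]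
  rcases h with h | h
  · exact congrArg Subgroup.zpowers h
  · exact (congrArg Subgroup.zpowers h).trans (Subgroup.zpowers_inv)

end Involutions

/-! ### Simple groups of order 504 -/

section Order504

variable {G : Type*} [Group G] [Finite G] [IsSimpleGroup G]

/-- If there were `8` Sylow `7`-subgroups, then their normalizers would have order `63`, so that an
element of order `3` would centralize one of them, against `not_orderOf_prime_of_commute_sylow`. -/
theorem card_sylow_seven_of_504 (hG : Nat.card G = 504) (hnc : ¬ ∀ a b : G, a * b = b * a)
    (P : Sylow 7 G) : Nat.card P = 7 ∧ Nat.card (Sylow 7 G) = 36 ∧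
      Nat.card ↥(Subgroup.normalizer (P : Set G)) = 14 := by
  have := Fact.mk (by norm_num : Nat.Prime 7)
  have := Fact.mk (by norm_num : Nat.Prime 3)
  obtain ⟨hP, b, hb, h1, h2, h3⟩ := card_sylow_restrictions (k := 1) (m := 72) hnc
    (by rw [hG]; norm_num) one_ne_zero (by norm_num) P
  rw [hG] at h3
  rw [pow_one] at hP
  have hn : Nat.card (Sylow 7 G) = 8 ∨ Nat.card (Sylow 7 G) = 36 := by
    have hle := Nat.le_of_dvd (by norm_num) (Dvd.intro b h1)
    interval_cases Nat.card (Sylow 7 G) <;> first | omega | (exfalso; revert h3; decide)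
  rcases hn with hn | hn
  · exfalso
    have hb9 : b = 9 := by rw [hn] at h1; omega
    obtain ⟨c, hc⟩ := exists_prime_orderOf_dvd_card' (G := ↥(P : Subgroup G)) 7
      (by rw [show Nat.card ↥(P : Subgroup G) = 7 from hP])
    have hcP : Subgroup.zpowers (c : G) = P := Subgroup.eq_of_le_of_card_ge
      (Subgroup.zpowers_le.mpr c.2) (by
        rw [Nat.card_zpowers, Subgroup.orderOf_coe, hc]; exact hP.le)
    obtain ⟨d, hd, h7⟩ : ∃ d, d ∣ (Nat.card P).totient ∧
        Nat.card ↥(Subgroup.centralizer {(c : G)}) * d =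
          Nat.card ↥(Subgroup.normalizer (P : Set G)) := exists_card_centralizer_mul_eq hcP
    rw [hP, show Nat.totient 7 = 6 by decide] at hd
    rw [hb, hb9] at h7
    have h8 : 3 ∣ Nat.card ↥(Subgroup.centralizer {(c : G)}) := by
      have := Nat.le_of_dvd (by norm_num) hd
      interval_cases d <;> omega
    obtain ⟨w, hw⟩ := exists_prime_orderOf_dvd_card' 3 h8
    have hwc : (w : G) * c = c * w := Subgroup.mem_centralizer_singleton_iff.mp w.2
    have : Nontrivial (Sylow 7 G) := Finite.one_lt_card_iff_nontrivial.mp (by rw [hn]; norm_num)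
    obtain ⟨S, hS⟩ := exists_ne P
    refine not_orderOf_prime_of_commute_sylow (p := 7) (q := 3) hnc (by norm_num)
      (by rw [hG]; norm_num) P S (by rw [hn, hP])
      (inf_eq_bot_of_prime_card (p := 7) (by norm_num) hP
        (card_sylow_eq (k := 1) (m := 72) (by rw [hG]; norm_num) (by norm_num) S)
        fun h => hS (Sylow.ext h.symm)) (w := w) (fun a ha => ?_)
      (by rwa [Subgroup.orderOf_coe])
    have ha' : a ∈ Subgroup.zpowers (c : G) := by rw [hcP]; exact ha
    obtain ⟨i, rfl⟩ := ha'
    exact (Commute.zpow_right hwc i).eq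
  · refine ⟨hP, hn, ?_⟩
    rw [hn] at h1
    omega

theorem card_centralizer_seven_of_504 (hG : Nat.card G = 504) (hnc : ¬ ∀ a b : G, a * b = b * a)
    (x : G) (hx : orderOf x = 7) : Nat.card ↥(Subgroup.centralizer {x}) = 7 := by
  have := Fact.mk (by norm_num : Nat.Prime 7)
  obtain ⟨P, hP⟩ := exists_sylow_eq_zpowers (p := 7) (k := 1)
    (fun P => (card_sylow_seven_of_504 hG hnc P).1) hx
  obtain ⟨h1, -, h2⟩ := card_sylow_seven_of_504 hG hnc P
  obtain ⟨h3, h4, h5⟩ := card_centralizer_of_zpowers hnc P hP (by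
    rintro rfl; rw [orderOf_one] at hx; omega)
  rw [h1] at h3
  rw [h2] at h4 h5
  have := Nat.le_of_dvd (by norm_num) h4
  interval_cases Nat.card ↥(Subgroup.centralizer {x}) <;> omega

/-- A subgroup of index `7` is impossible: on its `7` cosets, an involution inverting an element
of order `7` is a product of three transpositions, hence odd, and a simple group that is not
commutative has no subgroup of index `2`. -/
theorem index_ne_seven_of_504 (hG : Nat.card G = 504) (hnc : ¬ ∀ a b : G, a * b = b * a)
    (H : Subgroup G) : H.index ≠ 7 := by
  classical
  intro hH
  have := Fact.mk (by norm_num : Nat.Prime 7)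
  obtain ⟨c, hc⟩ := exists_prime_orderOf_dvd_card' (G := G) 7 (by rw [hG]; norm_num)
  obtain ⟨P, hP⟩ := exists_sylow_eq_zpowers (p := 7) (k := 1)
    (fun P => (card_sylow_seven_of_504 hG hnc P).1) hc
  obtain ⟨hP7, -, hN⟩ := card_sylow_seven_of_504 hG hnc P
  obtain ⟨⟨t, htN⟩, ht⟩ := exists_prime_orderOf_dvd_card'
    (G := ↥(Subgroup.normalizer (P : Set G))) 2 (by rw [hN]; norm_num)
  rw [Subgroup.orderOf_mk] at ht
  have hcP : c ∈ P := by
    have := Subgroup.mem_zpowers c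
    rw [hP] at this
    exact this
  have htc : t * c * t⁻¹ ∈ Subgroup.zpowers c := by
    rw [hP]
    exact (Subgroup.mem_normalizer_iff.mp htN c).mp hcP
  have hinv : t * c * t⁻¹ = c⁻¹ := by
    obtain ⟨i, hi⟩ := htc
    have h1 : Commute c (t * c * t⁻¹) := by
      rw [← hi]; exact Commute.self_zpow c i
    have h2 := commute_mul_conj ht h1
    refine (inv_eq_of_mul_eq_one_right ?_).symm
    by_contra hw
    have hwP : c * (t * c * t⁻¹) ∈ P := mul_mem hcP ((Subgroup.mem_normalizer_iff.mp htN c).mp hcP)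
    have h3 : orderOf (c * (t * c * t⁻¹)) = 7 := by
      have h4 : orderOf (c * (t * c * t⁻¹)) ∣ 7 := hP7 ▸ (P : Subgroup G).orderOf_dvd_natCard hwP
      exact ((Nat.dvd_prime (by norm_num)).mp h4).resolve_left
        fun h => hw (orderOf_eq_one_iff.mp h)
    have h5 : orderOf t ∣ 7 := by
      rw [← card_centralizer_seven_of_504 hG hnc _ h3]
      exact Subgroup.orderOf_dvd_natCard _ (Subgroup.mem_centralizer_singleton_iff.mpr h2.eq)
    rw [ht] at h5
    omega
  let X := G ⧸ H
  have hX : Nat.card X = 7 := hH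
  cases nonempty_fintype X
  -- nontrivial powers of `c` have no fixed points
  have hfix : ∀ z ∈ Subgroup.zpowers c, ∀ x : X, z • x = x → z = 1 := by
    intro z hz x hzx
    have h1 : orderOf z ∣ 7 := by
      rw [← hc, ← Nat.card_zpowers c]; exact Subgroup.orderOf_dvd_natCard _ hz
    have h2 : orderOf z ∣ 72 := by
      have h3 := (MulAction.stabilizer G x).card_mul_index
      rw [MulAction.index_stabilizer_of_transitive, hX, hG] at h3
      have h4 : Nat.card (MulAction.stabilizer G x) = 72 := by omega
      rw [← h4]
      exact Subgroup.orderOf_dvd_natCard _ hzx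
    exact orderOf_eq_one_iff.mp (Nat.dvd_one.mp (Nat.dvd_gcd h1 h2))
  -- so `t` has at most one fixed point
  have huniq : ∀ x y : X, t • x = x → t • y = y → x = y := by
    intro x y hx hy
    have hinj : Function.Injective fun z : Subgroup.zpowers c => (z : G) • x := by
      intro z z' hzz
      have hzz : (z : G) • x = (z' : G) • x := hzz
      have h1 : ((z' : G)⁻¹ * z) • x = x := by rw [mul_smul, hzz, inv_smul_smul]
      have h2 := hfix _ (mul_mem (inv_mem z'.2) z.2) x h1
      exact Subtype.ext (inv_mul_eq_one.mp h2).symm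
    obtain ⟨⟨z, hz⟩, hzy⟩ := (hinj.bijective_of_nat_card_le (by
      rw [hX, Nat.card_zpowers, hc])).2 y
    have hzy : z • x = y := hzy
    have h1 : t * z * t⁻¹ = z⁻¹ := by
      obtain ⟨i, rfl⟩ := hz
      change t * c ^ i * t⁻¹ = (c ^ i)⁻¹
      rw [← conj_zpow, hinv, inv_zpow]
    have h2 : z⁻¹ • x = y := by
      rw [← h1, mul_smul, mul_smul, inv_smul_eq_iff.mpr hx.symm, hzy, hy]
    have h3 : (z * z) • x = x := by
      rw [mul_smul, hzy, ← h2, smul_inv_smul]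
    have h4 := hfix _ (mul_mem hz hz) x h3
    have h5 : orderOf z ∣ 2 := orderOf_dvd_of_pow_eq_one (by rw [sq, h4])
    have h6 : orderOf z ∣ 7 := by
      rw [← hc, ← Nat.card_zpowers c]; exact Subgroup.orderOf_dvd_natCard _ hz
    have h7 : z = 1 := orderOf_eq_one_iff.mp (Nat.dvd_one.mp (Nat.dvd_gcd h5 h6))
    rw [← hzy, h7, one_smul]
  let σ : Equiv.Perm X := MulAction.toPerm t
  have hσ2 : σ ^ 2 = 1 := by
    ext1 x
    change t • t • x = x
    rw [← mul_smul, ← sq, ← ht, pow_orderOf_eq_one, one_smul]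
  have hsupp : σ.support.card = 6 := by
    have h1 : 2 ∣ σ.support.card := Equiv.Perm.two_dvd_card_support hσ2
    have h2 : σ.supportᶜ.card ≤ 1 := by
      rw [Finset.card_le_one]
      intro x hx y hy
      simp only [Finset.mem_compl, Equiv.Perm.mem_support, not_not] at hx hy
      exact huniq x y hx hy
    have h3 := Finset.card_add_card_compl σ.support
    rw [← Nat.card_eq_fintype_card, hX] at h3
    omega
  have hsign : Equiv.Perm.sign σ = -1 := by
    have h1 : orderOf σ = 2 := by
      refine orderOf_eq_prime hσ2 fun h => ?_
      rw [h] at hsupp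
      simp at hsupp
    obtain ⟨n, hn⟩ := Equiv.Perm.cycleType_prime_order (σ := σ) (by rw [h1]; norm_num)
    have h2 := σ.sum_cycleType
    rw [hn, h1, hsupp, Multiset.sum_replicate, smul_eq_mul] at h2
    have h3 : n = 2 := by omega
    rw [Equiv.Perm.sign_of_cycleType, hn, h1, h3]
    decide
  let f : G →* ℤˣ := Equiv.Perm.sign.comp (MulAction.toPermHom G X)
  rcases (inferInstance : f.ker.Normal).eq_bot_or_eq_top with h1 | h1
  · refine hnc fun a b => (MonoidHom.ker_eq_bot_iff f).mp h1 ?_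
    rw [map_mul, map_mul, mul_comm]
  · have h2 : t ∈ f.ker := h1 ▸ Subgroup.mem_top t
    have h3 : Equiv.Perm.sign σ = 1 := h2
    rw [hsign] at h3
    exact absurd h3 (by decide)

theorem card_sylow_three_of_504 (hG : Nat.card G = 504) (hnc : ¬ ∀ a b : G, a * b = b * a)
    (Q : Sylow 3 G) : Nat.card Q = 9 ∧ Nat.card (Sylow 3 G) = 28 ∧
      Nat.card ↥(Subgroup.normalizer (Q : Set G)) = 18 := by
  have := Fact.mk (by norm_num : Nat.Prime 3)
  obtain ⟨hQ, b, hb, h1, h2, h3⟩ := card_sylow_restrictions (k := 2) (m := 56) hnc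
    (by rw [hG]; norm_num) two_ne_zero (by norm_num) Q
  rw [hG] at h3
  have h7 : Nat.card (Sylow 3 G) ≠ 7 := fun h =>
    index_ne_seven_of_504 hG hnc _ (Q.card_eq_index_normalizer.symm.trans h)
  have hn : Nat.card (Sylow 3 G) = 28 := by
    have hle := Nat.le_of_dvd (by norm_num) (Dvd.intro b h1)
    interval_cases Nat.card (Sylow 3 G) <;> first | omega | (exfalso; revert h3; decide)
  refine ⟨hQ, hn, ?_⟩
  rw [hn] at h1
  omega

/-- An involution in the normalizer of a Sylow `3`-subgroup inverts it. -/
theorem exists_inverting_of_504 (hG : Nat.card G = 504) (hnc : ¬ ∀ a b : G, a * b = b * a)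
    (Q : Sylow 3 G) : ∃ t ∈ Subgroup.normalizer (Q : Set G), orderOf t = 2 ∧
      ∀ y ∈ Q, t * y * t⁻¹ = y⁻¹ := by
  have := Fact.mk (by norm_num : Nat.Prime 3)
  obtain ⟨hQ, -, hN⟩ := card_sylow_three_of_504 hG hnc Q
  have hcomm : ∀ a ∈ Q, ∀ b ∈ Q, a * b = b * a := fun a ha b hb =>
    congrArg Subtype.val (comm_of_card_eq_prime_pow (P := ↥(Q : Subgroup G)) (q := 3) (k := 2)
      hQ le_rfl ⟨a, ha⟩ ⟨b, hb⟩)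
  obtain ⟨⟨t, htN⟩, ht⟩ := exists_prime_orderOf_dvd_card'
    (G := ↥(Subgroup.normalizer (Q : Set G))) 2 (by rw [hN]; norm_num)
  rw [Subgroup.orderOf_mk] at ht
  refine ⟨t, htN, ht, fun y hy => ?_⟩
  have hty : t * y * t⁻¹ ∈ Q := (Subgroup.mem_normalizer_iff.mp htN y).mp hy
  have h1 := commute_mul_conj ht (hcomm y hy _ hty)
  have hwQ : y * (t * y * t⁻¹) ∈ Q := mul_mem hy hty
  refine (inv_eq_of_mul_eq_one_right (eq_one_of_commute_normalizer hnc Q hcomm hwQ ?_)).symm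
  set N := Subgroup.normalizer (Q : Set G)
  set C := Subgroup.centralizer {y * (t * y * t⁻¹)}
  have hQle : (Q : Subgroup G) ≤ C ⊓ N := le_inf
    (fun a ha => Subgroup.mem_centralizer_singleton_iff.mpr (hcomm a ha _ hwQ))
    Subgroup.le_normalizer
  have ht' : t ∈ C ⊓ N := ⟨Subgroup.mem_centralizer_singleton_iff.mpr h1.eq, htN⟩
  have h2 : 9 ∣ Nat.card ↥(C ⊓ N) := hQ ▸ Subgroup.card_dvd_of_le hQle
  have h3 : 2 ∣ Nat.card ↥(C ⊓ N) := ht ▸ (C ⊓ N).orderOf_dvd_natCard ht'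
  have h4 : 18 ≤ Nat.card ↥(C ⊓ N) := Nat.le_of_dvd Nat.card_pos (by omega)
  have h5 : C ⊓ N = N := Subgroup.eq_of_le_of_card_ge inf_le_right (by rw [hN]; exact h4)
  intro n hn
  rw [← h5] at hn
  exact Subgroup.mem_centralizer_singleton_iff.mp hn.1

/-- The centralizer of a nontrivial element of a Sylow `3`-subgroup is that subgroup. -/
theorem centralizer_eq_sylow_three_of_504 (hG : Nat.card G = 504)
    (hnc : ¬ ∀ a b : G, a * b = b * a) (Q : Sylow 3 G) {y : G} (hy : y ∈ Q) (hy1 : y ≠ 1) :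
    Subgroup.centralizer {y} = Q := by
  have := Fact.mk (by norm_num : Nat.Prime 3)
  have := Fact.mk (by norm_num : Nat.Prime 7)
  obtain ⟨hQ, -, hN⟩ := card_sylow_three_of_504 hG hnc Q
  have hcomm : ∀ a ∈ Q, ∀ b ∈ Q, a * b = b * a := fun a ha b hb =>
    congrArg Subtype.val (comm_of_card_eq_prime_pow (P := ↥(Q : Subgroup G)) (q := 3) (k := 2)
      hQ le_rfl ⟨a, ha⟩ ⟨b, hb⟩)
  obtain ⟨t, htN, ht, hinv⟩ := exists_inverting_of_504 hG hnc Q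
  set C := Subgroup.centralizer {y} with hC
  have hQC : (Q : Subgroup G) ≤ C := fun a ha =>
    Subgroup.mem_centralizer_singleton_iff.mpr (hcomm a ha y hy)
  have hoy : orderOf y ∣ 9 := hQ ▸ (Q : Subgroup G).orderOf_dvd_natCard hy
  have hoy1 : orderOf y ≠ 1 := fun h => hy1 (orderOf_eq_one_iff.mp h)
  have htC : t ∉ C := by
    intro h
    have h1 := Subgroup.mem_centralizer_singleton_iff.mp h
    have h2 : y = y⁻¹ := by rw [← hinv y hy, h1, mul_inv_cancel_right]
    have h3 : orderOf y ∣ 2 := orderOf_dvd_of_pow_eq_one (by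
      rw [sq]; nth_rewrite 2 [h2]; rw [mul_inv_cancel])
    exact hoy1 (Nat.dvd_one.mp (Nat.dvd_gcd h3 hoy))
  obtain ⟨m, hm⟩ : 9 ∣ Nat.card C := hQ ▸ Subgroup.card_dvd_of_le hQC
  have h7 : ¬ 7 ∣ Nat.card C := by
    refine not_dvd_card_centralizer (fun h => ?_) (card_centralizer_seven_of_504 hG hnc) rfl
    exact hoy1 (Nat.dvd_one.mp (Nat.dvd_gcd h hoy))
  have hCi := C.card_mul_index
  rw [hG, hm] at hCi
  have hm8 : m ∣ 8 * 7 := ⟨C.index, by linarith⟩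
  have hm8 : m ∣ 8 := Nat.Coprime.dvd_of_dvd_mul_right
    ((Nat.Prime.coprime_iff_not_dvd (by norm_num)).mpr fun h =>
      h7 (hm ▸ h.mul_left 9)).symm hm8
  have hle := Nat.le_of_dvd (by norm_num) hm8
  have hm1 : m = 1 := by
    by_contra hm1
    have hcases : m = 2 ∨ m = 4 ∨ m = 8 := by interval_cases m <;> omega
    rcases hcases with rfl | rfl | rfl
    · -- `Q` is normal in `C`, so `C` is the normalizer of `Q`
      have h1 : ((Q : Subgroup G).subgroupOf C).index = 2 := by
        have h2 := ((Q : Subgroup G).subgroupOf C).card_mul_index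
        rw [hm, Nat.card_congr (Subgroup.subgroupOfEquivOfLe hQC).toEquiv,
          show Nat.card ↥(Q : Subgroup G) = 9 from hQ] at h2
        omega
      have h2 : C ≤ Subgroup.normalizer (Q : Set G) :=
        (Subgroup.normal_subgroupOf_iff_le_normalizer hQC).mp (Subgroup.normal_of_index_eq_two h1)
      have h3 : C = Subgroup.normalizer (Q : Set G) :=
        Subgroup.eq_of_le_of_card_ge h2 (by rw [hm, hN])
      exact htC (h3 ▸ htN)
    · -- the normalizer of the group generated by `y` is too large
      set M := Subgroup.normalizer (Subgroup.zpowers y : Set G)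
      have h1 : C ≤ M := fun g hg => mem_normalizer_zpowers (Or.inl (by
        rw [Subgroup.mem_centralizer_singleton_iff.mp hg, mul_inv_cancel_right]))
      have h2 : t ∈ M := mem_normalizer_zpowers (Or.inr (hinv y hy))
      obtain ⟨k, hk⟩ : 36 ∣ Nat.card M := by
        have := Subgroup.card_dvd_of_le h1
        rwa [hm] at this
      have hk1 : k ≠ 1 := by
        rintro rfl
        have : C = M := Subgroup.eq_of_le_of_card_ge h1 (by rw [hm, hk])
        exact htC (this ▸ h2)
      have h3 := M.card_mul_index
      rw [hG, hk] at h3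
      have h4 : k * M.index = 14 := by linarith
      have h5 := index_ne_seven_of_504 hG hnc M
      by_cases hM : M = ⊤
      · have h6 : (Subgroup.zpowers y).Normal := Subgroup.normalizer_eq_top_iff.mp hM
        rcases h6.eq_bot_or_eq_top with h | h
        · exact hy1 (Subgroup.zpowers_eq_bot.mp h)
        · have h8 := Nat.card_zpowers y
          rw [h, Subgroup.card_top, hG] at h8
          rw [← h8] at hoy
          omega
      · have h6 := card_dvd_factorial_index hM
        rw [hG] at h6
        have h8 := Nat.le_of_dvd (by norm_num) (Dvd.intro_left k h4)
        interval_cases M.index <;> first | omega | (revert h6; decide)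
    · exact index_ne_seven_of_504 hG hnc C (by omega)
  exact (Subgroup.eq_of_le_of_card_ge hQC (by rw [hm, hm1]; exact hQ.ge)).symm

theorem card_centralizer_three_of_504 (hG : Nat.card G = 504) (hnc : ¬ ∀ a b : G, a * b = b * a)
    (y : G) (hy : orderOf y = 3) : Nat.card ↥(Subgroup.centralizer {y}) = 9 := by
  have := Fact.mk (by norm_num : Nat.Prime 3)
  obtain ⟨Q, hQ⟩ := exists_mem_sylow_of_orderOf (p := 3) (k := 1) hy
  rw [centralizer_eq_sylow_three_of_504 hG hnc Q hQ
    (by rintro rfl; rw [orderOf_one] at hy; omega)]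
  exact (card_sylow_three_of_504 hG hnc Q).1

theorem card_centralizer_two_of_504 (hG : Nat.card G = 504) (hnc : ¬ ∀ a b : G, a * b = b * a)
    {z : G} (hz : orderOf z = 2) : Nat.card ↥(Subgroup.centralizer {z}) ∣ 8 := by
  have := Fact.mk (by norm_num : Nat.Prime 7)
  have := Fact.mk (by norm_num : Nat.Prime 3)
  have h3 := not_dvd_card_centralizer (by norm_num) (card_centralizer_three_of_504 hG hnc) hz
  have h7 := not_dvd_card_centralizer (by norm_num) (card_centralizer_seven_of_504 hG hnc) hz
  have h2 : Nat.card ↥(Subgroup.centralizer {z}) ∣ 8 * (3 ^ 2 * 7) := by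
    have := (Subgroup.centralizer {z}).card_subgroup_dvd_card
    rwa [hG] at this
  refine Nat.Coprime.dvd_of_dvd_mul_right (Nat.Coprime.mul_right (Nat.Coprime.pow_right 2 ?_) ?_) h2
  · exact ((Nat.Prime.coprime_iff_not_dvd (by norm_num)).mpr h3).symm
  · exact ((Nat.Prime.coprime_iff_not_dvd (by norm_num)).mpr h7).symm

/-- The Sylow subgroups for `7` and `3` have `36 * 6 + 28 * 8` nontrivial elements, and an
involution has at least `63` conjugates. As `1 + 216 + 224 + 63 = 504`, each element of the group
lies in such a Sylow subgroup or is an involution. -/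
theorem orderOf_ne_four_of_504 (hG : Nat.card G = 504) (hnc : ¬ ∀ a b : G, a * b = b * a)
    (g : G) : orderOf g ≠ 4 := by
  classical
  intro hg
  have := Fact.mk (by norm_num : Nat.Prime 7)
  have := Fact.mk (by norm_num : Nat.Prime 3)
  have hz : orderOf (g ^ 2) = 2 := by
    rw [orderOf_pow_of_dvd (by norm_num) (by rw [hg]; norm_num), hg]
  let O := MulAction.orbit (ConjAct G) (g ^ 2)
  have hO : 63 ≤ Nat.card O := by
    have h1 := (MulAction.stabilizer (ConjAct G) (g ^ 2)).index_mul_card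
    rw [MulAction.index_stabilizer, ← Subgroup.nat_card_centralizer_nat_card_stabilizer,
      show Nat.card (ConjAct G) = 504 from hG, ← Nat.card_coe_set_eq] at h1
    have h2 := Nat.le_of_dvd (by norm_num) (card_centralizer_two_of_504 hG hnc hz)
    change Nat.card O * _ = _ at h1
    nlinarith
  have hOo : ∀ w : O, orderOf (w : G) = 2 := by
    rintro ⟨_, x, rfl⟩
    change orderOf (x • g ^ 2) = 2
    rw [ConjAct.smul_def]
    exact (orderOf_injective (MulAut.conj (ConjAct.ofConjAct x)).toMonoidHom
      (MulAut.conj (ConjAct.ofConjAct x)).injective (g ^ 2)).trans hz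
  cases nonempty_fintype (Sylow 7 G)
  cases nonempty_fintype (Sylow 3 G)
  cases nonempty_fintype O
  let F : Sylow 7 G ⊕ Sylow 3 G ⊕ O → Subgroup G :=
    Sum.elim (fun S => S) (Sum.elim (fun Q => Q) fun w => Subgroup.zpowers (w : G))
  have h7 : ∀ S, Nat.card ↥(F (Sum.inl S)) = 7 := fun S => (card_sylow_seven_of_504 hG hnc S).1
  have h3 : ∀ Q, Nat.card ↥(F (Sum.inr (Sum.inl Q))) = 9 := fun Q =>
    (card_sylow_three_of_504 hG hnc Q).1
  have h2 : ∀ w, Nat.card ↥(F (Sum.inr (Sum.inr w))) = 2 := fun w =>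
    (Nat.card_zpowers _).trans (hOo w)
  have hcop : ∀ i j, (Nat.card ↥(F i)).Coprime (Nat.card ↥(F j)) → F i ⊓ F j = ⊥ := fun i j h => by
    rw [← disjoint_iff]
    exact Subgroup.disjoint_of_coprime_natCard h
  have hF : ∀ i j, i ≠ j → F i ⊓ F j = ⊥ := by
    rintro (S | Q | w) (S' | Q' | w') hne
    · exact inf_eq_bot_of_prime_card (p := 7) (by norm_num) (h7 S) (h7 S')
        fun h => hne (congrArg Sum.inl (Sylow.ext h))
    · exact hcop _ _ (by rw [h7, h3]; norm_num)
    · exact hcop _ _ (by rw [h7, h2]; norm_num)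
    · exact hcop _ _ (by rw [h3, h7]; norm_num)
    · rw [Subgroup.eq_bot_iff_forall]
      rintro x ⟨hx, hx'⟩
      by_contra hx1
      have h4 := (centralizer_eq_sylow_three_of_504 hG hnc Q hx hx1).symm.trans
        (centralizer_eq_sylow_three_of_504 hG hnc Q' hx' hx1)
      exact hne (congrArg (fun Q => Sum.inr (Sum.inl Q)) (Sylow.ext h4))
    · exact hcop _ _ (by rw [h3, h2]; norm_num)
    · exact hcop _ _ (by rw [h2, h7]; norm_num)
    · exact hcop _ _ (by rw [h2, h3]; norm_num)
    · refine inf_eq_bot_of_prime_card (p := 2) (by norm_num) (h2 w) (h2 w') fun h => ?_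
      have h4 : (w : G) ∈ Subgroup.zpowers (w' : G) := by
        have h5 := Subgroup.mem_zpowers (w : G)
        rwa [show Subgroup.zpowers (w : G) = Subgroup.zpowers (w' : G) from h] at h5
      obtain ⟨i, hi, h5⟩ := (mem_zpowers_iff_mem_range_orderOf (x := (w' : G))).mp h4 |>
        Finset.mem_image.mp
      rw [Finset.mem_range, hOo w'] at hi
      interval_cases i
      · have h6 := hOo w
        rw [← h5, pow_zero, orderOf_one] at h6
        omega
      · rw [pow_one] at h5
        exact hne (congrArg (fun w => Sum.inr (Sum.inr w)) (Subtype.ext h5.symm))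
  obtain ⟨i, hi⟩ := (card_le_and_exists_mem_of_disjoint F hF).2 (by
    rw [Fintype.sum_sum_type, Fintype.sum_sum_type]
    simp only [h7, h3, h2, Finset.sum_const, Finset.card_univ, smul_eq_mul,
      Fintype.card_eq_nat_card]
    rw [(card_sylow_seven_of_504 hG hnc default).2.1, (card_sylow_three_of_504 hG hnc default).2.1,
      hG]
    omega) g (by rintro rfl; rw [orderOf_one] at hg; omega)
  have h4 := Subgroup.orderOf_dvd_natCard _ hi
  rw [hg] at h4
  rcases i with S | Q | w
  · rw [h7] at h4; omega
  · rw [h3] at h4; omega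
  · rw [h2] at h4; omega

theorem pow_eq_one_of_504 (hG : Nat.card G = 504) (hnc : ¬ ∀ a b : G, a * b = b * a)
    (g : G) : g ^ 126 = 1 := by
  rw [← orderOf_dvd_iff_pow_eq_one]
  have h1 : orderOf g ∣ 504 := hG ▸ orderOf_dvd_natCard g
  have h4 : ¬ 4 ∣ orderOf g := fun h => by
    obtain ⟨t, ht⟩ := exists_pow_orderOf_eq h
    exact orderOf_ne_four_of_504 hG hnc _ ht
  have key : ∀ d ∈ Nat.divisors 504, ¬ 4 ∣ d → d ∣ 126 := by decide +kernel
  exact key _ (Nat.mem_divisors.mpr ⟨h1, by norm_num⟩) h4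

/-- The `3`-subgroups of a group of order `504` are commutative, so that only the commutative case
of the hypothesis on elementary subgroups occurs. -/
theorem cyclotomicCharacters_le_monomialSpan_of_504 [Fintype G] (hG : Nat.card G = 504)
    (hnc : ¬ ∀ a b : G, a * b = b * a) :
    (cyclotomicCharacters 42 G).toAddSubgroup ≤ monomialSpan QBar 42 G := by
  refine cyclotomicCharacters_le_monomialSpan (r := 3) (by norm_num) (by norm_num) (by norm_num)
    (fun g => pow_eq_one_of_504 hG hnc g) (exists_comm_subgroup_of_card_dvd (by rw [hG]; norm_num))
    fun x P hel => Or.inl fun a ha b hb => ?_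
  have := Fact.mk (by norm_num : Nat.Prime 3)
  obtain ⟨Q, hPQ⟩ := hel.isPGroup.exists_le_sylow
  exact congrArg Subtype.val (comm_of_card_eq_prime_pow (P := ↥(Q : Subgroup G)) (q := 3) (k := 2)
    (card_sylow_three_of_504 hG hnc Q).1 le_rfl ⟨a, hPQ ha⟩ ⟨b, hPQ hb⟩)

end Order504

/-! ### The Brauer induction for the three orders -/

section Conclusion

/-- Since `-1` lies in every field, `ℚ(ζ_2n) = ℚ(ζ_n)` for odd `n`. -/
theorem mem_cyclotomicSubfield_of_pow_two_mul {n : ℕ} (hn : Odd n) {z : QBar}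
    (hz : z ^ (2 * n) = 1) : z ∈ cyclotomicSubfield n := by
  have h1 : z ^ n * z ^ n = 1 := by rw [← pow_add, ← two_mul, hz]
  rcases mul_self_eq_one_iff.mp h1 with h2 | h2
  · exact mem_cyclotomicSubfield_of_pow h2
  · rw [← neg_neg z]
    exact neg_mem (mem_cyclotomicSubfield_of_pow (by rw [hn.neg_pow, h2, neg_neg]))

theorem cyclotomicSubfield_le_of_dvd {m n : ℕ} (h : m ∣ n) :
    cyclotomicSubfield m ≤ cyclotomicSubfield n := by
  refine IntermediateField.adjoin_le_iff.mpr fun z hz => mem_cyclotomicSubfield_of_pow ?_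
  obtain ⟨t, rfl⟩ := h
  rw [pow_mul, show z ^ m = 1 from hz, one_pow]

theorem exists_eq_sum_of_mem_monomialSpan {G : Type*} [Group G] [Fintype G] {n : ℕ} {f : G → QBar}
    (hf : f ∈ monomialSpan QBar n G) :
    ∃ (m : ℕ) (H : Fin m → Subgroup G) (ψ : ∀ i, H i →* QBar) (a : Fin m → ℤ),
      (∀ i h, ψ i h ^ n = 1) ∧ ∀ g, f g = ∑ i, (a i : QBar) * indChar (H i) (ψ i) g := by
  induction hf using AddSubgroup.closure_induction with
  | mem f hf =>
    obtain ⟨H, ψ, hψ, rfl⟩ := hf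
    exact ⟨1, fun _ => H, fun _ => ψ, fun _ => 1, fun _ => hψ, fun g => by
      simp [indChar_eq_ind]⟩
  | zero => exact ⟨0, Fin.elim0, fun i => i.elim0, Fin.elim0, fun i => i.elim0, fun g => by simp⟩
  | add f f' _ _ h h' =>
    obtain ⟨m, H, ψ, a, hψ, hf⟩ := h
    obtain ⟨m', H', ψ', a', hψ', hf'⟩ := h'
    let c : Fin m ⊕ Fin m' → Σ H : Subgroup G, H →* QBar :=
      Sum.elim (fun i => ⟨H i, ψ i⟩) fun i => ⟨H' i, ψ' i⟩
    have hc : ∀ j (h : (c j).1), (c j).2 h ^ n = 1 := by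
      rintro (i | i)
      · exact hψ i
      · exact hψ' i
    refine ⟨m + m', fun i => (c (finSumFinEquiv.symm i)).1, fun i => (c (finSumFinEquiv.symm i)).2,
      fun i => Sum.elim a a' (finSumFinEquiv.symm i), fun i => hc _, fun g => ?_⟩
    rw [Pi.add_apply, hf, hf']
    refine Eq.trans ?_ (Equiv.sum_comp finSumFinEquiv.symm fun j =>
      ((Sum.elim a a' j : ℤ) : QBar) * indChar (c j).1 (c j).2 g).symm
    rw [Fintype.sum_sum_type]
    rfl
  | neg f _ h =>
    obtain ⟨m, H, ψ, a, hψ, hf⟩ := h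
    exact ⟨m, H, ψ, fun i => -a i, hψ, fun g => by simp [hf, Finset.sum_neg_distrib]⟩

/-- The number `n` is `42` or `126` when `7` divides the order, so that the `n`-th roots of unity are
the `k`-th ones up to sign for `k = n / 2`, and it is `60` otherwise. -/
theorem exists_brauer_of_card (G : Type*) [Group G] [Fintype G] [IsSimpleGroup G]
    (hG : Nat.card G = 168 ∨ Nat.card G = 504 ∨ Nat.card G = 360)
    {χ : G → QBar} (hχ : χ ∈ virtualCharacters QBar G) :
    ∃ n, χ ∈ monomialSpan QBar n G ∧
      ∀ z : QBar, z ^ n = 1 → z ∈ cyclotomicSubfield (rootOrder G χ) := by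
  have hnc : ¬ ∀ a b : G, a * b = b * a := not_comm_of_card_not_prime (by
    rcases hG with h | h | h <;> rw [h] <;> norm_num)
  rcases hG with h | h | h
  · refine ⟨42, virtualCharacters_le_monomialSpan_of_168 h hnc hχ, fun z hz => ?_⟩
    rw [rootOrder, if_pos (by rw [h]; norm_num), if_neg (by rw [h]; norm_num)]
    exact mem_cyclotomicSubfield_of_pow_two_mul (by decide) hz
  · by_cases hval : ∃ g, χ g ∉ cyclotomicSubfield 21
    · refine ⟨126, virtualCharacters_le_monomialSpan 126 (pow_eq_one_of_504 h hnc)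
        (exists_comm_subgroup_of_card_dvd (by rw [h]; norm_num)) hχ, fun z hz => ?_⟩
      rw [rootOrder, if_pos (by rw [h]; norm_num), if_pos ⟨h, hval⟩]
      exact mem_cyclotomicSubfield_of_pow_two_mul (by decide) hz
    · push Not at hval
      refine ⟨42, cyclotomicCharacters_le_monomialSpan_of_504 h hnc ⟨hχ, fun g =>
        cyclotomicSubfield_le_of_dvd (by norm_num) (hval g)⟩, fun z hz => ?_⟩
      rw [rootOrder, if_pos (by rw [h]; norm_num), if_neg fun h' => h'.2.elim fun g hg => hg (hval g)]
      exact mem_cyclotomicSubfield_of_pow_two_mul (by decide) hz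
  · refine ⟨60, virtualCharacters_le_monomialSpan 60 (pow_eq_one_of_360 h hnc)
      (exists_comm_subgroup_of_card_dvd (by rw [h]; norm_num)) hχ, fun z hz => ?_⟩
    rw [rootOrder, if_neg (by rw [h]; norm_num)]
    exact mem_cyclotomicSubfield_of_pow hz

theorem rootOrder_pos (G : Type*) (χ : G → QBar) : 0 < rootOrder G χ := by
  unfold rootOrder
  split_ifs <;> norm_num

end Conclusion

theorem theorem1p1
    -- `G` is a simple group of order 168, 504 or 360
    (G : Type*) [Group G] [Fintype G] [IsSimpleGroup G]
    (hG : Nat.card G = 168 ∨ Nat.card G = 504 ∨ Nat.card G = 360)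
    -- `χ = ρ.character` is an irreducible character of `G`, of degree `finrank V`
    (V : Type*) [AddCommGroup V] [Module QBar V] [FiniteDimensional QBar V]
    (ρ : Representation QBar G V) [ρ.IsIrreducible]
    (hχ : Nat.card G ≠ 360 ∨ Module.finrank QBar V ≠ 8) :
    -- the Brauer induction `χ = ∑ a_i Ind_{H_i}^G ψ_i`
    ∃ (m : ℕ) (H : Fin m → Subgroup G) (ψ : ∀ i, H i →* QBar) (a : Fin m → ℤ),
      (∀ g : G, ρ.character g = ∑ i, (a i : QBar) * indChar (H i) (ψ i) g) ∧
      -- the finite set of exceptional primes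
      ∃ S : Finset ℕ, ∀ (p : ℕ) [Fact p.Prime], ¬ p ∣ Nat.card G → p ∉ S →
        -- the embedding through which characters are regarded as `p`-adic ones
        ∀ ι : QBar →+* PadicAlgCl p,
        -- the idempotents of `χ` and of the `ψ_i` have coefficients in `ℤ_p[ζ_k]`
        ∃ (e : (ZpZeta p (rootOrder G ρ.character))[G])
          (f : Fin m → (ZpZeta p (rootOrder G ρ.character))[G]),
          groupRingIncl p (rootOrder G ρ.character) G e =
            charIdem (fun g => ι (ρ.character g)) ∧
          (∀ i, groupRingIncl p (rootOrder G ρ.character) G (f i) =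
            subgroupIdem (H i) (fun h => ι (ψ i h))) ∧
          -- `M` is a `ℤ_p[ζ_k][G]`-module, with the induced `ℤ_p[ζ_k]`- and `ℤ_p`-structures
          ∀ (M : Type*) [AddCommGroup M]
            [Module (ZpZeta p (rootOrder G ρ.character)) M]
            [Module (ZpZeta p (rootOrder G ρ.character))[G] M]
            [IsScalarTower (ZpZeta p (rootOrder G ρ.character))
              (ZpZeta p (rootOrder G ρ.character))[G] M]
            [Module ℤ_[p] M] [IsScalarTower ℤ_[p] (ZpZeta p (rootOrder G ρ.character)) M],
            ∃ N : Submodule (ZpZeta p (rootOrder G ρ.character)) M,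
              Nonempty (idemPart e M ≃ₗ[ℤ_[p]] (Fin (Module.finrank QBar V) → N)) ∧
              (Finite M →
                (Nat.card N : ℚ) = ∏ i, (Nat.card (idemPart (f i) M) : ℚ) ^ (a i)) := by
  obtain ⟨n, hn, hk⟩ := exists_brauer_of_card G hG (character_mem_virtualCharacters ρ)
  obtain ⟨m, H, ψ, a, hψ, hsum⟩ := exists_eq_sum_of_mem_monomialSpan hn
  obtain ⟨S, hS⟩ := exists_idempotents_of_brauer G V ρ (rootOrder_pos G ρ.character) m H ψ a
    (fun i h => hk _ (hψ i h)) hsum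
  exact ⟨m, H, ψ, a, hsum, S, fun p _ _ hpS ι => hS p hpS ι⟩
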